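/- Throughout $\mathbb N=\{1,2,\dots\}$, $\mathbb N_0=\mathbb N\cup\{0\}$, $\Phi_m$ is the $m$-th cyclotomic polynomial, $v_p(m)$ is the exponent of the prime $p$ in $m$ and $\pi_p(m)=m\,p^{-v_p(m)}$. An *excellent order* $\succ$ with bound $s(\succ)\in\mathbb N_0$ is a strict total order on $\{0,1,\dots,s(\succ)\}$ such that, with $S(\succ):=\{k : k\succ 0\}$, the order $\succ$ equals $>$ on $S(\succ)\cup\{0\}$ and equals $<$ on $\{0,\dots,s(\succ)\}\setminus S(\succ)$. The tensor product $\succ_1\otimes\succ_2$ of two excellent orders is the excellent order with $s(\succ_1\otimes\succ_2)=\max(s(\succ_1),s(\succ_2))$ and $S(\succ_1\otimes\succ_2)=(S(\succ_1)\cup S(\succ_2))\setminus(S(\succ_1)\cap S(\succ_2))$. Let $(\succ_p)_{p\in P}$ be a tuple of excellent orders for a finite set $P$ of primes, and let $V=\{\prod_{p\in P}p^{k_p} : 0\le k_p\le s(\succ_p)\}$. A map $\chi:\mathbb N\to\mathbb N_0$ with finite support is *compatible* with $(\succ_p)_{p\in P}$ if $P$ contains all primes dividing elements of $\operatorname{supp}(\chi)$,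 if $\operatorname{supp}(\chi)\subset V$, and if $\chi(m_a)\ge\chi(m_b)$ for all $p\in P$ and all $m_a,m_b\in V$ with $\pi_p(m_a)=\pi_p(m_b)$ and $v_p(m_a)\succ_p v_p(m_b)$. For monic $f=\prod_j(t-\lambda_j)$ and $g=\prod_i(t-\kappa_i)$ in $\mathbb C[t]$ let $f\otimes g:=\prod_{j,i}(t-\lambda_j\kappa_i)$. For a finite set $M\subset\mathbb N$ let $\mathrm{Or}(M)$ be the lattice $\mathbb Z[t]/(\prod_{m\in M}\Phi_m)$ together with the endomorphism multiplication by $t$. The *standard covering* of $\chi$ is the tuple $(M_1,\dots,M_{l_\chi})$ with $l_\chi=\max\chi$ and $M_j=\{m\in\operatorname{supp}(\chi) : \chi(m)\ge j\}$. A pair $(H,h)$ of a $\mathbb Z$-lattice of rank $n\ge1$ and an endomorphism is an *Orlik block* if $h$ is an automorphism of finite order and $H=\bigoplus_{j=0}^{n-1}\mathbb Z\,h^j(a_0)$ for some $a_0\in H$. A *standard decomposition into Orlik blocks* of a lattice with endomorphism $(H,h)$ is a decomposition $H=\bigoplus_{i=1}^kH^{(i)}$ ($k\ge0$) into $h$-invariant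 sublattices such that each $(H^{(i)},h|_{H^{(i)}})$ is an Orlik block, and such that the characteristic polynomial of $h|_{H^{(j)}}$ divides that of $h|_{H^{(i)}}$ whenever $i\le j$. **Theorem 9.10.** Let $\chi_1,\chi_2:\mathbb N\to\mathbb N_0$ be maps with finite supports. Then there is a unique map $\chi_3:\mathbb N\to\mathbb N_0$ with finite support such that $$\Bigl(\prod_{m}\Phi_m^{\chi_1(m)}\Bigr)\otimes\Bigl(\prod_{n}\Phi_n^{\chi_2(n)}\Bigr)=\prod_{l}\Phi_l^{\chi_3(l)}.$$ Let $P$ be a finite set of primes, which contains all primes dividing elements of $\operatorname{supp}(\chi_1)\cup\operatorname{supp}(\chi_2)$, and let $(\succ^M_p)_{p\in P}$ and $(\succ^N_p)_{p\in P}$ be tuples of excellent orders such that $\chi_1$ is compatible with $(\succ^M_p)_{p\in P}$ and $\chi_2$ is compatible with $(\succ^N_p)_{p\in P}$. (a) $\chi_3$ is compatible with the tuple $(\succ^M_p\otimes\succ^N_p)_{p\in P}$. (b) Let $(M_i)_{i\le l_{\chi_1}}$, $(N_j)_{j\le l_{\chi_2}}$ and $(L_k)_{k\le l_{\chi_3}}$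 be the standard coverings of $\chi_1$, $\chi_2$ and $\chi_3$. Then there is an isomorphism of lattices with endomorphism $$\Bigl(\bigoplus_{i=1}^{l_{\chi_1}}\mathrm{Or}(M_i)\Bigr)\otimes\Bigl(\bigoplus_{j=1}^{l_{\chi_2}}\mathrm{Or}(N_j)\Bigr)\cong\bigoplus_{k=1}^{l_{\chi_3}}\mathrm{Or}(L_k),$$ where the tensor product carries the tensor product of the two endomorphisms. In particular the tensor product on the left hand side admits a standard decomposition into Orlik blocks. -/

import Mathlib

open Polynomial TensorProduct DirectSum

noncomputable section

namespace OrlikTensor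

/-! ### Excellent orders -/

/-- An excellent order: a strict total order `≻` on `{0, …, s}` (`succ a b` is `a ≻ b`; the
relation is `False` outside of `{0, …, s}`) which is determined by the set `S = {k | k ≻ 0}`:
it equals `>` on `S ∪ {0}` and it equals `<` on `{0, …, s} \ S`. -/
@[ext]
structure ExcellentOrder where
  /-- the bound `s(≻)` -/
  s : ℕ
  /-- the relation `a ≻ b` -/
  succ : ℕ → ℕ → Prop
  le_bound : ∀ a b, succ a b → a ≤ s ∧ b ≤ s
  irrefl : ∀ a, ¬ succ a a
  trans : ∀ a b c, succ a b → succ b c → succ a c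
  trichotomous : ∀ a b, a ≤ s → b ≤ s → a = b ∨ succ a b ∨ succ b a
  eq_gt : ∀ a b, a ≤ s → b ≤ s → (succ a 0 ∨ a = 0) → (succ b 0 ∨ b = 0) → (succ a b ↔ a > b)
  eq_lt : ∀ a b, a ≤ s → b ≤ s → ¬ succ a 0 → ¬ succ b 0 → (succ a b ↔ a < b)

namespace ExcellentOrder

/-- The set `S(≻) = {k ∈ {0, …, s(≻)} | k ≻ 0}`. -/
def S (o : ExcellentOrder) : Set ℕ := {k | k ≤ o.s ∧ o.succ k 0}

lemma S_subset (o : ExcellentOrder) : o.S ⊆ Set.Icc 1 o.s := by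
  rintro k ⟨hk, h⟩
  refine ⟨?_, hk⟩
  rcases Nat.eq_zero_or_pos k with rfl | h0
  · exact absurd h (o.irrefl 0)
  · exact h0

/-- The excellent order with bound `s` and with `S(≻) = S`, for a given set `S ⊆ {1, …, s}`. -/
def ofSet (s : ℕ) (S : Set ℕ) (hS : S ⊆ Set.Icc 1 s) : ExcellentOrder where
  s := s
  succ a b := a ≤ s ∧ b ≤ s ∧
    ((a ∈ S ∧ b ∈ S ∧ a > b) ∨ (a ∈ S ∧ b ∉ S) ∨ (a ∉ S ∧ b ∉ S ∧ a < b))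
  le_bound a b h := ⟨h.1, h.2.1⟩
  irrefl a h := by grind
  trans a b c h₁ h₂ := by grind
  trichotomous a b ha hb := by grind
  eq_gt a b ha hb h₁ h₂ := by
    have h0 : (0 : ℕ) ∉ S := fun h => by simpa using (hS h).1
    have hpos : ∀ k ∈ S, 1 ≤ k := fun k hk => (hS hk).1
    grind
  eq_lt a b ha hb h₁ h₂ := by
    have h0 : (0 : ℕ) ∉ S := fun h => by simpa using (hS h).1
    grind

lemma S_ofSet (s : ℕ) (S : Set ℕ) (hS : S ⊆ Set.Icc 1 s) : (ofSet s S hS).S = S := by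
  have h0 : (0 : ℕ) ∉ S := fun h => by simpa using (hS h).1
  ext k
  have hk : k ∈ S → k ≤ s := fun h => (hS h).2
  simp only [ExcellentOrder.S, ofSet, Set.mem_ofPred_eq]
  grind

/-- An excellent order is determined by `s(≻)` and `S(≻)`. -/
lemma ext_of_S (o₁ o₂ : ExcellentOrder) (hs : o₁.s = o₂.s) (hS : o₁.S = o₂.S) : o₁ = o₂ := by
  have key : ∀ o : ExcellentOrder, ∀ a b, o.succ a b ↔ a ≤ o.s ∧ b ≤ o.s ∧
      ((a ∈ o.S ∧ b ∈ o.S ∧ a > b) ∨ (a ∈ o.S ∧ b ∉ o.S) ∨ (a ∉ o.S ∧ b ∉ o.S ∧ a < b)) := by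
    intro o a b
    have h1 := o.le_bound a b
    have h2 := o.irrefl
    have h3 := o.trans
    have h4 := o.trichotomous
    have h5 := o.eq_gt a b
    have h6 := o.eq_lt a b
    have h7 := h3 a b 0
    have h8 := h3 b 0 a
    have h9 := h3 a 0 b
    have h10 := h4 b 0
    have h11 := h3 b a 0
    simp only [ExcellentOrder.S, Set.mem_ofPred_eq]
    grind
  refine ExcellentOrder.ext hs ?_
  funext a b
  rw [key o₁, key o₂, hs, hS]

/-- The tensor product of two excellent orders: the excellent order with bound
`max (s(≻₁), s(≻₂))` and with `S = (S(≻₁) ∪ S(≻₂)) \ (S(≻₁) ∩ S(≻₂))`. -/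
def tensor (o₁ o₂ : ExcellentOrder) : ExcellentOrder :=
  ofSet (max o₁.s o₂.s) ((o₁.S ∪ o₂.S) \ (o₁.S ∩ o₂.S)) (by
    rintro k ⟨h | h, -⟩
    · exact ⟨(o₁.S_subset h).1, le_max_of_le_left (o₁.S_subset h).2⟩
    · exact ⟨(o₂.S_subset h).1, le_max_of_le_right (o₂.S_subset h).2⟩)

end ExcellentOrder

/-! ### Compatibility of a map `χ` with a tuple of excellent orders -/

/-- `v_p(m)`. -/
def val (p : Nat.Primes) (m : ℕ+) : ℕ := (m : ℕ).factorization p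

/-- The projection `π_p(m) = m · p ^ (-v_p(m))`. -/
def proj (p : Nat.Primes) (m : ℕ+) : ℕ := (m : ℕ) / (p : ℕ) ^ val p m

/-- The set of prime numbers which divide some element of `M`. -/
def primesOf (M : Finset ℕ+) : Set Nat.Primes := {p | ∃ m ∈ M, 0 < val p m}

/-- The quadrant `V = {∏_{p ∈ P} p ^ k_p | 0 ≤ k_p ≤ s(≻_p)}`. -/
def quadrant {P : Finset Nat.Primes} (o : P → ExcellentOrder) : Set ℕ+ :=
  {m | ∃ k : P → ℕ, (∀ p, k p ≤ (o p).s) ∧ (m : ℕ) = ∏ p : P, (p.1 : ℕ) ^ k p}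

/-- The `p`-edges `(a, b)` of the directed graph on the quadrant. -/
def IsPEdge {P : Finset Nat.Primes} (o : P → ExcellentOrder) (p : P) (a b : ℕ+) : Prop :=
  a ∈ quadrant o ∧ b ∈ quadrant o ∧ proj p a = proj p b ∧ (o p).succ (val p a) (val p b)

/-- The edges `(a, b)` of the directed graph on the quadrant. -/
def IsEdge {P : Finset Nat.Primes} (o : P → ExcellentOrder) (a b : ℕ+) : Prop :=
  ∃ p : P, IsPEdge o p a b

/-- Compatibility of a map `χ : {1, 2, …} → {0, 1, …}` with finite support with a tuple
`(≻_p)_{p ∈ P}` of excellent orders. -/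
structure IsCompatible {P : Finset Nat.Primes} (χ : ℕ+ →₀ ℕ) (o : P → ExcellentOrder) :
    Prop where
  primesOf_subset : primesOf χ.support ⊆ P
  support_subset : (χ.support : Set ℕ+) ⊆ quadrant o
  mono : ∀ a b, IsEdge o a b → χ a ≥ χ b

/-! ### Products of cyclotomic polynomials and their tensor product -/

/-- `∏_m Φ_m ^ χ(m)`, with complex coefficients. -/
def cycloProd (χ : ℕ+ →₀ ℕ) : ℂ[X] := χ.prod fun m e => cyclotomic (m : ℕ) ℂ ^ e

/-- The tensor product of two monic polynomials `f = ∏ (t - λ_j)` and `g = ∏ (t - κ_i)`, namely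
`∏ (t - λ_j κ_i)`, where zeros are counted with multiplicity. -/
def polyTensor (f g : ℂ[X]) : ℂ[X] :=
  ((f.roots ×ˢ g.roots).map fun z => X - C (z.1 * z.2)).prod

/-! ### Lattices with endomorphism, Orlik blocks -/

section Lattices

/-! The notions of this section are needed for lattices over `R = ℤ`. -/

variable {R : Type*} [CommRing R]

/-- Two modules with endomorphism `(G, g)` and `(H, h)` are isomorphic. -/
def PairIso {G H : Type*} [AddCommGroup G] [Module R G] [AddCommGroup H] [Module R H]
    (g : Module.End R G) (h : Module.End R H) : Prop :=
  ∃ e : G ≃ₗ[R] H, ∀ x, e (g x) = h (e x)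

/-- The pair `(H, h)`, for a lattice `H` of rank `n ≥ 1`, is a companion block: for some
`a₀ ∈ H`, the elements `h ^ j (a₀)`, `0 ≤ j < n`, form a basis of `H`. -/
def IsCompanionBlock {H : Type*} [AddCommGroup H] [Module R H] (h : Module.End R H) : Prop :=
  0 < Module.finrank R H ∧
    ∃ (a₀ : H) (b : Module.Basis (Fin (Module.finrank R H)) R H), ∀ j, b j = (h ^ (j : ℕ)) a₀

/-- An Orlik block is a companion block `(H, h)` such that `h` is an automorphism of finite order
(an endomorphism with `h ^ n = 1` for some `n ≥ 1` is an automorphism). -/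
def IsOrlikBlock {H : Type*} [AddCommGroup H] [Module R H] (h : Module.End R H) : Prop :=
  IsCompanionBlock h ∧ IsOfFinOrder h

/-- The lattice `H` with endomorphism `h` admits a standard decomposition into Orlik blocks: `H`
is the direct sum of `h`-invariant sublattices `B 0, …, B (k - 1)`, each of them is an Orlik
block, and the characteristic polynomial of `h` on `B j` divides the one on `B i` for `i ≤ j`. -/
def HasStandardOrlikDecomposition [IsDomain R] [IsPrincipalIdealRing R] {H : Type*}
    [AddCommGroup H] [Module R H] [Module.Free R H] [Module.Finite R H]
    (h : Module.End R H) : Prop :=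
  ∃ (k : ℕ) (B : Fin k → Submodule R H) (hB : ∀ i, ∀ x ∈ B i, h x ∈ B i),
    DirectSum.IsInternal B ∧
    (∀ i, IsOrlikBlock (h.restrict (hB i))) ∧
    ∀ i j, i ≤ j → (h.restrict (hB j)).charpoly ∣ (h.restrict (hB i)).charpoly

end Lattices

/-- The polynomial `∏_{m ∈ M} Φ_m` with integer coefficients. -/
def orPoly (M : Finset ℕ+) : ℤ[X] := ∏ m ∈ M, cyclotomic (m : ℕ) ℤ

lemma orPoly_monic (M : Finset ℕ+) : (orPoly M).Monic :=
  monic_prod_of_monic _ _ fun m _ => cyclotomic.monic (m : ℕ) ℤ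

/-- The lattice `ℤ[t] / (∏_{m ∈ M} Φ_m)` of the Orlik block `Or(M)`. -/
abbrev OrBlock (M : Finset ℕ+) : Type := AdjoinRoot (orPoly M)

instance (M : Finset ℕ+) : Module.Free ℤ (OrBlock M) :=
  Module.Free.of_basis (AdjoinRoot.powerBasis' (orPoly_monic M)).basis

instance (M : Finset ℕ+) : Module.Finite ℤ (OrBlock M) :=
  Module.Finite.of_basis (AdjoinRoot.powerBasis' (orPoly_monic M)).basis

/-- The endomorphism of `Or(M)`: multiplication by `t`. -/
def orEnd (M : Finset ℕ+) : Module.End ℤ (OrBlock M) :=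
  LinearMap.mulLeft ℤ (AdjoinRoot.root (orPoly M))

/-! ### Standard coverings -/

/-- `l_χ = max χ`, the length of the standard covering of `χ` (`0` for `χ = 0`). -/
def coverLength (χ : ℕ+ →₀ ℕ) : ℕ := χ.support.sup χ

/-- The `j`-th set `{m ∈ supp χ | χ(m) ≥ j}` of the standard covering of `χ`,
for `1 ≤ j ≤ l_χ`. -/
def coverSet (χ : ℕ+ →₀ ℕ) (j : ℕ) : Finset ℕ+ := χ.support.filter fun m => χ m ≥ j

/-- The lattice `⨁_{j = 1}^{l_χ} Or(M_j)` for the standard covering `(M_1, …, M_{l_χ})` of `χ`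
(the index `j : Fin l_χ` starts at `0`). -/
abbrev OrSum (χ : ℕ+ →₀ ℕ) : Type := ⨁ j : Fin (coverLength χ), OrBlock (coverSet χ (j + 1))

/-- The endomorphism of `⨁_{j = 1}^{l_χ} Or(M_j)`. -/
def orSumEnd (χ : ℕ+ →₀ ℕ) : Module.End ℤ (OrSum χ) :=
  DirectSum.lmap fun j : Fin (coverLength χ) => orEnd (coverSet χ (j + 1))

end OrlikTensor

end

/-! Let `n` be a common multiple of all indices that occur. Over `ℂ` the multiplicities of the zeros
of `∏ Φ_m ^ χ(m)` form the function `z ↦ χ(ord z)` on `ZMod n`, so the tensor product of polynomials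
is a convolution on `ZMod n`. Multiplication by units preserves orders and is transitive on elements
of equal order, so the convolution is again a function of the order; this is `χ₃`
(`polyTensor_cycloProd`), and it is unique because roots can be counted. Writing `χ₁`, `χ₂` as sums
of indicators of their covering sets reduces everything to `orderCount`: the number of ways to write
`z` as a sum of an element with order in `D` and one with order in `D'`. Compatibility says that `D`
and `D'` are upper sets along each prime. Part (a) then says that these counts are monotone along
edges, and by the Chinese remainder theorem this is a statement about `ZMod (p ^ s)`
(`sumCountMono`).

For (b), a product of two single blocks is `X = ℤ[x, y] / (f(x), g(y))` with `t = x y` as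
endomorphism. Let `F_j` be the product of `Φ_d` over the orders `d` of elements with more than `j`
representations. If each `F_j(t) X` is spanned by the `F_j(t) P(t) y ^ k` with `k < j`, then `X` is
the sum of the `ℤ[t] / (F_j)` (`exists_equiv_of_mulSpanned`). Spanning over `ℤ` follows from
spanning over fields of every prime characteristic once the rank of `F_j(t) X` does not drop modulo
any prime (`mulSpanned_int`).

Over a field, the dimension of `K[x, y] / (f(x), g(y), h(x y))` is a sum of dimensions of local
algebras `K[u, v] / (u ^ a, v ^ b, (u + v) ^ e)`. In characteristic `p` their increments in `e` obey
the same recursion on `p`-levels as the representation counts (`layersMatch`). Hence the dimensions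
are the same in all characteristics, and removing one factor `t - ξ` costs at most `j` dimensions,
in a quotient where `t` is a scalar and `y` generates; there `1, y, …, y ^ (j - 1)` span.

Finally the layers of all pairs of blocks are upper sets for the tensor orders. For two upper sets
`A`, `B` the relevant cyclotomic polynomials are comaximal, so `Or(A) ⊕ Or(B) ≅ Or(A ∪ B) ⊕ Or(A ∩
B)`; repeating this sorts the layers into the standard covering of `χ₃` (`pairIso_chain`). -/

namespace OrlikTensor

/-! ### Dimensions of quotients by colon ideals -/

section FinrankQuotient

variable {K R : Type*} [Field K] [CommRing R] [Algebra K R]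

/-- Multiplication by `g` makes `0 → R/(I : g) → R/I → R/(I + (g)) → 0` exact. The shift, duality,
concavity and coprime splitting formulas below all come from this sequence. -/
lemma finrank_quotient_colon (I J : Ideal R) (g : R) (hJ : ∀ c, c ∈ J ↔ g * c ∈ I)
    [Module.Finite K (R ⧸ I)] :
    Module.finrank K (R ⧸ J) + Module.finrank K (R ⧸ (I ⊔ Ideal.span {g})) =
      Module.finrank K (R ⧸ I) := by
  let π : (R ⧸ I) →ₗ[K] (R ⧸ (I ⊔ Ideal.span {g})) :=
    (Ideal.Quotient.factorₐ K (le_sup_left : I ≤ I ⊔ Ideal.span {g})).toLinearMap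
  let f : (R ⧸ J) →ₗ[K] (R ⧸ I) :=
    (Submodule.mapQ J I (LinearMap.mulLeft R g) (fun c hc => (hJ c).1 hc)).restrictScalars K
  have hf : Function.Injective f := by
    rw [← LinearMap.ker_eq_bot, LinearMap.ker_eq_bot']
    intro m hm
    obtain ⟨c, rfl⟩ := Ideal.Quotient.mk_surjective m
    have : (Ideal.Quotient.mk I) (g * c) = 0 := hm
    rw [Ideal.Quotient.eq_zero_iff_mem] at this
    exact Ideal.Quotient.eq_zero_iff_mem.2 ((hJ c).2 this)
  have hrange : LinearMap.range f = LinearMap.ker π := by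
    ext m
    obtain ⟨m, rfl⟩ := Ideal.Quotient.mk_surjective m
    constructor
    · rintro ⟨c, hc⟩
      obtain ⟨c, rfl⟩ := Ideal.Quotient.mk_surjective c
      rw [LinearMap.mem_ker, ← hc]
      change (Ideal.Quotient.mk _) (g * c) = 0
      rw [Ideal.Quotient.eq_zero_iff_mem]
      exact Ideal.mem_sup_right (Ideal.mul_mem_right _ _ (Ideal.mem_span_singleton_self g))
    · intro hm
      have : (Ideal.Quotient.mk (I ⊔ Ideal.span {g})) m = 0 := hm
      rw [Ideal.Quotient.eq_zero_iff_mem] at this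
      obtain ⟨i, hi, j, hj, rfl⟩ := Submodule.mem_sup.1 this
      obtain ⟨c, rfl⟩ := Ideal.mem_span_singleton.1 hj
      refine ⟨Ideal.Quotient.mk J c, ?_⟩
      change (Ideal.Quotient.mk I) (g * c) = (Ideal.Quotient.mk I) (i + g * c)
      rw [map_add, Ideal.Quotient.eq_zero_iff_mem.2 hi, zero_add]
  have hπ : Function.Surjective π :=
    Ideal.Quotient.factor_surjective (le_sup_left : I ≤ I ⊔ Ideal.span {g})
  have h := LinearMap.finrank_range_add_finrank_ker π
  rw [LinearMap.range_eq_top.2 hπ, finrank_top, ← hrange, LinearMap.finrank_range_of_inj hf] at h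
  omega

lemma finite_quotient_of_le {I J : Ideal R} (h : I ≤ J) [Module.Finite K (R ⧸ I)] :
    Module.Finite K (R ⧸ J) :=
  Module.Finite.of_surjective (Ideal.Quotient.factorₐ K h).toLinearMap
    (Ideal.Quotient.factor_surjective h)

lemma finrank_polynomial_quotient {A : Type*} [CommRing A] [Algebra K A] [Module.Finite K A]
    {g : A[X]} (hg : g.Monic) :
    Module.finrank K (A[X] ⧸ Ideal.span {g}) = Module.finrank K A * g.natDegree := by
  have e : AdjoinRoot g ≃ₗ[A] (Fin g.natDegree → A) :=
    (AdjoinRoot.powerBasis' hg).basis.equivFun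
  have := (e.restrictScalars K).finrank_eq
  rw [Module.finrank_pi_fintype, Finset.sum_const, Finset.card_univ, Fintype.card_fin,
    smul_eq_mul, mul_comm] at this
  exact this

lemma finite_polynomial_quotient {A : Type*} [CommRing A] [Algebra K A] [Module.Finite K A]
    {g : A[X]} (hg : g.Monic) : Module.Finite K (A[X] ⧸ Ideal.span {g}) := by
  have e : AdjoinRoot g ≃ₗ[A] (Fin g.natDegree → A) :=
    (AdjoinRoot.powerBasis' hg).basis.equivFun
  exact Module.Finite.equiv (e.restrictScalars K).symm

end FinrankQuotient

/-! ### The local algebras `K[u, v] / (u ^ a, v ^ b, (u + v) ^ e)` -/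

section TriangleDim

variable (K : Type*) [Field K]

/-- The truncated polynomial ring `K[v] / (v ^ b)`. -/
abbrev Trunc (b : ℕ) : Type _ := AdjoinRoot (X ^ b : K[X])

/-- The nilpotent generator `v` of `K[v] / (v ^ b)`. -/
noncomputable abbrev Trunc.gen (b : ℕ) : Trunc K b := AdjoinRoot.root (X ^ b : K[X])

lemma Trunc.gen_pow (b : ℕ) : Trunc.gen K b ^ b = 0 := by
  have := AdjoinRoot.eval₂_root (X ^ b : K[X])
  simpa using this

lemma Trunc.gen_pow_of_le {b c : ℕ} (h : b ≤ c) : Trunc.gen K b ^ c = 0 :=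
  pow_eq_zero_of_le h (Trunc.gen_pow K b)

instance (b : ℕ) : Module.Finite K (Trunc K b) :=
  Module.Finite.of_basis (AdjoinRoot.powerBasis' (monic_X_pow b)).basis

lemma finrank_trunc (b : ℕ) : Module.finrank K (Trunc K b) = b := by
  have := finrank_polynomial_quotient (K := K) (A := K) (monic_X_pow (R := K) b)
  rw [Module.finrank_self, one_mul, natDegree_X_pow] at this
  exact this

/-- The ideal `(u ^ a, (u + v) ^ e)` of `(K[v] / (v ^ b))[u]`. -/
noncomputable def triangleIdeal (a b e : ℕ) : Ideal (Trunc K b)[X] :=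
  Ideal.span {X ^ a} ⊔ Ideal.span {(X + C (Trunc.gen K b)) ^ e}

/-- The dimension of `K[u, v] / (u ^ a, v ^ b, (u + v) ^ e)`. -/
noncomputable def triangleDim (a b e : ℕ) : ℕ :=
  Module.finrank K ((Trunc K b)[X] ⧸ triangleIdeal K a b e)

instance (a b e : ℕ) : Module.Finite K ((Trunc K b)[X] ⧸ triangleIdeal K a b e) := by
  have := finite_polynomial_quotient (K := K) (A := Trunc K b) (monic_X_pow a)
  exact finite_quotient_of_le (le_sup_left : Ideal.span {X ^ a} ≤ triangleIdeal K a b e)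

lemma finrank_le_of_algHom_surjective {A B : Type*} [CommRing A] [Algebra K A] [CommRing B]
    [Algebra K B] [Module.Finite K A] (f : A →ₐ[K] B) (hf : Function.Surjective f) :
    Module.finrank K B ≤ Module.finrank K A :=
  LinearMap.finrank_le_finrank_of_surjective (f := f.toLinearMap) hf

/-- The universal property of `K[u, v] / (u ^ a, v ^ b, (u + v) ^ e)`. -/
lemma exists_algHom_triangle {A : Type*} [CommRing A] [Algebra K A] {a b e : ℕ} (u v : A)
    (hu : u ^ a = 0) (hv : v ^ b = 0) (huv : (u + v) ^ e = 0) :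
    ∃ f : ((Trunc K b)[X] ⧸ triangleIdeal K a b e) →ₐ[K] A,
      f (Ideal.Quotient.mk _ X) = u ∧ f (Ideal.Quotient.mk _ (C (Trunc.gen K b))) = v := by
  let g : Trunc K b →ₐ[K] A := AdjoinRoot.liftAlgHom _ (Algebra.ofId K A) v (by simp [hv])
  have hg : g (Trunc.gen K b) = v := AdjoinRoot.liftAlgHom_root _ _ _ _
  let h : (Trunc K b)[X] →ₐ[K] A := Polynomial.eval₂AlgHom g u (fun _ => Commute.all _ _)
  have hX : h X = u := by simp [h]
  have hC : h (C (Trunc.gen K b)) = v := by simp [h, hg]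
  have hker : ∀ x ∈ triangleIdeal K a b e, h x = 0 := by
    change triangleIdeal K a b e ≤ RingHom.ker h
    rw [triangleIdeal, sup_le_iff, Ideal.span_singleton_le_iff_mem, Ideal.span_singleton_le_iff_mem,
      RingHom.mem_ker, RingHom.mem_ker, map_pow, map_pow, map_add, hX, hC]
    exact ⟨hu, huv⟩
  exact ⟨Ideal.Quotient.liftₐ _ h hker, hX, hC⟩

lemma triangle_relations (a b e : ℕ) :
    (Ideal.Quotient.mk (triangleIdeal K a b e) X) ^ a = 0 ∧
    (Ideal.Quotient.mk (triangleIdeal K a b e) (C (Trunc.gen K b))) ^ b = 0 ∧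
    (Ideal.Quotient.mk (triangleIdeal K a b e) X +
      Ideal.Quotient.mk (triangleIdeal K a b e) (C (Trunc.gen K b))) ^ e = 0 := by
  refine ⟨?_, ?_, ?_⟩
  · rw [← map_pow, Ideal.Quotient.eq_zero_iff_mem]
    exact Ideal.mem_sup_left (Ideal.mem_span_singleton_self _)
  · rw [← map_pow, ← C_pow, Trunc.gen_pow, C_0, map_zero]
  · rw [← map_add, ← map_pow, Ideal.Quotient.eq_zero_iff_mem]
    exact Ideal.mem_sup_right (Ideal.mem_span_singleton_self _)

/-- A subalgebra of `K[u, v] / (u ^ a, v ^ b, (u + v) ^ e)` containing `u` and `v` is everything. -/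
lemma triangle_subalgebra_eq_top {a b e : ℕ}
    (S : Subalgebra K ((Trunc K b)[X] ⧸ triangleIdeal K a b e))
    (hu : Ideal.Quotient.mk _ X ∈ S) (hv : Ideal.Quotient.mk _ (C (Trunc.gen K b)) ∈ S) :
    S = ⊤ := by
  rw [eq_top_iff]
  rintro x -
  obtain ⟨p, rfl⟩ := Ideal.Quotient.mk_surjective x
  induction p using Polynomial.induction_on' with
  | add p q hp hq => rw [map_add]; exact S.add_mem hp hq
  | monomial n c =>
    rw [← C_mul_X_pow_eq_monomial, map_mul, map_pow]
    refine S.mul_mem ?_ (S.pow_mem hu n)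
    obtain ⟨q, rfl⟩ := AdjoinRoot.mk_surjective c
    induction q using Polynomial.induction_on' with
    | add p q hp hq => rw [map_add, C_add, map_add]; exact S.add_mem hp hq
    | monomial m c =>
      rw [← C_mul_X_pow_eq_monomial, map_mul, map_pow, C_mul, C_pow, map_mul, map_pow]
      exact S.mul_mem (S.algebraMap_mem c) (S.pow_mem hv m)

lemma triangleDim_comm_le (a b e : ℕ) : triangleDim K a b e ≤ triangleDim K b a e := by
  obtain ⟨h1, h2, h3⟩ := triangle_relations K a b e
  obtain ⟨f, hf1, hf2⟩ := exists_algHom_triangle K (a := b) (b := a) (e := e)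
    (Ideal.Quotient.mk (triangleIdeal K a b e) (C (Trunc.gen K b)))
    (Ideal.Quotient.mk (triangleIdeal K a b e) X) h2 h1 (by rwa [add_comm])
  refine finrank_le_of_algHom_surjective K f ?_
  rw [← AlgHom.range_eq_top]
  exact triangle_subalgebra_eq_top K _ ⟨_, hf2⟩ ⟨_, hf1⟩

lemma triangleDim_comm (a b e : ℕ) : triangleDim K a b e = triangleDim K b a e :=
  le_antisymm (triangleDim_comm_le K a b e) (triangleDim_comm_le K b a e)

lemma monic_X_add_gen_pow (b e : ℕ) : ((X + C (Trunc.gen K b)) ^ e).Monic :=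
  (monic_X_add_C _).pow e

lemma finrank_quotient_X_add_gen_pow (b e : ℕ) :
    Module.finrank K ((Trunc K b)[X] ⧸ Ideal.span {(X + C (Trunc.gen K b)) ^ e}) = b * e := by
  rw [finrank_polynomial_quotient (monic_X_add_gen_pow K b e), finrank_trunc]
  -- For `b = 0` the coefficient ring is zero and `natDegree` need not be `e`, but both sides carry
  -- the factor `b = 0`.
  rcases subsingleton_or_nontrivial (Trunc K b) with h | h
  · have := finrank_trunc K b
    rw [Module.finrank_zero_of_subsingleton] at this
    simp [← this]
  · rw [(monic_X_add_C _).natDegree_pow, natDegree_X_add_C, mul_one]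

lemma finrank_quotient_X_pow (b a : ℕ) :
    Module.finrank K ((Trunc K b)[X] ⧸ Ideal.span {(X : (Trunc K b)[X]) ^ a}) = b * a := by
  rw [finrank_polynomial_quotient (monic_X_pow a), finrank_trunc]
  rcases subsingleton_or_nontrivial (Trunc K b) with h | h
  · have := finrank_trunc K b
    rw [Module.finrank_zero_of_subsingleton] at this
    simp [← this]
  · rw [natDegree_X_pow]

lemma triangleDim_of_mem_right {a b e : ℕ}
    (h : (X : (Trunc K b)[X]) ^ a ∈ Ideal.span {(X + C (Trunc.gen K b)) ^ e}) :
    triangleDim K a b e = b * e := by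
  rw [← finrank_quotient_X_add_gen_pow K, triangleDim, triangleIdeal, sup_eq_right.2]
  rwa [Ideal.span_singleton_le_iff_mem]

lemma triangleDim_zero (a b : ℕ) : triangleDim K a b 0 = 0 := by
  rw [triangleDim_of_mem_right, mul_zero]
  simp

lemma triangleDim_zero_mid (a e : ℕ) : triangleDim K a 0 e = 0 := by
  have : Subsingleton (Trunc K 0) := by
    rw [← Module.finrank_eq_zero_iff_of_free (R := K), finrank_trunc]
  rw [triangleDim_of_mem_right, zero_mul]
  rw [Subsingleton.elim ((X : (Trunc K 0)[X]) ^ a) 0]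
  exact Ideal.zero_mem _

lemma triangleDim_zero_left (b e : ℕ) : triangleDim K 0 b e = 0 := by
  rw [triangleDim_comm, triangleDim_zero_mid]

lemma triangleDim_one : triangleDim K 1 1 1 = 1 := by
  rw [triangleDim_of_mem_right]
  have : Trunc.gen K 1 = 0 := by simpa using Trunc.gen_pow K 1
  rw [this]
  simp

variable (p : ℕ) [ExpChar K p]

/-- `(u + v) ^ (k p ^ r) = u ^ (k p ^ r)` when `v ^ b = 0` with `b ≤ p ^ r`. -/
lemma X_add_gen_pow_eq {b r : ℕ} (hb : b ≤ p ^ r) (k : ℕ) :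
    (X + C (Trunc.gen K b)) ^ (p ^ r * k) = (X : (Trunc K b)[X]) ^ (p ^ r * k) := by
  rcases subsingleton_or_nontrivial (Trunc K b) with h | h
  · exact Subsingleton.elim _ _
  · have : ExpChar (Trunc K b) p := expChar_of_injective_algebraMap
      (FaithfulSMul.algebraMap_injective K (Trunc K b)) p
    rw [pow_mul, pow_mul, add_pow_expChar_pow, ← C_pow, Trunc.gen_pow_of_le K hb, C_0, add_zero]

/-- By Frobenius `(u + v) ^ (p ^ r * k) = u ^ (p ^ r * k)`, so `u ^ a` is a multiple of `(u + v) ^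
e` and the relation `u ^ a = 0` is redundant. -/
lemma triangleDim_of_le {a b e r k : ℕ} (hb : b ≤ p ^ r) (ha : p ^ r * k ≤ a)
    (he : e ≤ p ^ r * k) : triangleDim K a b e = b * e := by
  apply triangleDim_of_mem_right
  obtain ⟨c, rfl⟩ := Nat.exists_eq_add_of_le ha
  obtain ⟨d, hd⟩ := Nat.exists_eq_add_of_le he
  rw [pow_add, ← X_add_gen_pow_eq K p hb, hd, pow_add, mul_assoc]
  exact Ideal.mul_mem_right _ _ (Ideal.mem_span_singleton_self _)

/-- Both generators are divisible by `u ^ (p ^ r * k) = (u + v) ^ (p ^ r * k)`, a monic and hence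
regular element that can be cancelled. -/
lemma triangleDim_add {b r : ℕ} (hb : b ≤ p ^ r) (k a e : ℕ) :
    triangleDim K (p ^ r * k + a) b (p ^ r * k + e) = b * (p ^ r * k) + triangleDim K a b e := by
  have h := finrank_quotient_colon (K := K) (triangleIdeal K (p ^ r * k + a) b (p ^ r * k + e))
    (triangleIdeal K a b e) (X ^ (p ^ r * k)) ?_
  · rw [triangleDim, triangleDim, ← h, add_comm]
    have hle : triangleIdeal K (p ^ r * k + a) b (p ^ r * k + e) ≤ Ideal.span {X ^ (p ^ r * k)} := ?_
    · rw [sup_eq_right.2 hle, finrank_quotient_X_pow K]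
    rw [triangleIdeal, sup_le_iff, Ideal.span_singleton_le_iff_mem,
      Ideal.span_singleton_le_iff_mem]
    rw [pow_add, pow_add, X_add_gen_pow_eq K p hb]
    exact ⟨Ideal.mul_mem_right _ _ (Ideal.mem_span_singleton_self _),
      Ideal.mul_mem_right _ _ (Ideal.mem_span_singleton_self _)⟩
  · intro c
    simp only [triangleIdeal, ← Ideal.span_union, Set.singleton_union, Ideal.mem_span_pair]
    rw [pow_add, pow_add, X_add_gen_pow_eq K p hb]
    constructor
    · rintro ⟨y, z, rfl⟩
      exact ⟨y, z, by ring⟩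
    · rintro ⟨y, z, h⟩
      refine ⟨y, z, ?_⟩
      have h2 : X ^ (p ^ r * k) * (y * X ^ a + z * (X + C (Trunc.gen K b)) ^ e) =
          X ^ (p ^ r * k) * c := by rw [← h]; ring
      exact (monic_X_pow (R := Trunc K b) (p ^ r * k)).isRegular.left h2

/-- Linkage: with `a' = p ^ r - a` and `e' = p ^ r - e`, the identity `u ^ a * u ^ a' = w ^ e * w ^
e'` for `w = u + v` makes the colon ideals `(w ^ e : u ^ a)` and `(u ^ a' : w ^ e')` equal.
Computing the dimension of the quotient by this ideal in both ways gives the formula. -/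
lemma triangleDim_compl {a b e r : ℕ} (ha : a ≤ p ^ r) (hb : b ≤ p ^ r) (he : e ≤ p ^ r) :
    triangleDim K a b e + b * p ^ r =
      b * a + b * e + triangleDim K (p ^ r - a) b (p ^ r - e) := by
  obtain ⟨a', ha'⟩ := Nat.exists_eq_add_of_le ha
  obtain ⟨e', he'⟩ := Nat.exists_eq_add_of_le he
  have hXq : (X + C (Trunc.gen K b)) ^ (p ^ r) = (X : (Trunc K b)[X]) ^ (p ^ r) := by
    simpa using X_add_gen_pow_eq K p hb 1
  set w : (Trunc K b)[X] := X + C (Trunc.gen K b) with hw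
  have hreg : ∀ m, IsRegular ((X : (Trunc K b)[X]) ^ m) := fun m => (monic_X_pow m).isRegular
  have hregw : ∀ m, IsRegular (w ^ m) := fun m => (monic_X_add_gen_pow K b m).isRegular
  have hdiv : ∀ c, w ^ e ∣ X ^ a * c ↔ X ^ a' ∣ w ^ e' * c := by
    have key : (X : (Trunc K b)[X]) ^ a * X ^ a' = w ^ e * w ^ e' := by
      rw [← pow_add, ← pow_add, ← ha', ← he', hXq]
    intro c
    constructor
    · rintro ⟨d, hd⟩
      refine ⟨d, (hreg a).left ?_⟩
      change X ^ a * (w ^ e' * c) = X ^ a * (X ^ a' * d)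
      calc _ = w ^ e' * (X ^ a * c) := by ring
        _ = _ := by rw [hd, ← mul_assoc (X ^ a), key]; ring
    · rintro ⟨d, hd⟩
      refine ⟨d, (hregw e').left ?_⟩
      change w ^ e' * (X ^ a * c) = w ^ e' * (w ^ e * d)
      calc _ = X ^ a * (w ^ e' * c) := by ring
        _ = _ := by rw [hd, ← mul_assoc (X ^ a), key]; ring
  let J : Ideal (Trunc K b)[X] :=
    Submodule.comap (LinearMap.mulLeft (Trunc K b)[X] (X ^ a)) (Ideal.span {w ^ e})
  have hJ : ∀ c, c ∈ J ↔ X ^ a * c ∈ Ideal.span {w ^ e} := fun c => Iff.rfl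
  have hJ' : ∀ c, c ∈ J ↔ w ^ e' * c ∈ Ideal.span {(X : (Trunc K b)[X]) ^ a'} := fun c => by
    rw [hJ, Ideal.mem_span_singleton, Ideal.mem_span_singleton, hdiv]
  have := finite_polynomial_quotient (K := K) (monic_X_add_gen_pow K b e)
  have := finite_polynomial_quotient (K := K) (monic_X_pow (R := Trunc K b) a')
  have h1 := finrank_quotient_colon (K := K) _ J _ hJ
  have h2 := finrank_quotient_colon (K := K) _ J _ hJ'
  rw [finrank_quotient_X_add_gen_pow, sup_comm] at h1
  rw [finrank_quotient_X_pow] at h2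
  have e1 : p ^ r - a = a' := by omega
  have e2 : p ^ r - e = e' := by omega
  rw [e1, e2]
  change _ + triangleDim K a b e = _ at h1
  change _ + triangleDim K a' b e' = _ at h2
  rw [ha', mul_add]
  omega

/-- The increment from `e` to `e + 1` is the dimension of the quotient by the colon ideal of `(u +
v) ^ e` in the triangle ideal for `e + 1`, and these colon ideals grow with `e`. -/
lemma triangleDim_concave (a b e : ℕ) :
    triangleDim K a b (e + 2) + triangleDim K a b e ≤
      triangleDim K a b (e + 1) + triangleDim K a b (e + 1) := by
  set w : (Trunc K b)[X] := X + C (Trunc.gen K b) with hw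
  let J : ℕ → Ideal (Trunc K b)[X] := fun e =>
    Submodule.comap (LinearMap.mulLeft (Trunc K b)[X] (w ^ e)) (triangleIdeal K a b (e + 1))
  have hJ : ∀ e c, c ∈ J e ↔ w ^ e * c ∈ triangleIdeal K a b (e + 1) := fun e c => Iff.rfl
  have key : ∀ e, Module.finrank K ((Trunc K b)[X] ⧸ J e) + triangleDim K a b e =
      triangleDim K a b (e + 1) := fun e => by
    have hsup : triangleIdeal K a b (e + 1) ⊔ Ideal.span {w ^ e} = triangleIdeal K a b e := by
      rw [triangleIdeal, triangleIdeal, sup_assoc]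
      congr 1
      refine sup_eq_right.2 ?_
      rw [Ideal.span_singleton_le_iff_mem, pow_succ]
      exact Ideal.mul_mem_right _ _ (Ideal.mem_span_singleton_self _)
    rw [triangleDim, triangleDim, ← finrank_quotient_colon (K := K) _ (J e) _ (hJ e), hsup]
  have hle : J e ≤ J (e + 1) := by
    intro c hc
    rw [hJ] at *
    obtain ⟨i, hi, j, hj, h⟩ := Submodule.mem_sup.1 hc
    rw [pow_succ', mul_assoc, ← h, mul_add]
    refine Ideal.add_mem _ (Ideal.mem_sup_left (Ideal.mul_mem_left _ _ hi))
      (Ideal.mem_sup_right ?_)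
    obtain ⟨d, rfl⟩ := Ideal.mem_span_singleton.1 hj
    rw [← mul_assoc, ← pow_succ']
    exact Ideal.mul_mem_right _ _ (Ideal.mem_span_singleton_self _)
  have hfin : Module.Finite K ((Trunc K b)[X] ⧸ J e) := by
    refine finite_quotient_of_le (I := triangleIdeal K a b (e + 1)) (fun c hc => ?_)
    exact (hJ e c).2 (Ideal.mul_mem_left _ _ hc)
  have := LinearMap.finrank_le_finrank_of_surjective
    (f := (Ideal.Quotient.factorₐ K hle).toLinearMap) (Ideal.Quotient.factor_surjective hle)
  have h1 := key e
  have h2 : _ = triangleDim K a b (e + 2) := key (e + 1)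
  omega

end TriangleDim


/-! ### Orders on exponents and their upper sets -/

section Levels

/-- The strict total order on `ℕ` attached to a set `S`: first the elements of `S` in decreasing
order, then the other numbers in increasing order. -/
def LevelRel (S : Set ℕ) (i j : ℕ) : Prop :=
  (i ∈ S ∧ j ∈ S ∧ j < i) ∨ (i ∈ S ∧ j ∉ S) ∨ (i ∉ S ∧ j ∉ S ∧ i < j)

lemma levelRel_compl (S : Set ℕ) (i j : ℕ) : LevelRel Sᶜ i j ↔ LevelRel S j i := by
  simp only [LevelRel, Set.mem_compl_iff]
  tauto

/-- The subsets of `{0, …, r}` which are upper sets for `LevelRel S`. -/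
structure IsLevelUpper (S : Set ℕ) (r : ℕ) (U : Set ℕ) : Prop where
  le : ∀ k ∈ U, k ≤ r
  mem : ∀ i j, i ≤ r → j ∈ U → LevelRel S i j → i ∈ U

/-- Complementing `S` reverses the order, so it exchanges upper and lower sets. Together with the
symmetry in the two factors this leaves a single case in the inductions below. -/
lemma IsLevelUpper.compl {S U : Set ℕ} {r : ℕ} (h : IsLevelUpper Sᶜ r U) :
    IsLevelUpper S r (Set.Iic r \ U) where
  le _ hk := hk.1
  mem i j hi hj hij := ⟨hi, fun hU => hj.2 (h.mem j i hj.1 hU ((levelRel_compl S j i).2 hij))⟩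

lemma IsLevelUpper.inter {S U : Set ℕ} {r : ℕ} (h : IsLevelUpper S (r + 1) U) :
    IsLevelUpper S r (U ∩ Set.Iic r) where
  le _ hk := hk.2
  mem i j hi hj hij := ⟨h.mem i j (hi.trans r.le_succ) hj.1 hij, hi⟩

lemma IsLevelUpper.of_notMem {S U : Set ℕ} {r : ℕ} (h : IsLevelUpper S (r + 1) U)
    (hr : r + 1 ∉ U) : IsLevelUpper S r U where
  le k hk := Nat.le_of_lt_succ (lt_of_le_of_ne (h.le k hk) (by rintro rfl; exact hr hk))
  mem i j hi hj hij := h.mem i j (hi.trans r.le_succ) hj hij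

end Levels

/-! ### Representation counts in an abelian group -/

section Convolution

variable {G : Type*} [AddCommGroup G] [DecidableEq G]

/-- The number of representations of `z` as a sum of an element of `A` and one of `B`. -/
def sumCount (A B : Finset G) (z : G) : ℕ := (A.filter fun a => z - a ∈ B).card

lemma sumCount_comm (A B : Finset G) (z : G) : sumCount A B z = sumCount B A z := by
  refine Finset.card_bij' (fun a _ => z - a) (fun a _ => z - a) ?_ ?_ ?_ ?_
  · intro a ha
    simp only [Finset.mem_filter] at ha ⊢
    simpa using ha.symm
  · intro a ha
    simp only [Finset.mem_filter] at ha ⊢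
    simpa using ha.symm
  · intro a _; simp
  · intro a _; simp

lemma sumCount_le (A B : Finset G) (z : G) : sumCount A B z ≤ B.card := by
  rw [sumCount_comm]
  exact Finset.card_filter_le _ _

lemma sumCount_eq_card {A B : Finset G} {z : G} (h : ∀ b ∈ B, z - b ∈ A) :
    sumCount A B z = B.card := by
  rw [sumCount_comm, sumCount, Finset.filter_true_of_mem h]

lemma sumCount_congr_left {A A' B : Finset G} {z : G}
    (h : ∀ b ∈ B, (z - b ∈ A ↔ z - b ∈ A')) : sumCount A B z = sumCount A' B z := by
  rw [sumCount_comm A, sumCount_comm A', sumCount, sumCount, Finset.filter_congr h]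

lemma sumCount_sdiff {A B H : Finset G} {z : G} (h : ∀ b ∈ B, z - b ∈ H) :
    sumCount A B z + sumCount (H \ A) B z = B.card := by
  rw [sumCount_comm A, sumCount_comm (H \ A), sumCount, sumCount,
    ← Finset.card_filter_add_card_filter_not (s := B) (fun b => z - b ∈ A)]
  congr 2
  apply Finset.filter_congr
  intro b hb
  simp [h b hb]

end Convolution

/-! ### Level sets of `ZMod (p ^ s)`: monotone counts, and layers of the local algebras -/

section PrimePower

variable (p s : ℕ) [hp : Fact p.Prime]

/-- The exponent of `p` in the order of an element of `ZMod (p ^ s)`. -/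
noncomputable def level (z : ZMod (p ^ s)) : ℕ := (addOrderOf z).factorization p

variable {p s}

lemma addOrderOf_eq_pow_level (z : ZMod (p ^ s)) : addOrderOf z = p ^ level p s z := by
  have h : addOrderOf z ∣ p ^ s := by
    have := addOrderOf_dvd_natCard z
    rwa [Nat.card_zmod] at this
  obtain ⟨k, -, hk⟩ := (Nat.dvd_prime_pow hp.out).1 h
  rw [level, hk, hp.out.factorization_pow, Finsupp.single_eq_same]

lemma level_le_iff (z : ZMod (p ^ s)) (r : ℕ) : level p s z ≤ r ↔ p ^ r • z = 0 := by
  rw [← addOrderOf_dvd_iff_nsmul_eq_zero, addOrderOf_eq_pow_level,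
    Nat.pow_dvd_pow_iff_le_right hp.out.one_lt]

lemma level_le (z : ZMod (p ^ s)) : level p s z ≤ s := by
  rw [level_le_iff]
  simp

lemma level_sub_le {y z : ZMod (p ^ s)} {r : ℕ} (hy : level p s y ≤ r) (hz : level p s z ≤ r) :
    level p s (y - z) ≤ r := by
  rw [level_le_iff] at *
  rw [smul_sub, hy, hz, sub_zero]

lemma level_sub_eq {y z : ZMod (p ^ s)} {r : ℕ} (hy : level p s y = r + 1)
    (hz : level p s z ≤ r) : level p s (y - z) = r + 1 := by
  refine le_antisymm (level_sub_le hy.le (hz.trans r.le_succ)) ?_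
  by_contra! h
  have := level_sub_le (Nat.le_of_lt_succ h) (z := -z) (r := r) (by
    rw [level_le_iff] at *; simp [hz])
  rw [sub_neg_eq_add, sub_add_cancel] at this
  omega

lemma card_level_eq {r : ℕ} (hr : r + 1 ≤ s) :
    (Finset.univ.filter fun z : ZMod (p ^ s) => level p s z = r + 1).card = p ^ r * (p - 1) := by
  rw [← Nat.totient_prime_pow_succ hp.out]
  have h : p ^ (r + 1) ∣ Fintype.card (ZMod (p ^ s)) := by
    rw [ZMod.card]; exact pow_dvd_pow p hr
  rw [← IsAddCyclic.card_addOrderOf_eq_totient h]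
  congr 1
  apply Finset.filter_congr
  intro z _
  rw [addOrderOf_eq_pow_level, (Nat.pow_right_injective hp.out.two_le).eq_iff]

open Classical in
/-- The elements of `ZMod (p ^ s)` whose level lies in `U`. -/
noncomputable def levelSet (p s : ℕ) [Fact p.Prime] (U : Set ℕ) : Finset (ZMod (p ^ s)) :=
  Finset.univ.filter fun z => level p s z ∈ U

lemma mem_levelSet {U : Set ℕ} {z : ZMod (p ^ s)} : z ∈ levelSet p s U ↔ level p s z ∈ U := by
  simp [levelSet]

lemma levelSet_sdiff (U V : Set ℕ) : levelSet p s (U \ V) = levelSet p s U \ levelSet p s V := by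
  ext z; simp [mem_levelSet]

lemma card_levelSet_Iic {r : ℕ} (hr : r ≤ s) : (levelSet p s (Set.Iic r)).card = p ^ r := by
  induction r with
  | zero =>
    rw [pow_zero, Finset.card_eq_one]
    refine ⟨0, ?_⟩
    ext z
    rw [mem_levelSet, Set.mem_Iic, level_le_iff, pow_zero, one_smul, Finset.mem_singleton]
  | succ r ih =>
    have : levelSet p s (Set.Iic (r + 1)) =
        (Finset.univ.filter fun z : ZMod (p ^ s) => level p s z = r + 1).disjUnion
          (levelSet p s (Set.Iic r)) (by
            rw [Finset.disjoint_left]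
            intro z hz hz'
            simp only [Finset.mem_filter, mem_levelSet, Set.mem_Iic] at hz hz'
            omega) := by
      ext z
      simp only [mem_levelSet, Set.mem_Iic, Finset.mem_disjUnion, Finset.mem_filter,
        Finset.mem_univ, true_and]
      omega
    rw [this, Finset.card_disjUnion, card_level_eq hr, ih (by omega), pow_succ, ← Nat.mul_succ]
    congr 1
    have := hp.out.one_lt
    omega

lemma IsLevelUpper.levelSet_subset {S U : Set ℕ} {r : ℕ} (h : IsLevelUpper S r U) :
    levelSet p s U ⊆ levelSet p s (Set.Iic r) := by
  intro z hz
  rw [mem_levelSet] at *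
  exact h.le _ hz

lemma IsLevelUpper.card_le {S U : Set ℕ} {r : ℕ} (hr : r ≤ s) (h : IsLevelUpper S r U) :
    (levelSet p s U).card ≤ p ^ r := by
  rw [← card_levelSet_Iic (p := p) hr]
  exact Finset.card_le_card h.levelSet_subset

lemma level_le_of_mem {S U : Set ℕ} {r : ℕ} (h : IsLevelUpper S r U) {z : ZMod (p ^ s)}
    (hz : z ∈ levelSet p s U) : level p s z ≤ r := h.le _ (mem_levelSet.1 hz)

/-- The numbers of representations as sums of elements of level sets are monotone. -/
def SumCountMono (p s : ℕ) [Fact p.Prime] (S T : Set ℕ) (r : ℕ) : Prop :=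
  ∀ U U', IsLevelUpper S r U → IsLevelUpper T r U' → ∀ z z', level p s z ≤ r → level p s z' ≤ r →
    LevelRel (symmDiff S T) (level p s z) (level p s z') →
      sumCount (levelSet p s U) (levelSet p s U') z' ≤ sumCount (levelSet p s U) (levelSet p s U') z

variable (K : Type*) [Field K]

/-- The layers of `K[u, v] / (u ^ a, v ^ b)` with respect to powers of `u + v` are counted by
the representations as sums of elements of level sets. -/
def LayersMatch (p s : ℕ) [Fact p.Prime] (S T : Set ℕ) (r : ℕ) : Prop :=
  ∃ σ : ℕ → ZMod (p ^ s), Set.BijOn σ (Set.Iio (p ^ r)) {z | level p s z ≤ r} ∧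
    ∀ U U', IsLevelUpper S r U → IsLevelUpper T r U' → ∀ e < p ^ r,
      triangleDim K (levelSet p s U).card (levelSet p s U').card (e + 1) =
        triangleDim K (levelSet p s U).card (levelSet p s U').card e +
          sumCount (levelSet p s U) (levelSet p s U') (σ e)

lemma SumCountMono.symm {S T : Set ℕ} {r : ℕ} (h : SumCountMono p s S T r) :
    SumCountMono p s T S r := by
  intro U U' hU hU' z z' hz hz' hzz
  rw [sumCount_comm, sumCount_comm (levelSet p s U)]
  exact h U' U hU' hU z z' hz hz' (by rwa [symmDiff_comm])

lemma LayersMatch.symm {S T : Set ℕ} {r : ℕ} (h : LayersMatch K p s S T r) :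
    LayersMatch K p s T S r := by
  obtain ⟨σ, hσ, h⟩ := h
  refine ⟨σ, hσ, fun U U' hU hU' e he => ?_⟩
  rw [triangleDim_comm, triangleDim_comm K (levelSet p s U).card, sumCount_comm]
  exact h U' U hU' hU e he

lemma sumCount_levelSet_compl {T U U' : Set ℕ} {r : ℕ} (hU' : IsLevelUpper T r U')
    {z : ZMod (p ^ s)} (hz : level p s z ≤ r) :
    sumCount (levelSet p s U) (levelSet p s U') z +
      sumCount (levelSet p s (Set.Iic r \ U)) (levelSet p s U') z = (levelSet p s U').card := by
  rw [levelSet_sdiff, sumCount_sdiff]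
  intro b hb
  exact mem_levelSet.2 (level_sub_le hz (level_le_of_mem hU' hb))

lemma symmDiff_compl_left (S T : Set ℕ) : symmDiff Sᶜ T = (symmDiff S T)ᶜ := by
  ext x; simp only [Set.mem_symmDiff, Set.mem_compl_iff]; tauto

/-- Replacing `U` by its complement replaces the count by the constant `#U'` minus the count, while
the orders for `S` and for the symmetric difference are both reversed. -/
lemma SumCountMono.compl {S T : Set ℕ} {r : ℕ} (h : SumCountMono p s S T r) :
    SumCountMono p s Sᶜ T r := by
  intro U U' hU hU' z z' hz hz' hzz
  rw [symmDiff_compl_left, levelRel_compl] at hzz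
  have h1 := h _ U' hU.compl hU' z' z hz' hz hzz
  have h2 := sumCount_levelSet_compl (U := U) hU' hz
  have h3 := sumCount_levelSet_compl (U := U) hU' hz'
  omega

/-- By `triangleDim_compl`, complementing turns an increment at `p ^ r - 1 - e` into `#U'` minus it
at `e`. So the enumeration is read backwards. -/
lemma LayersMatch.compl [ExpChar K p] {S T : Set ℕ} {r : ℕ} (hr : r ≤ s)
    (h : LayersMatch K p s S T r) : LayersMatch K p s Sᶜ T r := by
  obtain ⟨σ, hσ, h⟩ := h
  refine ⟨fun e => σ (p ^ r - 1 - e), hσ.comp (g := σ) (f := fun e => p ^ r - 1 - e) ?_,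
    fun U U' hU hU' e he => ?_⟩
  · refine ⟨fun e he => ?_, fun e he e' he' hee => ?_, fun e he => ⟨p ^ r - 1 - e, ?_, ?_⟩⟩ <;>
      simp only [Set.mem_Iio] at * <;> omega
  · have hcard : (levelSet p s (Set.Iic r \ U)).card = p ^ r - (levelSet p s U).card := by
      rw [levelSet_sdiff, Finset.card_sdiff_of_subset hU.levelSet_subset, card_levelSet_Iic hr]
    have h1 := h _ U' hU.compl hU' (p ^ r - 1 - e) (by omega)
    rw [hcard] at h1
    have hz : level p s (σ (p ^ r - 1 - e)) ≤ r := hσ.mapsTo (by simp only [Set.mem_Iio]; omega)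
    have h2 := sumCount_levelSet_compl (U := U) hU' hz
    have h3 := triangleDim_compl K p (hU.card_le hr) (hU'.card_le hr) he.le
    have h4 := triangleDim_compl K p (e := e + 1) (hU.card_le hr) (hU'.card_le hr) he
    have e1 : p ^ r - (e + 1) = p ^ r - 1 - e := by omega
    have e2 : p ^ r - e = p ^ r - 1 - e + 1 := by omega
    rw [e1] at h4
    rw [e2, h1] at h3
    rw [mul_add, mul_one] at h4
    dsimp only
    omega

lemma IsLevelUpper.eq_Iic {T U : Set ℕ} {r : ℕ} (hT : r + 1 ∉ T) (h : IsLevelUpper T (r + 1) U)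
    (hr : r + 1 ∈ U) : U = Set.Iic (r + 1) := by
  ext k
  refine ⟨h.le k, fun hk => ?_⟩
  rcases Nat.lt_or_ge k (r + 1) with hk' | hk'
  · refine h.mem k (r + 1) hk hr ?_
    simp only [LevelRel]
    tauto
  · rwa [le_antisymm hk hk']

lemma IsLevelUpper.succ_mem {S U : Set ℕ} {r : ℕ} (hS : r + 1 ∈ S) (h : IsLevelUpper S (r + 1) U)
    (hne : U.Nonempty) : r + 1 ∈ U := by
  obtain ⟨k, hk⟩ := hne
  rcases Nat.lt_or_ge k (r + 1) with hk' | hk'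
  · refine h.mem (r + 1) k le_rfl hk ?_
    simp only [LevelRel]
    tauto
  · rwa [← le_antisymm (h.le k hk) hk']

lemma sumCount_Iic {S U : Set ℕ} {r : ℕ} (h : IsLevelUpper S r U) {z : ZMod (p ^ s)}
    (hz : level p s z ≤ r) :
    sumCount (levelSet p s U) (levelSet p s (Set.Iic r)) z = (levelSet p s U).card := by
  rw [sumCount_comm, sumCount_eq_card]
  intro b hb
  exact mem_levelSet.2 (level_sub_le hz (level_le_of_mem h hb))

lemma sumCount_top {T U U' : Set ℕ} {r : ℕ} (hr : r + 1 ∈ U) (hU' : IsLevelUpper T r U')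
    {z : ZMod (p ^ s)} (hz : level p s z = r + 1) :
    sumCount (levelSet p s U) (levelSet p s U') z = (levelSet p s U').card := by
  rw [sumCount_eq_card]
  intro b hb
  rw [mem_levelSet, level_sub_eq hz (level_le_of_mem hU' hb)]
  exact hr

lemma sumCount_low {T U U' : Set ℕ} {r : ℕ} (hU' : IsLevelUpper T r U')
    {z : ZMod (p ^ s)} (hz : level p s z ≤ r) :
    sumCount (levelSet p s U) (levelSet p s U') z =
      sumCount (levelSet p s (U ∩ Set.Iic r)) (levelSet p s U') z := by
  apply sumCount_congr_left
  intro b hb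
  rw [mem_levelSet, mem_levelSet, Set.mem_inter_iff, Set.mem_Iic]
  have := level_sub_le hz (level_le_of_mem hU' hb)
  tauto

lemma card_levelSet_succ {S U : Set ℕ} {r : ℕ} (hr : r + 1 ≤ s) (h : IsLevelUpper S (r + 1) U)
    (hU : r + 1 ∈ U) :
    (levelSet p s U).card = p ^ r * (p - 1) + (levelSet p s (U ∩ Set.Iic r)).card := by
  rw [← card_level_eq hr, ← Finset.card_union_of_disjoint]
  · congr 1
    ext z
    simp only [Finset.mem_union, mem_levelSet, Finset.mem_filter, Finset.mem_univ, true_and,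
      Set.mem_inter_iff, Set.mem_Iic]
    constructor
    · intro hz
      have := h.le _ hz
      rcases Nat.lt_or_ge (level p s z) (r + 1) with h' | h'
      · exact Or.inr ⟨hz, by omega⟩
      · exact Or.inl (by omega)
    · rintro (hz | hz)
      · rwa [hz]
      · exact hz.1
  · rw [Finset.disjoint_left]
    intro z hz hz'
    simp only [Finset.mem_filter, mem_levelSet, Set.mem_inter_iff, Set.mem_Iic] at hz hz'
    omega

/-- Since `r + 1` is last for `T`, either `U'` is everything and the count is constant, or `U'`
lives in levels `≤ r`. Since `r + 1` is first for `S`, a nonempty `U` contains the whole top level.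
Elements of level `r + 1` then attain the maximal count `#U'`, as they should because `r + 1` is
first for the symmetric difference; for the others the top level of `U` is invisible. -/
lemma SumCountMono.succ {S T : Set ℕ} {r : ℕ} (hS : r + 1 ∈ S) (hT : r + 1 ∉ T)
    (h : SumCountMono p s S T r) : SumCountMono p s S T (r + 1) := by
  intro U U' hU hU' z z' hz hz' hzz
  by_cases hr' : r + 1 ∈ U'
  · rw [hU'.eq_Iic hT hr', sumCount_Iic hU hz, sumCount_Iic hU hz']
  replace hU' := hU'.of_notMem hr'
  rcases U.eq_empty_or_nonempty with rfl | hne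
  · have : levelSet p s ∅ = ∅ := by ext; simp [mem_levelSet]
    simp [this, sumCount]
  have hrU := hU.succ_mem hS hne
  have hD : r + 1 ∈ symmDiff S T := Or.inl ⟨hS, hT⟩
  have hz'' : level p s z' ≠ r + 1 := by
    intro h'
    rw [h'] at hzz
    simp only [LevelRel] at hzz
    have : ¬ (r + 1 < level p s z) := by omega
    tauto
  rcases eq_or_ne (level p s z) (r + 1) with h' | h'
  · rw [sumCount_top hrU hU' h']
    exact sumCount_le _ _ _
  · rw [sumCount_low hU' (z := z) (by omega), sumCount_low hU' (z := z') (by omega)]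
    exact h _ _ hU.inter hU' z z' (by omega) (by omega) hzz

/-- The same case distinction as in `SumCountMono.succ`. The top level of `U` contributes `N = p ^ r
* (p - 1)` to `a`; the first `N` layers are then full, and `triangleDim_add` shifts the remaining
ones to level `r`. -/
lemma LayersMatch.succ [ExpChar K p] {S T : Set ℕ} {r : ℕ} (hr : r + 1 ≤ s) (hS : r + 1 ∈ S)
    (hT : r + 1 ∉ T) (h : LayersMatch K p s S T r) : LayersMatch K p s S T (r + 1) := by
  obtain ⟨σ, hσ, h⟩ := h
  have hp1 := hp.out.one_lt
  set N := p ^ r * (p - 1) with hN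
  have hpow : p ^ (r + 1) = N + p ^ r := by
    rw [hN, pow_succ, ← Nat.mul_succ]; congr 1; omega
  let L := Finset.univ.filter fun z : ZMod (p ^ s) => level p s z = r + 1
  have hL : L.card = N := card_level_eq hr
  let τ := L.equivFin.symm
  -- All elements of level `r + 1` come first, in any order, followed by the old enumeration shifted
  -- by `N`.
  let σ' : ℕ → ZMod (p ^ s) := fun e => if he : e < N then τ ⟨e, hL ▸ he⟩ else σ (e - N)
  have hσ1 : ∀ e (he : e < N), σ' e = τ ⟨e, hL ▸ he⟩ := fun e he => by simp [σ', he]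
  have hσ2 : ∀ e, σ' (N + e) = σ e := fun e => by simp [σ']
  have hlev1 : ∀ e, e < N → level p s (σ' e) = r + 1 := fun e he => by
    rw [hσ1 e he]
    exact (Finset.mem_filter.1 (τ ⟨e, hL ▸ he⟩).2).2
  have hlev2 : ∀ e, e < p ^ r → level p s (σ' (N + e)) ≤ r := fun e he => by
    rw [hσ2]; exact hσ.mapsTo he
  have hsplit : ∀ e, e < p ^ (r + 1) → e < N ∨ ∃ e', e' < p ^ r ∧ e = N + e' := fun e he => by
    rcases Nat.lt_or_ge e N with h' | h'
    · exact Or.inl h'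
    · exact Or.inr ⟨e - N, by omega, by omega⟩
  have hlev : ∀ e, e < p ^ (r + 1) → level p s (σ' e) ≤ r + 1 := fun e he => by
    rcases hsplit e he with h' | ⟨e', he', rfl⟩
    · exact (hlev1 e h').le
    · exact (hlev2 e' he').trans r.le_succ
  refine ⟨σ', ⟨fun e he => hlev e he, fun e he e' he' hee => ?_, fun z hz => ?_⟩,
    fun U U' hU hU' e he => ?_⟩
  · rcases hsplit e he with h1 | ⟨e1, he1, rfl⟩ <;> rcases hsplit e' he' with h2 | ⟨e2, he2, rfl⟩
    · rw [hσ1 e h1, hσ1 e' h2, Subtype.coe_inj, τ.injective.eq_iff] at hee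
      simpa using hee
    · have := hlev1 e h1
      have := hlev2 e2 he2
      rw [hee] at *
      omega
    · have := hlev1 e' h2
      have := hlev2 e1 he1
      rw [hee] at *
      omega
    · rw [hσ2, hσ2] at hee
      rw [hσ.injOn he1 he2 hee]
  · rcases eq_or_ne (level p s z) (r + 1) with h' | h'
    · let i := τ.symm ⟨z, by simp [L, h']⟩
      have hi : (i : ℕ) < N := hL ▸ i.2
      refine ⟨i, by simp only [Set.mem_Iio]; omega, ?_⟩
      rw [hσ1 _ hi]
      simp [i]
    · have hz' : level p s z ≤ r := by have : level p s z ≤ r + 1 := hz; omega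
      obtain ⟨e, he, rfl⟩ := hσ.surjOn hz'
      refine ⟨N + e, ?_, hσ2 e⟩
      simp only [Set.mem_Iio] at *
      omega
  · by_cases hr' : r + 1 ∈ U'
    -- Here `U'` fills all levels, so `b = p ^ (r + 1)`; after exchanging `u` and `v` the relation
    -- of exponent `p ^ (r + 1)` is redundant and every increment is `#U`.
    · rw [hU'.eq_Iic hT hr', sumCount_Iic hU (hlev e he), card_levelSet_Iic hr,
        triangleDim_comm, triangleDim_comm K (levelSet p s U).card,
        triangleDim_of_le K p (r := r + 1) (k := 1) (hU.card_le hr) (by simp) (by simpa using he),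
        triangleDim_of_le K p (r := r + 1) (k := 1) (hU.card_le hr) (by simp)
          (by simpa using he.le)]
      ring
    replace hU' := hU'.of_notMem hr'
    rcases U.eq_empty_or_nonempty with rfl | hne
    · have : levelSet p s ∅ = ∅ := by ext; simp [mem_levelSet]
      simp [this, sumCount, triangleDim_zero_left]
    have hrU := hU.succ_mem hS hne
    have hb := hU'.card_le (p := p) (s := s) (by omega)
    rw [card_levelSet_succ hr hU hrU]
    rcases hsplit e he with h' | ⟨e', he', rfl⟩
    · rw [sumCount_top hrU hU' (hlev1 e h'),
        triangleDim_of_le K p (r := r) (k := p - 1) hb (Nat.le_add_right _ _) h',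
        triangleDim_of_le K p (r := r) (k := p - 1) hb (Nat.le_add_right _ _) h'.le, Nat.mul_succ]
    · rw [sumCount_low hU' (hlev2 e' he'), hσ2, add_assoc N, hN, triangleDim_add K p hb,
        triangleDim_add K p hb, h _ _ hU.inter hU' e' he', add_assoc]

theorem sumCountMono (S T : Set ℕ) (r : ℕ) : SumCountMono p s S T r := by
  induction r generalizing S T with
  | zero =>
    intro U U' hU hU' z z' hz hz' hzz
    rw [Nat.le_zero.1 hz, Nat.le_zero.1 hz'] at hzz
    simp only [LevelRel] at hzz
    have := lt_irrefl 0
    tauto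
  | succ r ih =>
    have key : ∀ S T : Set ℕ, r + 1 ∈ S → r + 1 ∉ T → SumCountMono p s S T (r + 1) :=
      fun S T hS hT => (ih S T).succ hS hT
    by_cases hS : r + 1 ∈ S <;> by_cases hT : r + 1 ∈ T
    -- When `r + 1` lies in both sets, complementing one of them reaches the solved case; the same
    -- trick works when it lies in neither.
    · have := (key T Sᶜ hT (by simpa using hS)).symm.compl
      rwa [compl_compl] at this
    · exact key S T hS hT
    · exact (key T S hT hS).symm
    · have := (key Sᶜ T (by simpa using hS) hT).compl
      rwa [compl_compl] at this

/-- The enumeration `σ` depends on `S` and `T` but not on `U` and `U'`. This is what later allows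
the local identities to be summed over pairs of roots with different level sets. -/
theorem layersMatch [ExpChar K p] (S T : Set ℕ) (r : ℕ) (hr : r ≤ s) :
    LayersMatch K p s S T r := by
  induction r generalizing S T with
  | zero =>
    refine ⟨fun _ => 0, ⟨fun _ _ => by simp [level], ?_, ?_⟩, ?_⟩
    · intro e he e' he' _
      simp only [pow_zero, Set.mem_Iio] at he he'
      omega
    · intro z hz
      refine ⟨0, by simp, ?_⟩
      have : level p s z ≤ 0 := hz
      rw [level_le_iff, pow_zero, one_smul] at this
      exact this.symm
    · intro U U' hU hU' e he
      rw [pow_zero, Nat.lt_one_iff] at he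
      subst he
      have hset : ∀ {S U : Set ℕ}, IsLevelUpper S 0 U →
          levelSet p s U = ∅ ∨ levelSet p s U = {0} := fun {S U} h => by
        rw [← Finset.subset_singleton_iff]
        intro z hz
        have := level_le_of_mem h hz
        rw [level_le_iff, pow_zero, one_smul] at this
        simpa using this
      rcases hset hU with h1 | h1 <;> rcases hset hU' with h2 | h2 <;>
        simp [h1, h2, triangleDim_zero, triangleDim_zero_left, triangleDim_zero_mid,
          triangleDim_one, sumCount, Finset.filter_singleton]
  | succ r ih =>
    have key : ∀ S T : Set ℕ, r + 1 ∈ S → r + 1 ∉ T → LayersMatch K p s S T (r + 1) :=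
      fun S T hS hT => (ih S T (by omega)).succ K hr hS hT
    by_cases hS : r + 1 ∈ S <;> by_cases hT : r + 1 ∈ T
    · have := ((key T Sᶜ hT (by simpa using hS)).symm K).compl K hr
      rwa [compl_compl] at this
    · exact key S T hS hT
    · exact (key T S hT hS).symm K
    · have := (key Sᶜ T (by simpa using hS) hT).compl K hr
      rwa [compl_compl] at this

end PrimePower


/-! ### The algebras `K[x, y] / (f(x), g(y), h(x y))` and their localization at roots -/

section PairDim

variable {K : Type*} [Field K]

/-- The ideal `(f(x), g(y), h(x y))` of `K[x, y]`. -/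
noncomputable def pairIdeal (f g h : K[X]) : Ideal (MvPolynomial (Fin 2) K) :=
  Ideal.span {aeval (MvPolynomial.X 0) f} ⊔ Ideal.span {aeval (MvPolynomial.X 1) g} ⊔
    Ideal.span {aeval (MvPolynomial.X 0 * MvPolynomial.X 1) h}

/-- The dimension of `K[x, y] / (f(x), g(y), h(x y))`. -/
noncomputable def pairDim (f g h : K[X]) : ℕ :=
  Module.finrank K (MvPolynomial (Fin 2) K ⧸ pairIdeal f g h)

/-- The class of `x` in `K[x, y] / (f(x), g(y), h(x y))`. -/
noncomputable def pairX (f g h : K[X]) : MvPolynomial (Fin 2) K ⧸ pairIdeal f g h :=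
  Ideal.Quotient.mkₐ K _ (MvPolynomial.X 0)

/-- The class of `y` in `K[x, y] / (f(x), g(y), h(x y))`. -/
noncomputable def pairY (f g h : K[X]) : MvPolynomial (Fin 2) K ⧸ pairIdeal f g h :=
  Ideal.Quotient.mkₐ K _ (MvPolynomial.X 1)

lemma pair_relations (f g h : K[X]) :
    aeval (pairX f g h) f = 0 ∧ aeval (pairY f g h) g = 0 ∧
      aeval (pairX f g h * pairY f g h) h = 0 := by
  refine ⟨?_, ?_, ?_⟩
  · rw [pairX, aeval_algHom_apply]
    exact Ideal.Quotient.eq_zero_iff_mem.2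
      (Ideal.mem_sup_left (Ideal.mem_sup_left (Ideal.mem_span_singleton_self _)))
  · rw [pairY, aeval_algHom_apply]
    exact Ideal.Quotient.eq_zero_iff_mem.2
      (Ideal.mem_sup_left (Ideal.mem_sup_right (Ideal.mem_span_singleton_self _)))
  · rw [pairX, pairY, ← map_mul, aeval_algHom_apply]
    exact Ideal.Quotient.eq_zero_iff_mem.2 (Ideal.mem_sup_right (Ideal.mem_span_singleton_self _))

lemma exists_algHom_pair {A : Type*} [CommRing A] [Algebra K A] {f g h : K[X]} (x y : A)
    (hx : aeval x f = 0) (hy : aeval y g = 0) (hxy : aeval (x * y) h = 0) :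
    ∃ F : (MvPolynomial (Fin 2) K ⧸ pairIdeal f g h) →ₐ[K] A,
      F (pairX f g h) = x ∧ F (pairY f g h) = y := by
  let φ : MvPolynomial (Fin 2) K →ₐ[K] A := MvPolynomial.aeval ![x, y]
  have h0 : φ (MvPolynomial.X 0) = x := by simp [φ]
  have h1 : φ (MvPolynomial.X 1) = y := by simp [φ]
  have hker : ∀ z ∈ pairIdeal f g h, φ z = 0 := by
    change pairIdeal f g h ≤ RingHom.ker φ
    rw [pairIdeal, sup_le_iff, sup_le_iff, Ideal.span_singleton_le_iff_mem,
      Ideal.span_singleton_le_iff_mem, Ideal.span_singleton_le_iff_mem, RingHom.mem_ker,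
      RingHom.mem_ker, RingHom.mem_ker, ← aeval_algHom_apply, ← aeval_algHom_apply,
      ← aeval_algHom_apply, map_mul, h0, h1]
    exact ⟨⟨hx, hy⟩, hxy⟩
  exact ⟨Ideal.Quotient.liftₐ _ φ hker, h0, h1⟩

lemma pair_adjoin_eq_top (f g h : K[X]) :
    Algebra.adjoin K {pairX f g h, pairY f g h} = ⊤ := by
  rw [eq_top_iff]
  rintro z -
  obtain ⟨z, rfl⟩ := Ideal.Quotient.mkₐ_surjective K _ z
  have hz : z ∈ Algebra.adjoin K (Set.range (MvPolynomial.X : Fin 2 → MvPolynomial (Fin 2) K)) := by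
    rw [MvPolynomial.adjoin_range_X]; trivial
  have := (Subalgebra.mem_map (f := Ideal.Quotient.mkₐ K (pairIdeal f g h))).2 ⟨z, hz, rfl⟩
  rw [AlgHom.map_adjoin] at this
  refine Algebra.adjoin_mono ?_ this
  rintro _ ⟨_, ⟨i, rfl⟩, rfl⟩
  fin_cases i
  · exact Or.inl rfl
  · exact Or.inr rfl

lemma pair_subalgebra_eq_top {f g h : K[X]}
    {S : Subalgebra K (MvPolynomial (Fin 2) K ⧸ pairIdeal f g h)} (hx : pairX f g h ∈ S)
    (hy : pairY f g h ∈ S) : S = ⊤ := by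
  rw [eq_top_iff, ← pair_adjoin_eq_top, Algebra.adjoin_le_iff]
  rintro z (rfl | rfl)
  · exact hx
  · exact hy

lemma finite_pair {f g : K[X]} (hf : f.Monic) (hg : g.Monic) (h : K[X]) :
    Module.Finite K (MvPolynomial (Fin 2) K ⧸ pairIdeal f g h) := by
  have := Algebra.finite_adjoin_of_finite_of_isIntegral (R := K)
    (s := {pairX f g h, pairY f g h}) (by simp) (by
      rintro z (rfl | rfl)
      · exact ⟨f, hf, (pair_relations f g h).1⟩
      · exact ⟨g, hg, (pair_relations f g h).2.1⟩)
  rw [pair_adjoin_eq_top] at this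
  exact Module.Finite.equiv (Subalgebra.topEquiv (R := K)).toLinearEquiv

/-- Coprimality of `u` and `v` identifies the colon ideal `(I + (u v) : u)` with `I + (v)`. -/
lemma finrank_quotient_sup_mul {R : Type*} [CommRing R] [Algebra K R] (I : Ideal R) {u v : R}
    (huv : IsCoprime u v) [Module.Finite K (R ⧸ (I ⊔ Ideal.span {u * v}))] :
    Module.finrank K (R ⧸ (I ⊔ Ideal.span {u * v})) =
      Module.finrank K (R ⧸ (I ⊔ Ideal.span {u})) + Module.finrank K (R ⧸ (I ⊔ Ideal.span {v})) := by
  rw [← finrank_quotient_colon (K := K) (I ⊔ Ideal.span {u * v}) (I ⊔ Ideal.span {v}) u, add_comm]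
  · have hle : Ideal.span {u * v} ≤ Ideal.span {u} := by
      rw [Ideal.span_singleton_le_iff_mem]
      exact Ideal.mul_mem_right _ _ (Ideal.mem_span_singleton_self _)
    rw [sup_assoc, sup_eq_right.2 hle]
  · intro c
    constructor
    · intro hc
      obtain ⟨i, hi, j, hj, rfl⟩ := Submodule.mem_sup.1 hc
      obtain ⟨d, rfl⟩ := Ideal.mem_span_singleton.1 hj
      rw [mul_add, ← mul_assoc]
      exact Ideal.add_mem _ (Ideal.mem_sup_left (Ideal.mul_mem_left _ _ hi))
        (Ideal.mem_sup_right (Ideal.mul_mem_right _ _ (Ideal.mem_span_singleton_self _)))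
    · intro hc
      obtain ⟨α, β, hαβ⟩ := huv
      have hle : I ⊔ Ideal.span {u * v} ≤ I ⊔ Ideal.span {v} := by
        refine sup_le_sup_left ?_ _
        rw [Ideal.span_singleton_le_iff_mem]
        exact Ideal.mul_mem_left _ _ (Ideal.mem_span_singleton_self _)
      have : c = α * (u * c) + (β * c) * v := by
        calc c = (α * u + β * v) * c := by rw [hαβ, one_mul]
          _ = _ := by ring
      rw [this]
      exact Ideal.add_mem _ (Ideal.mul_mem_left _ _ (hle hc))
        (Ideal.mem_sup_right (Ideal.mul_mem_left _ _ (Ideal.mem_span_singleton_self _)))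

lemma pairDim_mul_left {f₁ f₂ g : K[X]} (h : K[X]) (hf₁ : f₁.Monic) (hf₂ : f₂.Monic)
    (hg : g.Monic) (hc : IsCoprime f₁ f₂) :
    pairDim (f₁ * f₂) g h = pairDim f₁ g h + pairDim f₂ g h := by
  have := finite_pair (hf₁.mul hf₂) hg h
  have e : ∀ f : K[X], pairIdeal f g h = (Ideal.span {aeval (MvPolynomial.X 1) g} ⊔
      Ideal.span {aeval (MvPolynomial.X 0 * MvPolynomial.X 1) h}) ⊔
      Ideal.span {aeval (MvPolynomial.X 0) f} := fun f => by
    rw [pairIdeal, sup_assoc, sup_comm]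
  rw [e, map_mul] at this
  rw [pairDim, pairDim, pairDim, e, e, e, map_mul]
  exact finrank_quotient_sup_mul _ (hc.map (aeval (R := K) _).toRingHom)

lemma pairDim_mul_mid {f g₁ g₂ : K[X]} (h : K[X]) (hf : f.Monic) (hg₁ : g₁.Monic)
    (hg₂ : g₂.Monic) (hc : IsCoprime g₁ g₂) :
    pairDim f (g₁ * g₂) h = pairDim f g₁ h + pairDim f g₂ h := by
  have := finite_pair hf (hg₁.mul hg₂) h
  have e : ∀ g : K[X], pairIdeal f g h = (Ideal.span {aeval (MvPolynomial.X 0) f} ⊔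
      Ideal.span {aeval (MvPolynomial.X 0 * MvPolynomial.X 1) h}) ⊔
      Ideal.span {aeval (MvPolynomial.X 1) g} := fun g => by
    rw [pairIdeal, sup_right_comm]
  rw [e, map_mul] at this
  rw [pairDim, pairDim, pairDim, e, e, e, map_mul]
  exact finrank_quotient_sup_mul _ (hc.map (aeval (R := K) _).toRingHom)

lemma pairDim_mul_right {f g : K[X]} (h₁ h₂ : K[X]) (hf : f.Monic) (hg : g.Monic)
    (hc : IsCoprime h₁ h₂) :
    pairDim f g (h₁ * h₂) = pairDim f g h₁ + pairDim f g h₂ := by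
  have := finite_pair hf hg (h₁ * h₂)
  rw [pairIdeal, map_mul] at this
  rw [pairDim, pairDim, pairDim, pairIdeal, pairIdeal, pairIdeal, map_mul]
  exact finrank_quotient_sup_mul _ (hc.map (aeval (R := K) _).toRingHom)

lemma pairDim_eq_zero_of {f g h : K[X]} (h1 : (1 : MvPolynomial (Fin 2) K) ∈ pairIdeal f g h) :
    pairDim f g h = 0 := by
  rw [pairDim, (Ideal.eq_top_iff_one _).2 h1]
  have : Subsingleton (MvPolynomial (Fin 2) K ⧸ (⊤ : Ideal (MvPolynomial (Fin 2) K))) :=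
    Ideal.Quotient.subsingleton_iff.2 rfl
  exact Module.finrank_zero_of_subsingleton

lemma pairDim_one_left (g h : K[X]) : pairDim 1 g h = 0 := by
  apply pairDim_eq_zero_of
  exact Ideal.mem_sup_left (Ideal.mem_sup_left (by simp))

lemma pairDim_one_mid (f h : K[X]) : pairDim f 1 h = 0 := by
  apply pairDim_eq_zero_of
  exact Ideal.mem_sup_left (Ideal.mem_sup_right (by simp))

lemma pairDim_one_right (f g : K[X]) : pairDim f g 1 = 0 := by
  apply pairDim_eq_zero_of
  exact Ideal.mem_sup_right (by simp)

section Prod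

variable {ι : Type*} {F : ι → K[X]}

lemma isCoprime_prod_of_notMem (hc : Pairwise fun i j => IsCoprime (F i) (F j)) {s : Finset ι}
    {i : ι} (hi : i ∉ s) : IsCoprime (F i) (∏ j ∈ s, F j) :=
  IsCoprime.prod_right fun _ hj => hc fun hij => hi (hij ▸ hj)

variable [DecidableEq ι]

lemma pairDim_prod_left {g : K[X]} (h : K[X]) (hF : ∀ i, (F i).Monic) (hg : g.Monic)
    (hc : Pairwise fun i j => IsCoprime (F i) (F j)) (s : Finset ι) :
    pairDim (∏ i ∈ s, F i) g h = ∑ i ∈ s, pairDim (F i) g h := by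
  induction s using Finset.induction_on with
  | empty => simp [pairDim_one_left]
  | insert i s hi ih =>
    rw [Finset.prod_insert hi, Finset.sum_insert hi, pairDim_mul_left h (hF i)
      (monic_prod_of_monic _ _ fun j _ => hF j) hg (isCoprime_prod_of_notMem hc hi), ih]

lemma pairDim_prod_mid {f : K[X]} (h : K[X]) (hf : f.Monic) (hF : ∀ i, (F i).Monic)
    (hc : Pairwise fun i j => IsCoprime (F i) (F j)) (s : Finset ι) :
    pairDim f (∏ i ∈ s, F i) h = ∑ i ∈ s, pairDim f (F i) h := by
  induction s using Finset.induction_on with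
  | empty => simp [pairDim_one_mid]
  | insert i s hi ih =>
    rw [Finset.prod_insert hi, Finset.sum_insert hi, pairDim_mul_mid h hf (hF i)
      (monic_prod_of_monic _ _ fun j _ => hF j) (isCoprime_prod_of_notMem hc hi), ih]

lemma pairDim_prod_right {f g : K[X]} (hf : f.Monic) (hg : g.Monic)
    (hc : Pairwise fun i j => IsCoprime (F i) (F j)) (s : Finset ι) :
    pairDim f g (∏ i ∈ s, F i) = ∑ i ∈ s, pairDim f g (F i) := by
  induction s using Finset.induction_on with
  | empty => simp [pairDim_one_right]
  | insert i s hi ih =>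
    rw [Finset.prod_insert hi, Finset.sum_insert hi, pairDim_mul_right _ _ hf hg
      (isCoprime_prod_of_notMem hc hi), ih]

end Prod

/-- Modulo nilpotents `x y` is both `μ ν` and `ξ`, so the unit `μ ν - ξ` is nilpotent. -/
lemma subsingleton_of_isNilpotent_sub {A : Type*} [CommRing A] [Algebra K A] {x y : A} {μ ν ξ : K}
    (h : μ * ν ≠ ξ) (n1 : IsNilpotent (x - algebraMap K A μ))
    (n2 : IsNilpotent (y - algebraMap K A ν)) (n3 : IsNilpotent (x * y - algebraMap K A ξ)) :
    Subsingleton A := by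
  have n4 : IsNilpotent (algebraMap K A (μ * ν - ξ)) := by
    have : algebraMap K A (μ * ν - ξ) = (x * y - algebraMap K A ξ) -
        ((x - algebraMap K A μ) * y + algebraMap K A μ * (y - algebraMap K A ν)) := by
      rw [map_sub, map_mul]; ring
    rw [this]
    exact (Commute.all _ _).isNilpotent_sub n3 ((Commute.all _ _).isNilpotent_add
      ((Commute.all _ _).isNilpotent_mul_right n1) ((Commute.all _ _).isNilpotent_mul_left n2))
  have u4 : IsUnit (algebraMap K A (μ * ν - ξ)) := (sub_ne_zero.2 h).isUnit.map _
  by_contra hA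
  rw [not_subsingleton_iff_nontrivial] at hA
  exact u4.not_isNilpotent n4

lemma pairDim_local_ne {μ ν ξ : K} (h : μ * ν ≠ ξ) (a b e : ℕ) :
    pairDim ((X - C μ) ^ a) ((X - C ν) ^ b) ((X - C ξ) ^ e) = 0 := by
  obtain ⟨h1, h2, h3⟩ := pair_relations ((X - C μ) ^ a) ((X - C ν) ^ b) ((X - C ξ) ^ e)
  simp only [map_pow, map_sub, aeval_X, aeval_C] at h1 h2 h3
  have := subsingleton_of_isNilpotent_sub h ⟨a, h1⟩ ⟨b, h2⟩ ⟨e, h3⟩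
  exact Module.finrank_zero_of_subsingleton

/-- The change of coordinates is `u = ν (x - μ)`, `v = x (y - ν)`, chosen so that `u + v = x y - μ
ν`. -/
lemma exists_algHom_triangle_of_pair {A : Type*} [CommRing A] [Algebra K A] {μ ν : K}
    (hμ : μ ≠ 0) (hν : ν ≠ 0) {a b e : ℕ} {x y : A} (h1 : (x - algebraMap K A μ) ^ a = 0)
    (h2 : (y - algebraMap K A ν) ^ b = 0)
    (h3 : (x * y - algebraMap K A μ * algebraMap K A ν) ^ e = 0) :
    ∃ F : ((Trunc K b)[X] ⧸ triangleIdeal K a b e) →ₐ[K] A, x ∈ F.range ∧ y ∈ F.range := by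
  obtain ⟨F, hu, hv⟩ := exists_algHom_triangle K (A := A) (a := a) (b := b) (e := e)
    (algebraMap K A ν * (x - algebraMap K A μ)) (x * (y - algebraMap K A ν))
    (by rw [mul_pow, h1, mul_zero]) (by rw [mul_pow, h2, mul_zero])
    (by rw [← h3]; congr 1; ring)
  have hN : x - algebraMap K A μ ∈ F.range := by
    have : x - algebraMap K A μ = algebraMap K A ν⁻¹ *
        (algebraMap K A ν * (x - algebraMap K A μ)) := by
      rw [← mul_assoc, ← map_mul, inv_mul_cancel₀ hν, map_one, one_mul]
    rw [this]
    exact F.range.mul_mem (F.range.algebraMap_mem _) ⟨_, hu⟩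
  have hx' : x ∈ F.range := by
    rw [← sub_add_cancel x (algebraMap K A μ)]
    exact F.range.add_mem hN (F.range.algebraMap_mem _)
  -- In the image, `x` is the nonzero scalar `μ` plus a nilpotent, so its inverse is already in the
  -- image and `y = ν + x⁻¹ v` can be recovered.
  have hunit : IsUnit (⟨x, hx'⟩ : F.range) := by
    have hnil : IsNilpotent (⟨x - algebraMap K A μ, hN⟩ : F.range) :=
      ⟨a, Subtype.ext (by simpa using h1)⟩
    have h4 : (⟨x, hx'⟩ : F.range) =
        ⟨x - algebraMap K A μ, hN⟩ + algebraMap K F.range μ := by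
      apply Subtype.ext
      change x = (x - algebraMap K A μ) + algebraMap K A μ
      ring
    rw [h4]
    exact hnil.isUnit_add_right_of_commute (hμ.isUnit.map _) (Commute.all _ _)
  obtain ⟨z, hz⟩ := hunit.exists_left_inv
  refine ⟨F, hx', ?_⟩
  have h5 : y = algebraMap K A ν + z.1 * (x * (y - algebraMap K A ν)) := by
    have : z.1 * x = 1 := congrArg Subtype.val hz
    rw [← mul_assoc, this]; ring
  rw [h5]
  exact F.range.add_mem (F.range.algebraMap_mem _) (F.range.mul_mem z.2 ⟨_, hv⟩)

/-- The inverse change of coordinates: `x = μ + ν⁻¹ u` and `y = ν + x⁻¹ v`. -/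
lemma exists_algHom_pair_of_triangle {A : Type*} [CommRing A] [Algebra K A] {μ ν : K}
    (hμ : μ ≠ 0) (hν : ν ≠ 0) {a b e : ℕ} {u v : A} (h1 : u ^ a = 0) (h2 : v ^ b = 0)
    (h3 : (u + v) ^ e = 0) :
    ∃ F : (MvPolynomial (Fin 2) K ⧸
        pairIdeal ((X - C μ) ^ a) ((X - C ν) ^ b) ((X - C (μ * ν)) ^ e)) →ₐ[K] A,
      u ∈ F.range ∧ v ∈ F.range := by
  have hνA : algebraMap K A ν⁻¹ * algebraMap K A ν = 1 := by
    rw [← map_mul, inv_mul_cancel₀ hν, map_one]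
  have hunit : IsUnit (algebraMap K A ν⁻¹ * u + algebraMap K A μ) :=
    IsNilpotent.isUnit_add_right_of_commute
      ((Commute.all _ _).isNilpotent_mul_left ⟨a, h1⟩) (hμ.isUnit.map _) (Commute.all _ _)
  set x := algebraMap K A ν⁻¹ * u + algebraMap K A μ with hx
  obtain ⟨z, hz⟩ := hunit.exists_left_inv
  have hxy : x * (algebraMap K A ν + z * v) =
      u + v + algebraMap K A μ * algebraMap K A ν := by
    calc x * (algebraMap K A ν + z * v) = x * algebraMap K A ν + (z * x) * v := by ring
      _ = x * algebraMap K A ν + v := by rw [hz, one_mul]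
      _ = (algebraMap K A ν⁻¹ * algebraMap K A ν) * u + v +
          algebraMap K A μ * algebraMap K A ν := by rw [hx]; ring
      _ = _ := by rw [hνA, one_mul]
  obtain ⟨F, hFx, hFy⟩ := exists_algHom_pair (f := (X - C μ) ^ a) (g := (X - C ν) ^ b)
    (h := (X - C (μ * ν)) ^ e) x (algebraMap K A ν + z * v)
    (by simp [hx, mul_pow, h1]) (by simp [mul_pow, h2])
    (by simp only [hxy, map_pow, map_sub, aeval_X, aeval_C, map_mul, add_sub_cancel_right, h3])
  have m1 : x ∈ F.range := ⟨_, hFx⟩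
  have m2 : algebraMap K A ν + z * v ∈ F.range := ⟨_, hFy⟩
  refine ⟨F, ?_, ?_⟩
  · have : u = algebraMap K A ν * (x - algebraMap K A μ) := by
      calc u = (algebraMap K A ν⁻¹ * algebraMap K A ν) * u := by rw [hνA, one_mul]
        _ = _ := by rw [hx]; ring
    rw [this]
    exact F.range.mul_mem (F.range.algebraMap_mem _)
      (F.range.sub_mem m1 (F.range.algebraMap_mem _))
  · have : v = x * ((algebraMap K A ν + z * v) - algebraMap K A ν) := by
      calc v = (z * x) * v := by rw [hz, one_mul]
        _ = _ := by ring
    rw [this]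
    exact F.range.mul_mem m1 (F.range.sub_mem m2 (F.range.algebraMap_mem _))

lemma pairDim_local_eq {μ ν : K} (hμ : μ ≠ 0) (hν : ν ≠ 0) (a b e : ℕ) :
    pairDim ((X - C μ) ^ a) ((X - C ν) ^ b) ((X - C (μ * ν)) ^ e) = triangleDim K a b e := by
  have := finite_pair ((monic_X_sub_C μ).pow a) ((monic_X_sub_C ν).pow b) ((X - C (μ * ν)) ^ e)
  apply le_antisymm
  · obtain ⟨h1, h2, h3⟩ := pair_relations ((X - C μ) ^ a) ((X - C ν) ^ b) ((X - C (μ * ν)) ^ e)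
    simp only [map_pow, map_sub, aeval_X, aeval_C, map_mul] at h1 h2 h3
    obtain ⟨F, hx, hy⟩ := exists_algHom_triangle_of_pair hμ hν h1 h2 h3
    refine finrank_le_of_algHom_surjective K F ?_
    rw [← AlgHom.range_eq_top]
    exact pair_subalgebra_eq_top hx hy
  · obtain ⟨h1, h2, h3⟩ := triangle_relations K a b e
    obtain ⟨F, hu, hv⟩ := exists_algHom_pair_of_triangle hμ hν h1 h2 h3
    refine finrank_le_of_algHom_surjective K F ?_
    rw [← AlgHom.range_eq_top]
    exact triangle_subalgebra_eq_top K _ hu hv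

end PairDim


/-! ### Spanning by powers of `y` over polynomials in `t` -/

section Monogenic

variable {K : Type*} [Field K]

/-- A finite-dimensional algebra generated by one element is spanned by its first powers. -/
lemma exists_eq_sum_pow_of_finrank_le {A : Type*} [CommRing A] [Algebra K A] [Module.Finite K A]
    {y : A} (hy : Algebra.adjoin K {y} = ⊤) {m : ℕ} (hm : Module.finrank K A ≤ m) (x : A) :
    ∃ c : ℕ → K, x = ∑ k ∈ Finset.range m, algebraMap K A (c k) * y ^ k := by
  have hx : x ∈ Algebra.adjoin K {y} := hy ▸ Algebra.mem_top
  rw [Algebra.adjoin_singleton_eq_range_aeval] at hx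
  obtain ⟨F, rfl⟩ := hx
  -- Cayley–Hamilton for multiplication by `y` supplies a monic polynomial of degree `dim A` that
  -- annihilates `y`; reduce modulo it.
  let φ : A →ₗ[K] A := LinearMap.mulLeft K y
  have hφ : aeval y φ.charpoly = 0 := by
    have h1 := LinearMap.aeval_self_charpoly φ
    have h2 : aeval φ φ.charpoly = LinearMap.mulLeft K (aeval y φ.charpoly) :=
      aeval_algHom_apply (Algebra.lmul K A) y φ.charpoly
    rw [h2] at h1
    simpa using LinearMap.congr_fun h1 1
  rcases subsingleton_or_nontrivial A with hA | hA
  · exact ⟨0, Subsingleton.elim _ _⟩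
  have hmon := φ.charpoly_monic
  have hdeg : (F %ₘ φ.charpoly).natDegree < m := by
    refine lt_of_lt_of_le (natDegree_modByMonic_lt F hmon ?_) ?_
    · intro h
      have h' := φ.charpoly_natDegree
      rw [h, natDegree_one] at h'
      exact Module.finrank_pos.ne h'
    · rw [φ.charpoly_natDegree]; exact hm
  refine ⟨fun k => (F %ₘ φ.charpoly).coeff k, ?_⟩
  change aeval y F = _
  conv_lhs => rw [← modByMonic_add_div F φ.charpoly]
  rw [map_add, map_mul, hφ, zero_mul, add_zero, aeval_eq_sum_range' hdeg]
  simp only [Algebra.smul_def]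

/-- All multiples of `h(t)` are multiples of `h(t)` by combinations of `1, y, …, y ^ (m - 1)`
with coefficients polynomials in `t`. -/
def MulSpanned {R A : Type*} [CommRing R] [CommRing A] [Algebra R A] (t y : A) (m : ℕ)
    (h : R[X]) : Prop :=
  ∀ x : A, ∃ c : ℕ → R[X],
    aeval t h * x = aeval t h * ∑ k ∈ Finset.range m, aeval t (c k) * y ^ k

/-- The quotient `h(t) A / h(t) (t - ξ) A` is isomorphic to `A / J` for a colon ideal `J`. There `t`
acts as the scalar `ξ`, so `y` alone generates, and dimension at most `m` means that `1, …, y ^ (m -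
1)` span. The remaining error lies in `h(t) (t - ξ) A`. -/
lemma MulSpanned.of_mul_X_sub_C {A : Type*} [CommRing A] [Algebra K A] [Module.Finite K A]
    {t y : A} (hty : Algebra.adjoin K {t, y} = ⊤) {m : ℕ} {h : K[X]} {ξ : K}
    (hdim : Module.finrank K (A ⧸ Ideal.span {aeval t (h * (X - C ξ))}) ≤
      Module.finrank K (A ⧸ Ideal.span {aeval t h}) + m)
    (hP : MulSpanned t y m (h * (X - C ξ))) : MulSpanned t y m h := by
  set u := aeval t h with hu
  have hmul : aeval t (h * (X - C ξ)) = u * (t - algebraMap K A ξ) := by simp [hu]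
  rw [hmul] at hdim
  let J : Ideal A := Submodule.comap (LinearMap.mulLeft A u)
    (Ideal.span {u * (t - algebraMap K A ξ)})
  have hJ : ∀ c, c ∈ J ↔ u * c ∈ Ideal.span {u * (t - algebraMap K A ξ)} := fun c => Iff.rfl
  have hcol := finrank_quotient_colon (K := K) _ J u hJ
  have hle : Ideal.span {u * (t - algebraMap K A ξ)} ≤ Ideal.span {u} := by
    rw [Ideal.span_singleton_le_iff_mem]
    exact Ideal.mul_mem_right _ _ (Ideal.mem_span_singleton_self _)
  rw [sup_eq_right.2 hle] at hcol
  have hJm : Module.finrank K (A ⧸ J) ≤ m := by omega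
  have htJ : Ideal.Quotient.mkₐ K J t = algebraMap K (A ⧸ J) ξ := by
    rw [← sub_eq_zero, ← AlgHom.commutes (Ideal.Quotient.mkₐ K J), ← map_sub]
    exact Ideal.Quotient.eq_zero_iff_mem.2 ((hJ _).2 (Ideal.mem_span_singleton_self _))
  have hgen : Algebra.adjoin K {Ideal.Quotient.mkₐ K J y} = ⊤ := by
    rw [eq_top_iff]
    rintro z -
    obtain ⟨z, rfl⟩ := Ideal.Quotient.mkₐ_surjective K J z
    have hz : z ∈ Algebra.adjoin K {t, y} := hty ▸ Algebra.mem_top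
    have := (Subalgebra.mem_map (f := Ideal.Quotient.mkₐ K J)).2 ⟨z, hz, rfl⟩
    rw [AlgHom.map_adjoin] at this
    refine Algebra.adjoin_le (S := Algebra.adjoin K {Ideal.Quotient.mkₐ K J y}) ?_ this
    rintro _ ⟨w, rfl | rfl, rfl⟩
    · rw [htJ]; exact Subalgebra.algebraMap_mem _ _
    · exact Algebra.subset_adjoin rfl
  intro x
  obtain ⟨c, hc⟩ := exists_eq_sum_pow_of_finrank_le hgen hJm (Ideal.Quotient.mkₐ K J x)
  have hsub : x - ∑ k ∈ Finset.range m, algebraMap K A (c k) * y ^ k ∈ J := by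
    rw [← Ideal.Quotient.eq_zero_iff_mem, ← Ideal.Quotient.mkₐ_eq_mk K, map_sub, hc, map_sum,
      sub_eq_zero]
    refine Finset.sum_congr rfl fun k _ => ?_
    rw [map_mul, map_pow, AlgHom.commutes]
  obtain ⟨x', hx'⟩ := Ideal.mem_span_singleton'.1 ((hJ _).1 hsub)
  obtain ⟨c', hc'⟩ := hP x'
  -- The scalar `c k` comes from the quotient by `J`; the multiple of `X - ξ` corrects the error.
  refine ⟨fun k => C (c k) + (X - C ξ) * c' k, ?_⟩
  have h1 : u * x = u * ∑ k ∈ Finset.range m, algebraMap K A (c k) * y ^ k +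
      (u * (t - algebraMap K A ξ)) * x' := by
    rw [mul_sub] at hx'
    linear_combination -hx'
  rw [h1, ← hmul, hc', hmul, mul_assoc, ← mul_add, Finset.mul_sum, ← Finset.sum_add_distrib]
  congr 1
  refine Finset.sum_congr rfl fun k _ => ?_
  simp only [map_add, map_mul, map_sub, aeval_X, aeval_C]
  ring

end Monogenic

/-! ### Products of linear factors indexed by a finite group, and their layers -/

section RootProd

variable {K : Type*} [Field K] {Z : Type*} [Fintype Z]

/-- The polynomial `∏_z (X - ψ(z)) ^ a(z)`. -/
noncomputable def rootProd (ψ : Z → K) (a : Z → ℕ) : K[X] := ∏ z, (X - C (ψ z)) ^ a z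

lemma rootProd_monic (ψ : Z → K) (a : Z → ℕ) : (rootProd ψ a).Monic :=
  monic_prod_of_monic _ _ fun _ _ => (monic_X_sub_C _).pow _

lemma rootProd_update [DecidableEq Z] (ψ : Z → K) (a : Z → ℕ) (z : Z) :
    rootProd ψ (Function.update a z (a z + 1)) = rootProd ψ a * (X - C (ψ z)) := by
  rw [rootProd, rootProd, ← Finset.mul_prod_erase _ _ (Finset.mem_univ z),
    ← Finset.mul_prod_erase (f := fun i => (X - C (ψ i)) ^ a i) _ (Finset.mem_univ z),
    Function.update_self, pow_succ, mul_right_comm]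
  congr 2
  refine Finset.prod_congr rfl fun i hi => ?_
  rw [Function.update_of_ne (Finset.ne_of_mem_erase hi)]

variable [AddCommGroup Z]

/-- The sum of the dimensions of the local algebras at `ψ(z)`. -/
noncomputable def localDim (K : Type*) [Field K] (a b : Z → ℕ) (z : Z) (e : ℕ) : ℕ :=
  ∑ z₁, triangleDim K (a z₁) (b (z - z₁)) e

/-- Coprime splitting isolates triples of roots; only triples `ψ(z₁), ψ(z₂), ψ(z₁ + z₂)` contribute,
each with the dimension of its local algebra. -/
lemma pairDim_rootProd [DecidableEq Z] {ψ : Z → K} (hψ : ∀ z, ψ z ≠ 0)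
    (hmul : ∀ z z', ψ (z + z') = ψ z * ψ z') (hinj : Function.Injective ψ) (a b e : Z → ℕ) :
    pairDim (rootProd ψ a) (rootProd ψ b) (rootProd ψ e) = ∑ z, localDim K a b z (e z) := by
  have hc : ∀ a : Z → ℕ, Pairwise fun i j =>
      IsCoprime ((X - C (ψ i)) ^ a i) ((X - C (ψ j)) ^ a j) := fun a i j hij =>
    (pairwise_coprime_X_sub_C hinj hij).pow
  have hm : ∀ (a : Z → ℕ) (i : Z), ((X - C (ψ i)) ^ a i).Monic := fun a i =>
    (monic_X_sub_C _).pow _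
  conv_lhs => rw [rootProd]
  rw [pairDim_prod_left _ (hm a) (rootProd_monic _ _) (hc a)]
  simp only [localDim]
  rw [Finset.sum_comm]
  refine Finset.sum_congr rfl fun z₁ _ => ?_
  conv_lhs => rw [rootProd]
  rw [pairDim_prod_mid _ (hm a _) (hm b) (hc b)]
  have : ∀ z₂, pairDim ((X - C (ψ z₁)) ^ a z₁) ((X - C (ψ z₂)) ^ b z₂) (rootProd ψ e) =
      triangleDim K (a z₁) (b z₂) (e (z₁ + z₂)) := fun z₂ => by
    rw [rootProd, pairDim_prod_right (hm a _) (hm b _) (hc e),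
      Finset.sum_eq_single (z₁ + z₂), hmul, pairDim_local_eq (hψ _) (hψ _)]
    · intro z _ hz
      apply pairDim_local_ne
      rw [← hmul]
      exact fun h => hz (hinj h).symm
    · simp
  simp only [this]
  refine Fintype.sum_equiv (Equiv.addLeft z₁) _ _ fun z₂ => ?_
  simp

lemma localDim_concave (a b : Z → ℕ) (z : Z) (e : ℕ) :
    localDim K a b z (e + 2) + localDim K a b z e ≤
      localDim K a b z (e + 1) + localDim K a b z (e + 1) := by
  simp only [localDim, ← Finset.sum_add_distrib]
  exact Finset.sum_le_sum fun _ _ => triangleDim_concave K _ _ _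

/-- For an antitone `f` the set where `m < f e` is an initial segment, so its cardinality tells
where it ends. -/
lemma lt_card_filter_iff {q m : ℕ} {f : ℕ → ℕ} (hf : ∀ e, e + 1 < q → f (e + 1) ≤ f e) {e : ℕ}
    (he : e < q) : e < ((Finset.range q).filter fun e => m < f e).card ↔ m < f e := by
  have hanti : ∀ d e, e + d < q → f (e + d) ≤ f e := by
    intro d
    induction d with
    | zero => intro e _; exact le_rfl
    | succ d ih => intro e h; exact (hf (e + d) h).trans (ih e (by omega))
  constructor
  · intro h
    by_contra hm
    have : ((Finset.range q).filter fun e => m < f e) ⊆ Finset.range e := by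
      intro i hi
      simp only [Finset.mem_filter, Finset.mem_range] at hi ⊢
      by_contra hie
      have := hanti (i - e) e (by omega)
      rw [Nat.add_sub_cancel' (by omega)] at this
      omega
    have := Finset.card_le_card this
    rw [Finset.card_range] at this
    omega
  · intro h
    have : Finset.range (e + 1) ⊆ (Finset.range q).filter fun e => m < f e := by
      intro i hi
      simp only [Finset.mem_filter, Finset.mem_range] at hi ⊢
      have := hanti (e - i) i (by omega)
      rw [Nat.add_sub_cancel' (by omega)] at this
      exact ⟨by omega, by omega⟩
    have := Finset.card_le_card this
    rw [Finset.card_range] at this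
    omega

variable {Q : Type*} [Fintype Q]

section Layers

variable {ψ : Z → K} (hψ : ∀ z, ψ z ≠ 0) (hmul : ∀ z z', ψ (z + z') = ψ z * ψ z')
  (hinj : Function.Injective ψ) {a b : Z → ℕ} {q : ℕ} {σ : ℕ → Q} {w : Q → Z → ℕ}
  (hσ : Set.BijOn σ (Set.Iio q) Set.univ)
  (hw : ∀ z, ∀ e < q, localDim K a b z (e + 1) = localDim K a b z e + w (σ e) z)

include hσ in
lemma sum_layers {M : Type*} [AddCommMonoid M] (f : Q → M) :
    ∑ i, f i = ∑ e ∈ Finset.range q, f (σ e) := by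
  symm
  refine Finset.sum_nbij σ (fun _ _ => Finset.mem_univ _) ?_ ?_ fun _ _ => rfl
  · simpa using hσ.injOn
  · simpa using hσ.surjOn

include hσ in
omit [Fintype Z] [AddCommGroup Z] in
lemma card_layers (m : ℕ) (z : Z) : (Finset.univ.filter fun i => m < w i z).card =
    ((Finset.range q).filter fun e => m < w (σ e) z).card := by
  rw [Finset.card_filter, Finset.card_filter, sum_layers hσ]

include hw in
omit [Fintype Q] in
lemma layers_antitone (z : Z) (e : ℕ) (he : e + 1 < q) : w (σ (e + 1)) z ≤ w (σ e) z := by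
  have h1 := hw z e (by omega)
  have h2 := hw z (e + 1) he
  have h3 : localDim K a b z (e + 1 + 1) + _ ≤ _ := localDim_concave (K := K) a b z e
  omega

include hσ hw in
lemma lt_card_layers_iff {m : ℕ} {z : Z} {e : ℕ} (he : e < q) :
    e < (Finset.univ.filter fun i => m < w i z).card ↔ m < w (σ e) z := by
  rw [card_layers hσ]
  exact lt_card_filter_iff (f := fun e => w (σ e) z) (layers_antitone hw z) he

include hσ in
omit [Fintype Z] [AddCommGroup Z] in
lemma card_layers_le (m : ℕ) (z : Z) : (Finset.univ.filter fun i => m < w i z).card ≤ q := by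
  rw [card_layers hσ]
  simpa using Finset.card_filter_le (Finset.range q) fun e => m < w (σ e) z

include hw in
omit [Fintype Q] in
lemma localDim_eq_sum (z : Z) {e : ℕ} (he : e ≤ q) :
    localDim K a b z e = ∑ i ∈ Finset.range e, w (σ i) z := by
  induction e with
  | zero => simp [localDim, triangleDim_zero]
  | succ e ih => rw [hw z e he, Finset.sum_range_succ, ih (by omega)]

include hψ hmul hinj hσ hw in
-- By concavity the layers at each `z` are listed by `σ` in decreasing size, so the exponent `#{i |
-- m < w i z}` collects exactly the layers of size greater than `m`.
theorem pairDim_layers [DecidableEq Z] (m : ℕ) :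
    pairDim (rootProd ψ a) (rootProd ψ b)
      (rootProd ψ fun z => (Finset.univ.filter fun i => m < w i z).card) =
        ∑ z, ∑ i, if m < w i z then w i z else 0 := by
  rw [pairDim_rootProd hψ hmul hinj]
  refine Finset.sum_congr rfl fun z _ => ?_
  have hle := card_layers_le (w := w) hσ m z
  rw [localDim_eq_sum hw z hle, sum_layers hσ, ← Finset.sum_filter]
  congr 1
  ext e
  simp only [Finset.mem_filter, Finset.mem_range]
  constructor
  · intro he
    exact ⟨by omega, (lt_card_layers_iff hσ hw (by omega)).1 he⟩
  · rintro ⟨he, h⟩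
    exact (lt_card_layers_iff hσ hw he).2 h

include hψ hmul hinj hσ hw in
-- Start from the product with all exponents `q`, which annihilates `t`, and remove one linear
-- factor at a time. As long as the exponents are at least `#{i | m < w i z}`, each removed factor
-- corresponds to a layer of size at most `m`.
theorem mulSpanned_layers [DecidableEq Z] {A : Type*} [CommRing A] [Algebra K A] [Module.Finite K A]
    {t y : A} (hty : Algebra.adjoin K {t, y} = ⊤)
    (hA : ∀ h : K[X], Module.finrank K (A ⧸ Ideal.span {aeval t h}) =
      pairDim (rootProd ψ a) (rootProd ψ b) h)
    (ht : aeval t (rootProd ψ fun _ => q) = 0) (m : ℕ) :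
    MulSpanned t y m (rootProd ψ fun z => (Finset.univ.filter fun i => m < w i z).card) := by
  -- `N` counts the linear factors removed from the full product.
  have key : ∀ (N : ℕ) (e : Z → ℕ), (∀ z, (Finset.univ.filter fun i => m < w i z).card ≤ e z) →
      (∀ z, e z ≤ q) → ∑ z, (q - e z) = N → MulSpanned t y m (rootProd ψ e) := by
    intro N
    induction N with
    | zero =>
      intro e h1 h2 h3 x
      have : e = fun _ => q := by
        funext z
        have h4 := Finset.sum_eq_zero_iff.1 h3 z (Finset.mem_univ z)
        have := h2 z
        omega
      rw [this, ht]
      exact ⟨0, by simp⟩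
    | succ N ih =>
      intro e h1 h2 h3
      obtain ⟨z, hz⟩ : ∃ z, e z < q := by
        by_contra! h
        have : ∑ z, (q - e z) = 0 := Finset.sum_eq_zero fun z _ => Nat.sub_eq_zero_of_le (h z)
        omega
      apply MulSpanned.of_mul_X_sub_C (ξ := ψ z) hty
      · rw [← rootProd_update, hA, hA, pairDim_rootProd hψ hmul hinj,
          pairDim_rootProd hψ hmul hinj, ← Finset.add_sum_erase _ _ (Finset.mem_univ z),
          ← Finset.add_sum_erase (f := fun z => localDim K a b z (e z)) _ (Finset.mem_univ z),
          Function.update_self, hw z _ hz]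
        have : ∑ x ∈ Finset.univ.erase z, localDim K a b x (Function.update e z (e z + 1) x) =
            ∑ x ∈ Finset.univ.erase z, localDim K a b x (e x) :=
          Finset.sum_congr rfl fun i hi => by
            rw [Function.update_of_ne (Finset.ne_of_mem_erase hi)]
        rw [this]
        have h4 : ¬ m < w (σ (e z)) z := fun h =>
          absurd ((lt_card_layers_iff hσ hw hz).2 h) (not_lt.2 (h1 z))
        omega
      · rw [← rootProd_update]
        refine ih _ (fun i => ?_) (fun i => ?_) ?_
        · rcases eq_or_ne i z with rfl | hi
          · rw [Function.update_self]; exact (h1 i).trans (Nat.le_succ _)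
          · rw [Function.update_of_ne hi]; exact h1 i
        · rcases eq_or_ne i z with rfl | hi
          · rw [Function.update_self]; exact hz
          · rw [Function.update_of_ne hi]; exact h2 i
        · rw [← Finset.add_sum_erase _ _ (Finset.mem_univ z)] at h3 ⊢
          rw [Function.update_self]
          have : ∑ x ∈ Finset.univ.erase z, (q - Function.update e z (e z + 1) x) =
              ∑ x ∈ Finset.univ.erase z, (q - e x) :=
            Finset.sum_congr rfl fun i hi => by
              rw [Function.update_of_ne (Finset.ne_of_mem_erase hi)]
          rw [this]
          omega
  exact key _ _ (fun _ => le_rfl) (card_layers_le hσ m) rfl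

end Layers

end RootProd


/-! ### Elements of prescribed order in products of groups -/

section OrderSet

variable {G : Type*} [AddCommGroup G] [Fintype G]

/-- The set of the elements of `G` whose order is in `D`. -/
noncomputable def orderSet (G : Type*) [AddCommGroup G] [Fintype G] (D : Finset ℕ) : Finset G :=
  Finset.univ.filter fun z => addOrderOf z ∈ D

lemma mem_orderSet {D : Finset ℕ} {z : G} : z ∈ orderSet G D ↔ addOrderOf z ∈ D := by
  simp [orderSet]

variable [DecidableEq G]

lemma sumCount_orderSet_equiv {G' : Type*} [AddCommGroup G'] [Fintype G'] [DecidableEq G']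
    (e : G ≃+ G') (D D' : Finset ℕ) (z : G) :
    sumCount (orderSet G' D) (orderSet G' D') (e z) = sumCount (orderSet G D) (orderSet G D') z := by
  symm
  refine Finset.card_bij (fun a _ => e a) ?_ (fun a _ b _ h => e.injective h) fun b hb => ?_
  · intro a ha
    simp only [Finset.mem_filter, mem_orderSet, ← map_sub, AddEquiv.addOrderOf_eq] at ha ⊢
    exact ha
  · refine ⟨e.symm b, ?_, e.apply_symm_apply b⟩
    rw [← e.apply_symm_apply b] at hb
    simp only [Finset.mem_filter, mem_orderSet, ← map_sub, AddEquiv.addOrderOf_eq] at hb ⊢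
    exact hb

/-- The slices of the set of the elements of `Q × Z` whose order is in `D`. -/
noncomputable def orderSlice (Q : Type*) {Z : Type*} [AddCommGroup Q] [Fintype Q] [AddCommGroup Z]
    (D : Finset ℕ) (z : Z) : Finset Q :=
  Finset.univ.filter fun i => addOrderOf (i, z) ∈ D

lemma mem_orderSlice {Q Z : Type*} [AddCommGroup Q] [Fintype Q] [AddCommGroup Z]
    {D : Finset ℕ} {z : Z} {i : Q} : i ∈ orderSlice Q D z ↔ addOrderOf (i, z) ∈ D := by
  simp [orderSlice]

lemma sumCount_prod {Q Z : Type*} [AddCommGroup Q] [Fintype Q] [DecidableEq Q] [AddCommGroup Z]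
    [Fintype Z] [DecidableEq Z] (D D' : Finset ℕ) (i : Q) (z : Z) :
    sumCount (orderSet (Q × Z) D) (orderSet (Q × Z) D') (i, z) =
      ∑ z₁, sumCount (orderSlice Q D z₁) (orderSlice Q D' (z - z₁)) i := by
  rw [sumCount, Finset.card_eq_sum_card_fiberwise (f := Prod.snd) (t := Finset.univ)
    fun _ _ => Finset.mem_coe.2 (Finset.mem_univ _)]
  refine Finset.sum_congr rfl fun z₁ _ => ?_
  refine Finset.card_bij (fun a _ => a.1) ?_ ?_ ?_
  · rintro ⟨a, a'⟩ h
    simp only [Finset.mem_filter, mem_orderSet, mem_orderSlice, Prod.mk_sub_mk] at h ⊢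
    obtain ⟨h, rfl⟩ := h
    exact h
  · rintro ⟨a, a'⟩ h ⟨b, b'⟩ h' (rfl : a = b)
    simp only [Finset.mem_filter] at h h'
    rw [h.2, h'.2]
  · intro a h
    refine ⟨(a, z₁), ?_, rfl⟩
    simpa [mem_orderSet, mem_orderSlice, sumCount] using h

end OrderSet

/-! ### Roots of cyclotomic polynomials in arbitrary characteristic -/

section Cyclotomic

variable {K : Type*} [Field K] {n : ℕ} [NeZero n] {ω : K}

/-- The character `z ↦ ω ^ z` of `ZMod n`. -/
noncomputable def powChar (ω : K) (z : ZMod n) : K := ω ^ z.val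

lemma powChar_ne_zero (hω : IsPrimitiveRoot ω n) (z : ZMod n) : powChar ω z ≠ 0 :=
  pow_ne_zero _ (hω.ne_zero (NeZero.ne n))

lemma powChar_add (hω : IsPrimitiveRoot ω n) (z z' : ZMod n) :
    powChar ω (z + z') = powChar ω z * powChar ω z' := by
  rw [powChar, powChar, powChar, ← pow_add, ZMod.val_add]
  conv_rhs => rw [← Nat.mod_add_div (z.val + z'.val) n]
  rw [pow_add, pow_mul, hω.pow_eq_one, one_pow, mul_one]

lemma powChar_injective (hω : IsPrimitiveRoot ω n) :
    Function.Injective (powChar ω : ZMod n → K) := fun z z' h =>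
  ZMod.val_injective n (hω.pow_inj z.val_lt z'.val_lt h)

lemma orderOf_powChar (hω : IsPrimitiveRoot ω n) (z : ZMod n) :
    orderOf (powChar ω z) = addOrderOf z := by
  let f : Multiplicative (ZMod n) →* K :=
    { toFun := fun z => powChar ω z.toAdd
      map_one' := by simp [powChar]
      map_mul' := fun a b => powChar_add hω _ _ }
  have := orderOf_injective f (fun a b h => powChar_injective hω h) (Multiplicative.ofAdd z)
  rw [orderOf_ofAdd_eq_addOrderOf] at this
  exact this

lemma cyclotomic_eq_rootProd (hω : IsPrimitiveRoot ω n) {d : ℕ} (hd : d ∣ n) :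
    cyclotomic d K = rootProd (powChar ω : ZMod n → K) fun z => if addOrderOf z = d then 1 else 0 := by
  have hd0 : 0 < d := Nat.pos_of_dvd_of_pos hd (NeZero.pos n)
  obtain ⟨c, hc⟩ := hd
  have hprim : IsPrimitiveRoot (ω ^ c) d := hω.pow (NeZero.pos n) (by rw [hc, mul_comm])
  rw [cyclotomic_eq_prod_X_sub_primitiveRoots hprim, rootProd]
  simp only [pow_ite, pow_one, pow_zero]
  rw [← Finset.prod_filter]
  symm
  refine Finset.prod_bij (fun z _ => powChar ω z) ?_ (fun _ _ _ _ h => powChar_injective hω h) ?_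
    fun _ _ => rfl
  · intro z hz
    rw [mem_primitiveRoots hd0, IsPrimitiveRoot.iff_orderOf, orderOf_powChar hω]
    exact (Finset.mem_filter.1 hz).2
  · intro μ hμ
    rw [mem_primitiveRoots hd0] at hμ
    obtain ⟨i, hi, rfl⟩ := hω.eq_pow_of_pow_eq_one (ξ := μ) (by
      rw [hc, pow_mul, hμ.pow_eq_one, one_pow])
    have : powChar ω (i : ZMod n) = ω ^ i := by rw [powChar, ZMod.val_natCast_of_lt hi]
    refine ⟨(i : ZMod n), ?_, this⟩
    rw [Finset.mem_filter, ← orderOf_powChar hω, this, hμ.eq_orderOf]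
    exact ⟨Finset.mem_univ _, rfl⟩

lemma rootProd_pow {Z : Type*} [Fintype Z] (ψ : Z → K) (a : Z → ℕ) (k : ℕ) :
    rootProd ψ a ^ k = rootProd ψ fun z => a z * k := by
  simp only [rootProd, ← Finset.prod_pow, pow_mul]

lemma rootProd_prod {Z ι : Type*} [Fintype Z] (ψ : Z → K) (a : ι → Z → ℕ) (s : Finset ι) :
    ∏ i ∈ s, rootProd ψ (a i) = rootProd ψ fun z => ∑ i ∈ s, a i z := by
  simp only [rootProd]
  rw [Finset.prod_comm]
  simp only [Finset.prod_pow_eq_pow_sum]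

/-- Over `K` the cyclotomic polynomials of the divisors of the order of `Q × ZMod n` have the
zeros which are expected from the elements of `Q × ZMod n`. -/
def CyclotomicSplit (ω : K) (n : ℕ) [NeZero n] (Q : Type*) [AddCommGroup Q] [Fintype Q] : Prop :=
  ∀ d, d ∣ Fintype.card Q * n →
    cyclotomic d K = rootProd (powChar ω : ZMod n → K) fun z => (orderSlice Q {d} z).card

lemma CyclotomicSplit.prod {Q : Type*} [AddCommGroup Q] [Fintype Q]
    (h : CyclotomicSplit ω n Q) {D : Finset ℕ} (hD : ∀ d ∈ D, d ∣ Fintype.card Q * n) :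
    ∏ d ∈ D, cyclotomic d K = rootProd (powChar ω : ZMod n → K) fun z => (orderSlice Q D z).card := by
  rw [Finset.prod_congr rfl fun d hd => h d (hD d hd), rootProd_prod]
  congr 1
  funext z
  symm
  rw [Finset.card_eq_sum_card_fiberwise (f := fun i => addOrderOf (i, z)) (t := D)
    fun i hi => mem_orderSlice.1 hi]
  refine Finset.sum_congr rfl fun d hd => ?_
  congr 1
  ext i
  simp only [Finset.mem_filter, mem_orderSlice, Finset.mem_singleton]
  constructor
  · exact fun h => h.2
  · exact fun h => ⟨h ▸ hd, h⟩

/-- This turns `t ^ N = 1` into the starting point of `mulSpanned_layers`, where all exponents equal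
the order of `Q`. -/
lemma CyclotomicSplit.X_pow_sub_one {Q : Type*} [AddCommGroup Q] [Fintype Q]
    (h : CyclotomicSplit ω n Q) :
    (X ^ (Fintype.card Q * n) - 1 : K[X]) =
      rootProd (powChar ω : ZMod n → K) fun _ => Fintype.card Q := by
  have h0 : 0 < Fintype.card Q * n := Nat.mul_pos Fintype.card_pos (NeZero.pos n)
  rw [← prod_cyclotomic_eq_X_pow_sub_one h0, h.prod fun d hd => Nat.dvd_of_mem_divisors hd]
  congr 1
  funext z
  rw [orderSlice, Finset.filter_true_of_mem, Finset.card_univ]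
  intro i _
  rw [Nat.mem_divisors]
  refine ⟨?_, h0.ne'⟩
  have := addOrderOf_dvd_natCard (i, z)
  rwa [Nat.card_prod, Nat.card_eq_fintype_card, Nat.card_zmod] at this

lemma cyclotomicSplit_of_unique {Q : Type*} [AddCommGroup Q] [Fintype Q] [Unique Q]
    (hω : IsPrimitiveRoot ω n) : CyclotomicSplit ω n Q := by
  intro d hd
  rw [Fintype.card_unique, one_mul] at hd
  rw [cyclotomic_eq_rootProd hω hd]
  congr 1
  funext z
  have : ∀ i : Q, addOrderOf (i, z) = addOrderOf z := fun i => by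
    rw [Prod.addOrderOf_mk, Subsingleton.elim i 0, addOrderOf_zero, Nat.lcm_one_left]
  rw [orderSlice]
  simp only [this, Finset.mem_singleton]
  split_ifs with h
  · simp [h]
  · simp [h]

variable {p s : ℕ} [hp : Fact p.Prime]

omit [NeZero n] in
lemma addOrderOf_mk_zmod (hpn : ¬ p ∣ n) (i : ZMod (p ^ s)) (z : ZMod n) :
    addOrderOf (i, z) = p ^ level p s i * addOrderOf z := by
  rw [Prod.addOrderOf_mk, addOrderOf_eq_pow_level]
  refine Nat.Coprime.lcm_eq_mul (Nat.Coprime.pow_left _ ?_)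
  rw [hp.out.coprime_iff_not_dvd]
  intro h
  have := addOrderOf_dvd_natCard z
  rw [Nat.card_zmod] at this
  exact hpn (h.trans this)

omit [NeZero n] in
lemma orderSlice_zmod (hpn : ¬ p ∣ n) (D : Finset ℕ) (z : ZMod n) :
    orderSlice (ZMod (p ^ s)) D z = levelSet p s {k | k ≤ s ∧ p ^ k * addOrderOf z ∈ D} := by
  ext i
  rw [mem_orderSlice, mem_levelSet, addOrderOf_mk_zmod hpn]
  exact ⟨fun h => ⟨level_le i, h⟩, fun h => h.2⟩

/-- In characteristic `p` and for `p ∤ d₂`, `Φ_{p ^ k d₂} = Φ_{d₂} ^ φ(p ^ k)`, and `φ(p ^ k)` is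
the number of elements of order `p ^ k` in the `p`-part `ZMod (p ^ s)`. -/
lemma cyclotomicSplit_zmod [CharP K p] (hpn : ¬ p ∣ n) (hω : IsPrimitiveRoot ω n) :
    CyclotomicSplit ω n (ZMod (p ^ s)) := by
  intro d hd
  rw [ZMod.card] at hd
  obtain ⟨d₁, d₂, h1, h2, rfl⟩ := (Nat.dvd_mul).1 hd
  obtain ⟨k, hk, rfl⟩ := (Nat.dvd_prime_pow hp.out).1 h1
  have hpd : ¬ p ∣ d₂ := fun h => hpn (h.trans h2)
  have hcyc : cyclotomic (p ^ k * d₂) K = cyclotomic d₂ K ^ Nat.totient (p ^ k) := by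
    rcases Nat.eq_zero_or_pos k with rfl | hk0
    · simp
    · rw [cyclotomic_mul_prime_pow_eq K hpd hk0, Nat.totient_prime_pow hp.out hk0,
        Nat.mul_sub, mul_one, ← pow_succ, Nat.sub_add_cancel hk0]
  rw [hcyc, cyclotomic_eq_rootProd hω h2, rootProd_pow]
  congr 1
  funext z
  have hset : orderSlice (ZMod (p ^ s)) {p ^ k * d₂} z =
      if addOrderOf z = d₂ then Finset.univ.filter fun i => addOrderOf i = p ^ k else ∅ := by
    ext i
    rw [mem_orderSlice, addOrderOf_mk_zmod hpn, Finset.mem_singleton]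
    have hz : ¬ p ∣ addOrderOf z := fun h => hpn (h.trans (by
      simpa using addOrderOf_dvd_natCard z))
    constructor
    · intro h
      have h3 : addOrderOf z = d₂ := by
        have e : ∀ (j c : ℕ), ¬ p ∣ c → ordCompl[p] (p ^ j * c) = c := fun j c hc => by
          rw [Nat.ordCompl_mul, Nat.ordCompl_self_pow hp.out, one_mul,
            Nat.factorization_eq_zero_of_not_dvd hc,
            pow_zero, Nat.div_one]
        rw [← e _ _ hz, h, e _ _ hpd]
      rw [if_pos h3, Finset.mem_filter, addOrderOf_eq_pow_level]
      rw [h3] at h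
      exact ⟨Finset.mem_univ _, Nat.eq_of_mul_eq_mul_right
        (Nat.pos_of_ne_zero (by rintro rfl; exact hpd (dvd_zero p))) h⟩
    · intro h
      split_ifs at h with h3
      · rw [h3, ← addOrderOf_eq_pow_level, (Finset.mem_filter.1 h).2]
      · simp at h
  rw [hset]
  split_ifs
  · rw [one_mul, IsAddCyclic.card_addOrderOf_eq_totient]
    rw [ZMod.card]
    exact pow_dvd_pow p hk
  · simp

end Cyclotomic

/-! ### Dimensions and spanning over algebraically closed fields -/

section FieldResult

/-- The numbers of representations of elements of `ZMod n` as sums of an element with order in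
`D` and an element with order in `D'`. -/
noncomputable def orderCount (n : ℕ) [NeZero n] (D D' : Finset ℕ) (z : ZMod n) : ℕ :=
  sumCount (orderSet (ZMod n) D) (orderSet (ZMod n) D') z

/-- The statement over a field which is needed for the statement over the integers. -/
structure FieldLayers (K : Type*) [Field K] (n : ℕ) [NeZero n] (D D' : Finset ℕ) : Prop where
  pairDim_eq : ∀ (m : ℕ) (L : Finset ℕ), (∀ d ∈ L, d ∣ n) →
    (∀ z : ZMod n, addOrderOf z ∈ L ↔ m < orderCount n D D' z) →
    pairDim (∏ d ∈ D, cyclotomic d K) (∏ d ∈ D', cyclotomic d K) (∏ d ∈ L, cyclotomic d K) =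
      ∑ z : ZMod n, if m < orderCount n D D' z then orderCount n D D' z else 0
  mulSpanned : ∀ (m : ℕ) (L : Finset ℕ), (∀ d ∈ L, d ∣ n) →
    (∀ z : ZMod n, addOrderOf z ∈ L ↔ m < orderCount n D D' z) →
    ∀ (A : Type) [CommRing A] [Algebra K A] [Module.Finite K A] (t y : A),
      Algebra.adjoin K {t, y} = ⊤ →
      (∀ h : K[X], Module.finrank K (A ⧸ Ideal.span {aeval t h}) =
        pairDim (∏ d ∈ D, cyclotomic d K) (∏ d ∈ D', cyclotomic d K) h) →
      t ^ n = 1 → MulSpanned t y m (∏ d ∈ L, cyclotomic d K)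

/-- The slice cardinalities are the multiplicities of the roots. As `σ` is the same for all pairs of
slices, summing `htri` over `z₁` gives layers of size `orderCount` at the element corresponding to
`(σ i, z)`. The resulting dimensions do not mention the field. -/
lemma fieldLayers_of_split {K : Type*} [Field K] {N n : ℕ} [NeZero N] [NeZero n] {ω : K}
    (hω : IsPrimitiveRoot ω n) {Q : Type*} [AddCommGroup Q] [Fintype Q] [DecidableEq Q]
    (hN : N = Fintype.card Q * n) (e : ZMod N ≃+ Q × ZMod n) (hsplit : CyclotomicSplit ω n Q)
    {D D' : Finset ℕ} (hD : ∀ d ∈ D, d ∣ N) (hD' : ∀ d ∈ D', d ∣ N) {σ : ℕ → Q}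
    (hσ : Set.BijOn σ (Set.Iio (Fintype.card Q)) Set.univ)
    (htri : ∀ z z' : ZMod n, ∀ i < Fintype.card Q,
      triangleDim K (orderSlice Q D z).card (orderSlice Q D' z').card (i + 1) =
        triangleDim K (orderSlice Q D z).card (orderSlice Q D' z').card i +
          sumCount (orderSlice Q D z) (orderSlice Q D' z') (σ i)) :
    FieldLayers K N D D' := by
  have hw : ∀ z : ZMod n, ∀ i < Fintype.card Q,
      localDim K (fun z => (orderSlice Q D z).card) (fun z => (orderSlice Q D' z).card) z (i + 1) =
        localDim K (fun z => (orderSlice Q D z).card) (fun z => (orderSlice Q D' z).card) z i +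
          orderCount N D D' (e.symm (σ i, z)) := by
    intro z i hi
    rw [orderCount, ← sumCount_orderSet_equiv e, e.apply_symm_apply, sumCount_prod]
    simp only [localDim]
    rw [← Finset.sum_add_distrib]
    exact Finset.sum_congr rfl fun z₁ _ => htri _ _ i hi
  have hf := hsplit.prod (D := D) fun d hd => hN ▸ hD d hd
  have hg := hsplit.prod (D := D') fun d hd => hN ▸ hD' d hd
  have hL : ∀ (m : ℕ) (L : Finset ℕ), (∀ d ∈ L, d ∣ N) →
      (∀ z : ZMod N, addOrderOf z ∈ L ↔ m < orderCount N D D' z) →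
      ∏ d ∈ L, cyclotomic d K = rootProd (powChar ω : ZMod n → K) fun z =>
        (Finset.univ.filter fun i => m < orderCount N D D' (e.symm (i, z))).card := by
    intro m L hdvd hL
    rw [hsplit.prod fun d hd => hN ▸ hdvd d hd]
    congr 1
    funext z
    congr 1
    ext i
    rw [mem_orderSlice, Finset.mem_filter, ← hL, AddEquiv.addOrderOf_eq]
    simp
  constructor
  · intro m L hdvd hmem
    rw [hL m L hdvd hmem, hf, hg, pairDim_layers (powChar_ne_zero hω) (powChar_add hω)
      (powChar_injective hω) hσ hw, Finset.sum_comm, ← Fintype.sum_prod_type',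
      Fintype.sum_equiv e.symm.toEquiv]
    exact fun _ => rfl
  · intro m L hdvd hmem A _ _ _ t y hty hA ht
    rw [hL m L hdvd hmem]
    refine mulSpanned_layers (powChar_ne_zero hω) (powChar_add hω)
      (powChar_injective hω) hσ hw hty (fun h => by rw [hA, hf, hg]) ?_ m
    rw [← hsplit.X_pow_sub_one, ← hN]
    simp [ht]

/-- `D` consists of divisors of `N`, and along the multiples by powers of `p` it is an upper set
for the relation on the exponents which is given by a set `S`. -/
def IsUpperAlong (p s : ℕ) (S : Set ℕ) (D : Finset ℕ) : Prop :=
  ∀ c, ¬ p ∣ c → IsLevelUpper S s {k | k ≤ s ∧ p ^ k * c ∈ D}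

lemma fieldLayers_charP (K : Type*) [Field K] [IsAlgClosed K] {p s n : ℕ} [hp : Fact p.Prime]
    [CharP K p] [NeZero (p ^ s * n)] (hpn : ¬ p ∣ n) {D D' : Finset ℕ}
    (hD : ∀ d ∈ D, d ∣ p ^ s * n) (hD' : ∀ d ∈ D', d ∣ p ^ s * n) {S S' : Set ℕ}
    (hS : IsUpperAlong p s S D) (hS' : IsUpperAlong p s S' D') :
    FieldLayers K (p ^ s * n) D D' := by
  have : NeZero n := ⟨fun h => hpn (h ▸ dvd_zero p)⟩
  have : NeZero (n : K) := ⟨fun h => hpn ((CharP.cast_eq_zero_iff K p n).1 h)⟩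
  have hexp : ExpChar K p := ExpChar.prime hp.out
  obtain ⟨ω, hω⟩ := HasEnoughRootsOfUnity.exists_primitiveRoot K n
  obtain ⟨σ, hσ, h⟩ := layersMatch (p := p) (s := s) K S S' s le_rfl
  have hcop : (p ^ s).Coprime n := Nat.Coprime.pow_left _ ((hp.out.coprime_iff_not_dvd).2 hpn)
  have hz : ∀ z : ZMod n, ¬ p ∣ addOrderOf z := fun z h => hpn (h.trans (by
    simpa using addOrderOf_dvd_natCard z))
  refine fieldLayers_of_split (Q := ZMod (p ^ s)) (σ := σ) hω (by rw [ZMod.card])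
    (ZMod.chineseRemainder hcop).toAddEquiv (cyclotomicSplit_zmod hpn hω) hD hD' ?_ ?_
  · rw [ZMod.card]
    convert hσ using 1
    ext z
    simp [level_le]
  · intro z z' i hi
    rw [ZMod.card] at hi
    rw [orderSlice_zmod hpn, orderSlice_zmod hpn]
    exact h _ _ (hS _ (hz z)) (hS' _ (hz z')) i hi

lemma fieldLayers_charZero (K : Type*) [Field K] [IsAlgClosed K] [CharZero K] {n : ℕ} [NeZero n]
    {D D' : Finset ℕ} (hD : ∀ d ∈ D, d ∣ n) (hD' : ∀ d ∈ D', d ∣ n) : FieldLayers K n D D' := by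
  obtain ⟨ω, hω⟩ := HasEnoughRootsOfUnity.exists_primitiveRoot K n
  -- In characteristic zero there is no `p`-part: all roots are simple, and each local algebra is
  -- `K` or zero.
  refine fieldLayers_of_split (Q := ZMod 1) (σ := fun _ => 0) hω (by simp)
    (AddEquiv.uniqueProd (M := ZMod n) (N := ZMod 1)).symm
    (cyclotomicSplit_of_unique hω) hD hD' ?_ ?_
  · refine ⟨fun _ _ => trivial, fun a ha b hb _ => ?_, fun z _ => ⟨0, ?_, Subsingleton.elim _ _⟩⟩
    · simp at ha hb; omega
    · simp
  · intro z z' i hi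
    have hi0 : i = 0 := by simpa using hi
    subst hi0
    have hle : ∀ A : Finset (ZMod 1), A = ∅ ∨ A = {0} := fun A => by
      rcases A.eq_empty_or_nonempty with h | ⟨x, hx⟩
      · exact Or.inl h
      · refine Or.inr (Finset.eq_singleton_iff_unique_mem.2
          ⟨Subsingleton.elim x 0 ▸ hx, fun _ _ => Subsingleton.elim _ _⟩)
    rw [zero_add, triangleDim_zero]
    rcases hle (orderSlice (ZMod 1) D z) with h | h <;>
      rcases hle (orderSlice (ZMod 1) D' z') with h' | h' <;> rw [h, h'] <;>
      simp [sumCount, triangleDim_zero_left, triangleDim_zero_mid, triangleDim_one,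
        Finset.filter_singleton]

end FieldResult


/-! ### From fields of all characteristics to the integers -/

section Saturation

lemma finrank_quotient_add_range {K A : Type*} [Field K] [CommRing A] [Algebra K A]
    [Module.Finite K A] (c : A) :
    Module.finrank K (A ⧸ Ideal.span {c}) + Module.finrank K (LinearMap.range (LinearMap.mulLeft K c)) =
      Module.finrank K A := by
  have h : (Ideal.span {c}).restrictScalars K = LinearMap.range (LinearMap.mulLeft K c) := by
    ext x
    rw [Submodule.restrictScalars_mem, Ideal.mem_span_singleton, LinearMap.mem_range]
    constructor
    · rintro ⟨d, rfl⟩; exact ⟨d, rfl⟩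
    · rintro ⟨d, rfl⟩; exact ⟨d, rfl⟩
  rw [← h, ← (Submodule.Quotient.restrictScalarsEquiv K (Ideal.span {c})).finrank_eq]
  exact Submodule.finrank_quotient_add_finrank _

variable {X : Type*} [CommRing X]

lemma finrank_range_baseChange (K : Type*) [Field K] [CharZero K] [Module.Free ℤ X]
    [Module.Finite ℤ X] (f : X →ₗ[ℤ] X) :
    Module.finrank K (LinearMap.range (f.baseChange K)) = Module.finrank ℤ (LinearMap.range f) := by
  have h1 : f.baseChange K = (LinearMap.range f).subtype.baseChange K ∘ₗ
      f.rangeRestrict.baseChange K := by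
    rw [← LinearMap.baseChange_comp, LinearMap.subtype_comp_codRestrict]
  have h2 : Function.Surjective (f.rangeRestrict.baseChange K) :=
    LinearMap.lTensor_surjective K f.surjective_rangeRestrict
  have h3 : Function.Injective ((LinearMap.range f).subtype.baseChange K) :=
    Module.Flat.lTensor_preserves_injective_linearMap (M := K) _ Subtype.val_injective
  rw [h1, LinearMap.range_comp, LinearMap.range_eq_top.2 h2, Submodule.map_top,
    LinearMap.finrank_range_of_inj h3, Module.finrank_baseChange]

lemma coe_sum_repr {N : Submodule ℤ X} {ι : Type*} [Fintype ι] (b : Module.Basis ι ℤ N) (v : N) :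
    (v : X) = ∑ i, b.repr v i • (b i : X) := by
  conv_lhs => rw [← b.sum_repr v]
  simp only [Submodule.coe_sum, Submodule.coe_smul]

lemma span_one_tmul_le {N : Submodule ℤ X} {ι : Type*} [Fintype ι] (b : Module.Basis ι ℤ N)
    (K : Type*) [Field K] : Submodule.span K ((fun v : X => (1 : K) ⊗ₜ[ℤ] v) '' N) ≤
      Submodule.span K (Set.range fun i => (1 : K) ⊗ₜ[ℤ] (b i : X)) := by
  rw [Submodule.span_le]
  rintro _ ⟨v, hv, rfl⟩
  change (1 : K) ⊗ₜ[ℤ] ((⟨v, hv⟩ : N) : X) ∈ _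
  rw [coe_sum_repr b, TensorProduct.tmul_sum]
  refine Submodule.sum_mem _ fun i _ => ?_
  rw [TensorProduct.tmul_smul]
  exact (Submodule.span _ _).toAddSubgroup.zsmul_mem
    (Submodule.subset_span (Set.mem_range_self i)) _

/-- A submodule of a lattice which remains of the same rank modulo all primes is saturated. -/
lemma saturated_of_finrank_span [Module.Free ℤ X] [Module.Finite ℤ X] (N : Submodule ℤ X)
    (K : ∀ p : ℕ, p.Prime → Type) [∀ p hp, Field (K p hp)] [∀ p hp, CharP (K p hp) p]
    (hspan : ∀ p hp, Module.finrank ℤ N ≤ Module.finrank (K p hp)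
      (Submodule.span (K p hp) ((fun v : X => (1 : K p hp) ⊗ₜ[ℤ] v) '' N)))
    (k : ℕ) (hk : k ≠ 0) (x : X) (hx : k • x ∈ N) : x ∈ N := by
  induction k using Nat.recOnMul generalizing x with
  | zero => exact absurd rfl hk
  | one => simpa using hx
  | mul a b iha ihb =>
    rw [mul_smul] at hx
    exact ihb (right_ne_zero_of_mul hk) x (iha (left_ne_zero_of_mul hk) _ hx)
  | prime p hp =>
    let b := Module.finBasis ℤ N
    -- The dimension hypothesis forces a basis of `N` to stay independent over `K p hp`; hence `p •
    -- x ∈ N` has all its coordinates divisible by `p`.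
    have hli : LinearIndependent (K p hp) fun i => (1 : K p hp) ⊗ₜ[ℤ] (b i : X) := by
      rw [linearIndependent_iff_card_le_finrank_span, Fintype.card_fin]
      exact (hspan p hp).trans (Submodule.finrank_mono (span_one_tmul_le b _))
    have hrepr : p • x = ∑ i, b.repr ⟨p • x, hx⟩ i • (b i : X) :=
      coe_sum_repr b ⟨p • x, hx⟩
    have hzero : ∑ i, ((b.repr ⟨p • x, hx⟩ i : ℤ) : K p hp) • ((1 : K p hp) ⊗ₜ[ℤ] (b i : X)) = 0 := by
      have h1 : (1 : K p hp) ⊗ₜ[ℤ] (p • x) = 0 := by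
        rw [TensorProduct.tmul_smul, ← Nat.cast_smul_eq_nsmul (K p hp), CharP.cast_eq_zero, zero_smul]
      rw [← h1]
      conv_rhs => rw [hrepr]
      rw [TensorProduct.tmul_sum]
      refine Finset.sum_congr rfl fun i _ => ?_
      rw [TensorProduct.tmul_smul, Int.cast_smul_eq_zsmul]
    have hdvd : ∀ i, (p : ℤ) ∣ b.repr ⟨p • x, hx⟩ i := fun i =>
      (CharP.intCast_eq_zero_iff (K p hp) p _).1 (Fintype.linearIndependent_iff.1 hli _ hzero i)
    choose a ha using hdvd
    have hxa : x = ∑ i, a i • (b i : X) := by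
      have : p • x = p • ∑ i, a i • (b i : X) := by
        conv_lhs => rw [hrepr]
        rw [Finset.smul_sum]
        refine Finset.sum_congr rfl fun i _ => ?_
        rw [ha, mul_smul, Nat.cast_smul_eq_nsmul]
      rw [← Nat.cast_smul_eq_nsmul ℤ p, ← Nat.cast_smul_eq_nsmul ℤ p] at this
      exact smul_right_injective X (Nat.cast_ne_zero.2 hp.ne_zero) this
    rw [hxa]
    exact Submodule.sum_mem _ fun i _ => N.smul_mem _ (b i).2

/-- The combinations of `1, y, …, y ^ (m - 1)` with coefficients polynomials in `t`. -/
noncomputable def polyCombo {R A : Type*} [CommRing R] [CommRing A] [Algebra R A] (t y : A) (m : ℕ) :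
    (ℕ → R[X]) →ₗ[R] A :=
  ∑ k ∈ Finset.range m, LinearMap.mulRight R (y ^ k) ∘ₗ (aeval t).toLinearMap ∘ₗ LinearMap.proj k

lemma polyCombo_apply {R A : Type*} [CommRing R] [CommRing A] [Algebra R A] (t y : A) (m : ℕ)
    (c : ℕ → R[X]) : polyCombo t y m c = ∑ k ∈ Finset.range m, aeval t (c k) * y ^ k := by
  simp [polyCombo, LinearMap.sum_apply]

lemma aeval_one_tmul (K : Type*) [Field K] (t : X) (F : ℤ[X]) :
    aeval ((1 : K) ⊗ₜ[ℤ] t) (F.map (Int.castRingHom K)) = (1 : K) ⊗ₜ[ℤ] aeval t F := by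
  have h : (Algebra.TensorProduct.includeRight : X →ₐ[ℤ] K ⊗[ℤ] X) t = 1 ⊗ₜ t := rfl
  rw [← h, ← algebraMap_int_eq, aeval_map_algebraMap, aeval_algHom_apply]
  rfl

/-- The integral version of `MulSpanned` follows from the versions over fields of all
characteristics. -/
theorem mulSpanned_int [Module.Free ℤ X] [Module.Finite ℤ X] (t y : X) (F : ℤ[X]) (m r : ℕ)
    (K₀ : Type*) [Field K₀] [CharZero K₀]
    (K : ∀ p : ℕ, p.Prime → Type) [∀ p hp, Field (K p hp)] [∀ p hp, CharP (K p hp) p]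
    (h₀ : Module.finrank K₀ (K₀ ⊗[ℤ] X ⧸ Ideal.span {aeval ((1 : K₀) ⊗ₜ[ℤ] t)
      (F.map (Int.castRingHom K₀))}) = r)
    (hK : ∀ p hp, Module.finrank (K p hp) (K p hp ⊗[ℤ] X ⧸ Ideal.span {aeval ((1 : K p hp) ⊗ₜ[ℤ] t)
      (F.map (Int.castRingHom (K p hp)))}) = r)
    (hP : ∀ p hp, MulSpanned ((1 : K p hp) ⊗ₜ[ℤ] t) ((1 : K p hp) ⊗ₜ[ℤ] y) m
      (F.map (Int.castRingHom (K p hp)))) : MulSpanned t y m F := by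
  set c := aeval t F with hc
  -- `N` consists of the multiples of `c` by the allowed combinations, `N'` of all multiples of `c`;
  -- the goal is `N' ≤ N`.
  let N := LinearMap.range (LinearMap.mulLeft ℤ c ∘ₗ polyCombo t y m)
  let N' := LinearMap.range (LinearMap.mulLeft ℤ c)
  have hNN' : N ≤ N' := LinearMap.range_comp_le_range _ _
  have hr' : r + Module.finrank ℤ N' = Module.finrank ℤ X := by
    have h1 := finrank_quotient_add_range (K := K₀) (aeval ((1 : K₀) ⊗ₜ[ℤ] t)
      (F.map (Int.castRingHom K₀)))
    have h2 : LinearMap.mulLeft K₀ (aeval ((1 : K₀) ⊗ₜ[ℤ] t) (F.map (Int.castRingHom K₀))) =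
        (LinearMap.mulLeft ℤ c).baseChange K₀ := by
      rw [aeval_one_tmul]
      ext x
      simp [hc]
    rw [h₀, h2, finrank_range_baseChange, Module.finrank_baseChange] at h1
    exact h1
  -- By `hP` the image of `N` over `K p hp` spans all multiples of the reduced `c`; their dimension
  -- is `finrank X - r`, which is the rank of `N'` computed over `K₀`.
  have hspan : ∀ p hp, Module.finrank ℤ N' ≤ Module.finrank (K p hp)
      (Submodule.span (K p hp) ((fun v : X => (1 : K p hp) ⊗ₜ[ℤ] v) '' N)) := by
    intro p hp
    have h1 := finrank_quotient_add_range (K := K p hp) (aeval ((1 : K p hp) ⊗ₜ[ℤ] t)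
      (F.map (Int.castRingHom (K p hp))))
    rw [hK, Module.finrank_baseChange, ← hr'] at h1
    rw [← Nat.add_left_cancel h1]
    refine Submodule.finrank_mono ?_
    rintro _ ⟨x, rfl⟩
    obtain ⟨d, hd⟩ := hP p hp x
    rw [LinearMap.mulLeft_apply, hd, Finset.mul_sum]
    refine Submodule.sum_mem _ fun k hk => ?_
    rw [aeval_eq_sum_range (p := d k), Finset.sum_mul, Finset.mul_sum]
    refine Submodule.sum_mem _ fun i _ => ?_
    rw [smul_mul_assoc, mul_smul_comm, aeval_one_tmul]
    refine Submodule.smul_mem _ _ (Submodule.subset_span ⟨c * (t ^ i * y ^ k), ?_, ?_⟩)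
    · refine ⟨Pi.single k (Polynomial.X ^ i), ?_⟩
      rw [LinearMap.comp_apply, LinearMap.mulLeft_apply, polyCombo_apply,
        Finset.sum_eq_single_of_mem k hk]
      · simp
      · intro j _ hj
        simp [Pi.single_eq_of_ne hj]
    · simp [hc]
  have hsat := saturated_of_finrank_span N K fun p hp =>
    (Submodule.finrank_mono hNN').trans (hspan p hp)
  have hrank : Module.finrank ℤ N = Module.finrank ℤ N' := by
    -- Any prime would do here: a spanning set over the field coming from a basis of `N` bounds the
    -- dimension by the rank of `N`.
    refine le_antisymm (Submodule.finrank_mono hNN') ((hspan 2 Nat.prime_two).trans ?_)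
    let b := Module.finBasis ℤ N
    refine (Submodule.finrank_mono (span_one_tmul_le b _)).trans ((finrank_range_le_card _).trans ?_)
    rw [Fintype.card_fin]
  -- Equal ranks make `N' / N` a torsion group, and saturation of `N` then removes the torsion.
  have htors : ∀ x ∈ N', ∃ k : ℕ, k ≠ 0 ∧ k • x ∈ N := by
    intro x hx
    have h1 := Submodule.finrank_quotient_add_finrank (N.submoduleOf N')
    have h2 : Module.finrank ℤ (N.submoduleOf N') = Module.finrank ℤ N :=
      (Submodule.submoduleOfEquivOfLe hNN').finrank_eq
    have h3 : Module.finrank ℤ (N' ⧸ N.submoduleOf N') = 0 := by omega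
    obtain ⟨a, ha, hax⟩ := Module.finrank_eq_zero_iff.1 h3 (Submodule.Quotient.mk ⟨x, hx⟩)
    rw [← Submodule.Quotient.mk_smul, Submodule.Quotient.mk_eq_zero] at hax
    have hax' : a • x ∈ N := hax
    refine ⟨a.natAbs, Int.natAbs_ne_zero.2 ha, ?_⟩
    rcases Int.natAbs_eq a with h | h
    · rw [h] at hax'
      simpa using hax'
    · rw [h, neg_smul] at hax'
      simpa using N.neg_mem hax'
  intro x
  obtain ⟨k, hk, hkx⟩ := htors (c * x) ⟨x, rfl⟩
  obtain ⟨d, hd⟩ := hsat k hk _ hkx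
  refine ⟨d, ?_⟩
  rw [← hd, LinearMap.comp_apply, LinearMap.mulLeft_apply, polyCombo_apply]

end Saturation

/-! ### Cyclic decomposition from spanning -/

section Decomposition

variable {R X : Type*} [CommRing R] [CommRing X] [Algebra R X]

/-- The map `P ↦ P(t) w` on `R[t] / (F)` for a monic polynomial `F` with `F(t) w = 0`. -/
noncomputable def cyclicMap {F : R[X]} (hF : F.Monic) (t w : X) : AdjoinRoot F →ₗ[R] X :=
  LinearMap.mulRight R w ∘ₗ (aeval t).toLinearMap ∘ₗ AdjoinRoot.modByMonicHom hF

lemma cyclicMap_mk {F : R[X]} (hF : F.Monic) {t w : X} (hw : aeval t F * w = 0) (Q : R[X]) :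
    cyclicMap hF t w (AdjoinRoot.mk F Q) = aeval t Q * w := by
  have : aeval t (Q %ₘ F) * w = aeval t Q * w := by
    conv_rhs => rw [← modByMonic_add_div Q F]
    rw [map_add, map_mul, add_mul, mul_right_comm, hw, zero_mul, add_zero]
  simpa [cyclicMap, AdjoinRoot.modByMonicHom_mk] using this

lemma cyclicMap_root_mul {F : R[X]} (hF : F.Monic) {t w : X} (hw : aeval t F * w = 0)
    (z : AdjoinRoot F) : cyclicMap hF t w (AdjoinRoot.root F * z) = t * cyclicMap hF t w z := by
  obtain ⟨Q, rfl⟩ := AdjoinRoot.mk_surjective z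
  rw [← AdjoinRoot.mk_X, ← map_mul, cyclicMap_mk hF hw, cyclicMap_mk hF hw, map_mul, aeval_X, mul_assoc]

instance free_adjoinRoot_of_fact {F : R[X]} [hF : Fact F.Monic] : Module.Free R (AdjoinRoot F) :=
  Module.Free.of_basis (AdjoinRoot.powerBasis' hF.out).basis

instance finite_adjoinRoot_of_fact {F : R[X]} [hF : Fact F.Monic] : Module.Finite R (AdjoinRoot F) :=
  Module.Finite.of_basis (AdjoinRoot.powerBasis' hF.out).basis

lemma finrank_adjoinRoot [Nontrivial R] {F : R[X]} (hF : F.Monic) :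
    Module.finrank R (AdjoinRoot F) = F.natDegree := by
  rw [(AdjoinRoot.powerBasis' hF).finrank, AdjoinRoot.powerBasis'_dim]

/-- A decomposition into cyclic summands of an algebra. -/
theorem exists_equiv_of_mulSpanned [Nontrivial R] [Module.Free R X] [Module.Finite R X] (t y : X)
    (l : ℕ) (F : ℕ → R[X]) (hF : ∀ j, (F j).Monic) (hl : F l = 1)
    (hP : ∀ j ≤ l, MulSpanned t y j (F j))
    (hdeg : ∑ j : Fin l, (F j).natDegree = Module.finrank R X) :
    PairIso (LinearMap.mulLeft R t)
      (DirectSum.lmap fun j : Fin l => LinearMap.mulLeft R (AdjoinRoot.root (F j))) := by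
  -- Spanning for `F j`, applied to `y ^ j`, corrects `y ^ j` by lower powers to an element `w j`
  -- killed by `F j (t)`.
  have hw : ∀ j ≤ l, ∃ c : ℕ → R[X],
      aeval t (F j) * (y ^ j - ∑ k ∈ Finset.range j, aeval t (c k) * y ^ k) = 0 := fun j hj => by
    obtain ⟨c, hc⟩ := hP j hj (y ^ j)
    exact ⟨c, by rw [mul_sub, hc, sub_self]⟩
  choose! c hc using hw
  let w : ℕ → X := fun j => y ^ j - ∑ k ∈ Finset.range j, aeval t (c j k) * y ^ k
  have hw : ∀ j : Fin l, aeval t (F j) * w j = 0 := fun j => hc j j.2.le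
  let Φ : (⨁ j : Fin l, AdjoinRoot (F j)) →ₗ[R] X :=
    DirectSum.toModule R (Fin l) X fun j => cyclicMap (hF j) t (w j)
  have hΦ : ∀ (j : Fin l) (z : AdjoinRoot (F j)),
      Φ (DirectSum.lof R (Fin l) (fun j : Fin l => AdjoinRoot (F j)) j z) =
        cyclicMap (hF j) t (w j) z := fun j z => by simp only [Φ, DirectSum.toModule_lof]
  have hmem : ∀ j < l, ∀ Q : R[X], aeval t Q * y ^ j ∈ LinearMap.range Φ := by
    intro j
    induction j using Nat.strong_induction_on with
    | _ j ih =>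
      intro hj Q
      -- The `w j` are unitriangular in the powers of `y`, so strong induction recovers all `y ^ j`
      -- with `j < l`.
      have h1 : aeval t Q * y ^ j = aeval t Q * w j +
          ∑ k ∈ Finset.range j, aeval t (Q * c j k) * y ^ k := by
        simp only [w, mul_sub, Finset.mul_sum, map_mul, mul_assoc, sub_add_cancel]
      rw [h1]
      refine Submodule.add_mem _ ⟨_, (hΦ ⟨j, hj⟩ (AdjoinRoot.mk _ Q)).trans
        (cyclicMap_mk _ (hw ⟨j, hj⟩) _)⟩ (Submodule.sum_mem _ fun k hk => ?_)
      exact ih k (Finset.mem_range.1 hk) ((Finset.mem_range.1 hk).trans hj) _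
  have hsurj : Function.Surjective Φ := by
    intro x
    -- Because `F l = 1`, spanning at `l` says that the powers `y ^ k`, `k < l`, generate all of `X`
    -- over polynomials in `t`.
    obtain ⟨d, hd⟩ := hP l le_rfl x
    rw [hl, map_one, one_mul, one_mul] at hd
    rw [hd]
    exact Submodule.sum_mem (LinearMap.range Φ) fun k hk => hmem k (Finset.mem_range.1 hk) _
  have : ∀ j : Fin l, Fact (F j).Monic := fun j => ⟨hF j⟩
  have hrank : Module.finrank R (⨁ j : Fin l, AdjoinRoot (F j)) = Module.finrank R X := by
    rw [Module.finrank_directSum, ← hdeg]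
    exact Finset.sum_congr rfl fun j _ => finrank_adjoinRoot (hF j)
  -- A surjection between finite free modules of equal rank is bijective, so no relations need to be
  -- checked.
  have hbij : Function.Bijective Φ :=
    OrzechProperty.bijective_of_surjective_of_finrank_le Φ hsurj hrank.le
  have hcomm : LinearMap.mulLeft R t ∘ₗ Φ = Φ ∘ₗ DirectSum.lmap fun j : Fin l =>
      LinearMap.mulLeft R (AdjoinRoot.root (F j)) := by
    refine DirectSum.linearMap_ext R fun j => LinearMap.ext fun z => ?_
    simp only [LinearMap.comp_apply, DirectSum.lmap_lof, hΦ, LinearMap.mulLeft_apply]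
    exact (cyclicMap_root_mul (hF j) (hw j) z).symm
  refine ⟨(LinearEquiv.ofBijective Φ hbij).symm, fun x => ?_⟩
  obtain ⟨z, rfl⟩ := (LinearEquiv.ofBijective Φ hbij).surjective x
  rw [LinearEquiv.symm_apply_eq, LinearEquiv.symm_apply_apply]
  exact LinearMap.congr_fun hcomm z

end Decomposition


/-- A finite set of positive numbers as a finite set of natural numbers. -/
def natSet (M : Finset ℕ+) : Finset ℕ := M.map ⟨PNat.val, PNat.coe_injective⟩

lemma mem_natSet {M : Finset ℕ+} {m : ℕ+} : (m : ℕ) ∈ natSet M ↔ m ∈ M :=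
  Finset.mem_map' _

lemma orPoly_eq_prod (M : Finset ℕ+) : orPoly M = ∏ d ∈ natSet M, cyclotomic d ℤ := by
  rw [orPoly, natSet, Finset.prod_map]
  rfl

lemma orPoly_map (M : Finset ℕ+) (K : Type*) [CommRing K] :
    (orPoly M).map (Int.castRingHom K) = ∏ d ∈ natSet M, cyclotomic d K := by
  rw [orPoly_eq_prod, Polynomial.map_prod]
  simp only [map_cyclotomic_int]

/-! ### Degrees and total counts -/

section Count

variable {n : ℕ} [NeZero n]

lemma card_orderSet {D : Finset ℕ} (hD : ∀ d ∈ D, d ∣ n) :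
    (orderSet (ZMod n) D).card = ∑ d ∈ D, d.totient := by
  rw [Finset.card_eq_sum_card_fiberwise (f := addOrderOf) (t := D)
    fun z hz => mem_orderSet.1 hz]
  refine Finset.sum_congr rfl fun d hd => ?_
  rw [← IsAddCyclic.card_addOrderOf_eq_totient (α := ZMod n) (by rw [ZMod.card]; exact hD d hd)]
  congr 1
  ext z
  simp only [Finset.mem_filter, mem_orderSet, Finset.mem_univ, true_and, and_iff_right_iff_imp]
  rintro rfl
  exact hd

lemma natDegree_orPoly {M : Finset ℕ+} (hM : ∀ d ∈ natSet M, d ∣ n) :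
    (orPoly M).natDegree = (orderSet (ZMod n) (natSet M)).card := by
  rw [card_orderSet hM, orPoly_eq_prod, natDegree_prod_of_monic _ _ fun d _ => cyclotomic.monic d ℤ]
  simp only [natDegree_cyclotomic]

lemma exists_addOrderOf_eq {d : ℕ} (hd : d ∣ n) : ∃ z : ZMod n, addOrderOf z = d := by
  have h := IsAddCyclic.card_addOrderOf_eq_totient (α := ZMod n) (d := d)
    (by rw [ZMod.card]; exact hd)
  have hpos : 0 < d.totient := Nat.totient_pos.2 (Nat.pos_of_dvd_of_pos hd (NeZero.pos n))
  rw [← h, Finset.card_pos] at hpos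
  obtain ⟨z, hz⟩ := hpos
  exact ⟨z, (Finset.mem_filter.1 hz).2⟩

lemma sum_sumCount {G : Type*} [AddCommGroup G] [Fintype G] [DecidableEq G] (A B : Finset G) :
    ∑ z, sumCount A B z = A.card * B.card := by
  simp only [sumCount, Finset.card_filter]
  rw [Finset.sum_comm]
  have : ∀ a ∈ A, (∑ z, if z - a ∈ B then 1 else 0) = B.card := fun a _ => by
    rw [← Finset.card_filter]
    refine Finset.card_bij' (fun z _ => z - a) (fun b _ => b + a) ?_ ?_ ?_ ?_ <;> simp
  rw [Finset.sum_congr rfl this, Finset.sum_const, smul_eq_mul]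

lemma sum_card_lt {G : Type*} [Fintype G] (w : G → ℕ) {l : ℕ} (hl : ∀ z, w z ≤ l) :
    ∑ j : Fin l, (Finset.univ.filter fun z => (j : ℕ) < w z).card = ∑ z, w z := by
  simp only [Finset.card_filter]
  rw [Finset.sum_comm]
  refine Finset.sum_congr rfl fun z _ => ?_
  rw [Fin.sum_univ_eq_sum_range (fun j => if j < w z then 1 else 0) l, ← Finset.card_filter]
  have : (Finset.range l).filter (fun j => j < w z) = Finset.range (w z) := by
    ext j
    simp only [Finset.mem_filter, Finset.mem_range]
    have := hl z
    omega
  rw [this, Finset.card_range]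

lemma orPoly_dvd_X_pow_sub_one {M : Finset ℕ+} (hM : ∀ d ∈ natSet M, d ∣ n) :
    orPoly M ∣ X ^ n - 1 := by
  rw [orPoly_eq_prod, ← prod_cyclotomic_eq_X_pow_sub_one (NeZero.pos n) ℤ]
  exact Finset.prod_dvd_prod_of_subset _ _ _ fun d hd =>
    Nat.mem_divisors.2 ⟨hM d hd, NeZero.ne n⟩

lemma root_pow_eq_one {M : Finset ℕ+} (hM : ∀ d ∈ natSet M, d ∣ n) :
    AdjoinRoot.root (orPoly M) ^ n = 1 := by
  obtain ⟨q, hq⟩ := orPoly_dvd_X_pow_sub_one hM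
  have : AdjoinRoot.mk (orPoly M) (X ^ n - 1) = 0 := by rw [hq, map_mul, AdjoinRoot.mk_self, zero_mul]
  rw [map_sub, map_pow, AdjoinRoot.mk_X, map_one, sub_eq_zero] at this
  exact this

end Count

/-- Modules over the integers with endomorphism are isomorphic if there is an additive isomorphism
which is compatible with the endomorphisms. -/
lemma PairIso.of_addEquiv {G H : Type*} [AddCommGroup G] [Module ℤ G] [AddCommGroup H] [Module ℤ H]
    {g : Module.End ℤ G} {h : Module.End ℤ H} (e : G ≃+ H) (he : ∀ x, e (g x) = h (e x)) :
    PairIso g h :=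
  ⟨{ e with map_smul' := fun c x => map_intCast_smul e ℤ ℤ c x }, he⟩

/-- `A` need not be finite-dimensional: generation and the universal property give surjections in
both directions between the quotient of `A` and the finite-dimensional pair algebra. -/
lemma finrank_quotient_eq_pairDim {K A : Type*} [Field K] [CommRing A] [Algebra K A] {x y : A}
    {f g h : K[X]} (hf : f.Monic) (hg : g.Monic)
    (htop : ∀ S : Subalgebra K A, x ∈ S → y ∈ S → S = ⊤)
    (hlift : ∃ F : A →ₐ[K] MvPolynomial (Fin 2) K ⧸ pairIdeal f g h,
      F x = pairX f g h ∧ F y = pairY f g h)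
    (hx : aeval x f = 0) (hy : aeval y g = 0) :
    Module.finrank K (A ⧸ Ideal.span {aeval (x * y) h}) = pairDim f g h := by
  have := finite_pair hf hg h
  let π := Ideal.Quotient.mkₐ K (Ideal.span {aeval (x * y) h})
  have hπs : Function.Surjective π := Ideal.Quotient.mkₐ_surjective _ _
  obtain ⟨h1, h2, h3⟩ := pair_relations f g h
  obtain ⟨G, hGx, hGy⟩ := hlift
  have hker : ∀ z ∈ Ideal.span {aeval (x * y) h}, G z = 0 := by
    change Ideal.span {aeval (x * y) h} ≤ RingHom.ker G
    rw [Ideal.span_singleton_le_iff_mem, RingHom.mem_ker, ← aeval_algHom_apply, map_mul, hGx, hGy, h3]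
  obtain ⟨F, hFx, hFy⟩ := exists_algHom_pair (f := f) (g := g) (h := h) (π x) (π y)
    (by rw [aeval_algHom_apply, hx, map_zero]) (by rw [aeval_algHom_apply, hy, map_zero])
    (by
      rw [← map_mul, aeval_algHom_apply]
      exact Ideal.Quotient.eq_zero_iff_mem.2 (Ideal.mem_span_singleton_self _))
  have hFs : Function.Surjective F := by
    have htop : F.range.comap π = ⊤ := htop _ ⟨_, hFx⟩ ⟨_, hFy⟩
    intro z
    obtain ⟨z, rfl⟩ := hπs z
    have : z ∈ F.range.comap π := htop ▸ Algebra.mem_top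
    exact this
  have : Module.Finite K (A ⧸ Ideal.span {aeval (x * y) h}) :=
    Module.Finite.of_surjective F.toLinearMap hFs
  apply le_antisymm
  · exact finrank_le_of_algHom_surjective K F hFs
  · refine finrank_le_of_algHom_surjective K (Ideal.Quotient.liftₐ _ G hker) ?_
    rw [← AlgHom.range_eq_top]
    exact pair_subalgebra_eq_top ⟨π x, hGx⟩ ⟨π y, hGy⟩

/-! ### The tensor product of two blocks as a universal ring -/

section RootPair

variable {M N : Finset ℕ+} {X : Type} [CommRing X]

/-- The ring `X` is generated by zeros `x` and `y` of the two polynomials, and it is universal. -/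
structure IsRootPair (M N : Finset ℕ+) {X : Type} [CommRing X] (x y : X) : Prop where
  eq_top : ∀ S : Subring X, x ∈ S → y ∈ S → S = ⊤
  lift : ∀ (B : Type) [CommRing B] (x' y' : B), aeval x' (orPoly M) = 0 → aeval y' (orPoly N) = 0 →
    ∃ F : X →+* B, F x = x' ∧ F y = y'
  aeval_left : aeval x (orPoly M) = 0
  aeval_right : aeval y (orPoly N) = 0

namespace IsRootPair

variable {x y : X} (h : IsRootPair M N x y) (K : Type) [Field K]

include h

lemma baseChange_eq_top {A : Subalgebra K (K ⊗[ℤ] X)} (hx : (1 : K) ⊗ₜ[ℤ] x ∈ A)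
    (hy : (1 : K) ⊗ₜ[ℤ] y ∈ A) : A = ⊤ := by
  have hr := h.eq_top (A.toSubring.comap
    (Algebra.TensorProduct.includeRight : X →ₐ[ℤ] K ⊗[ℤ] X).toRingHom) hx hy
  rw [eq_top_iff]
  rintro z -
  induction z using TensorProduct.induction_on with
  | zero => exact A.zero_mem
  | tmul a b =>
    have h2 : b ∈ A.toSubring.comap
        (Algebra.TensorProduct.includeRight : X →ₐ[ℤ] K ⊗[ℤ] X).toRingHom := hr ▸ Subring.mem_top b
    have h3 : (1 : K) ⊗ₜ[ℤ] b ∈ A := h2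
    have := A.smul_mem h3 a
    rwa [TensorProduct.smul_tmul', smul_eq_mul, mul_one] at this
  | add a b ha hb => exact A.add_mem ha hb

lemma exists_algHom_baseChange {B : Type} [CommRing B] [Algebra K B] (x' y' : B)
    (hx : aeval x' (∏ d ∈ natSet M, cyclotomic d K) = 0)
    (hy : aeval y' (∏ d ∈ natSet N, cyclotomic d K) = 0) :
    ∃ F : K ⊗[ℤ] X →ₐ[K] B, F ((1 : K) ⊗ₜ[ℤ] x) = x' ∧ F ((1 : K) ⊗ₜ[ℤ] y) = y' := by
  rw [← orPoly_map, ← algebraMap_int_eq, aeval_map_algebraMap] at hx hy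
  obtain ⟨φ, h1, h2⟩ := h.lift B x' y' hx hy
  refine ⟨Algebra.TensorProduct.lift (Algebra.ofId K B) φ.toIntAlgHom fun _ _ => Commute.all _ _,
    ?_, ?_⟩
  · simpa using h1
  · simpa using h2

lemma aeval_baseChange :
    aeval ((1 : K) ⊗ₜ[ℤ] x) (∏ d ∈ natSet M, cyclotomic d K) = 0 ∧
    aeval ((1 : K) ⊗ₜ[ℤ] y) (∏ d ∈ natSet N, cyclotomic d K) = 0 := by
  constructor
  · rw [← orPoly_map, aeval_one_tmul, h.aeval_left, TensorProduct.tmul_zero]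
  · rw [← orPoly_map, aeval_one_tmul, h.aeval_right, TensorProduct.tmul_zero]

lemma finrank_quotient (f : K[X]) :
    Module.finrank K (K ⊗[ℤ] X ⧸ Ideal.span {aeval ((1 : K) ⊗ₜ[ℤ] (x * y)) f}) =
      pairDim (∏ d ∈ natSet M, cyclotomic d K) (∏ d ∈ natSet N, cyclotomic d K) f := by
  obtain ⟨hx, hy⟩ := h.aeval_baseChange K
  have hxy : (1 : K) ⊗ₜ[ℤ] (x * y) = ((1 : K) ⊗ₜ[ℤ] x) * ((1 : K) ⊗ₜ[ℤ] y) := by simp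
  rw [hxy]
  obtain ⟨h1, h2, -⟩ := pair_relations (∏ d ∈ natSet M, cyclotomic d K)
    (∏ d ∈ natSet N, cyclotomic d K) f
  exact finrank_quotient_eq_pairDim (monic_prod_of_monic _ _ fun d _ => cyclotomic.monic d K)
    (monic_prod_of_monic _ _ fun d _ => cyclotomic.monic d K)
    (fun _ h1 h2 => h.baseChange_eq_top K h1 h2) (h.exists_algHom_baseChange K _ _ h1 h2) hx hy

end IsRootPair

/-- An algebraically closed field of characteristic `p`. -/
def PrimeClosure (p : ℕ) (hp : p.Prime) : Type :=
  haveI := Fact.mk hp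
  AlgebraicClosure (ZMod p)

noncomputable instance (p : ℕ) (hp : p.Prime) : Field (PrimeClosure p hp) :=
  haveI := Fact.mk hp
  inferInstanceAs (Field (AlgebraicClosure (ZMod p)))

instance (p : ℕ) (hp : p.Prime) : CharP (PrimeClosure p hp) p :=
  haveI := Fact.mk hp
  inferInstanceAs (CharP (AlgebraicClosure (ZMod p)) p)

instance (p : ℕ) (hp : p.Prime) : IsAlgClosed (PrimeClosure p hp) :=
  haveI := Fact.mk hp
  inferInstanceAs (IsAlgClosed (AlgebraicClosure (ZMod p)))

namespace IsRootPair

variable {x y : X} (h : IsRootPair M N x y) {n : ℕ} [NeZero n]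

include h

lemma pow_eq_one (hM : ∀ d ∈ natSet M, d ∣ n) (hN : ∀ d ∈ natSet N, d ∣ n) :
    x ^ n = 1 ∧ y ^ n = 1 := by
  constructor
  · obtain ⟨q, hq⟩ := orPoly_dvd_X_pow_sub_one hM
    have := congrArg (aeval x) hq
    rw [map_mul, h.aeval_left, zero_mul] at this
    simpa [sub_eq_zero] using this
  · obtain ⟨q, hq⟩ := orPoly_dvd_X_pow_sub_one hN
    have := congrArg (aeval y) hq
    rw [map_mul, h.aeval_right, zero_mul] at this
    simpa [sub_eq_zero] using this

/-- Since `y` has finite multiplicative order, `x = (x y) y ^ (n - 1)` is recovered from `t = x y`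
and `y`. -/
lemma adjoin_eq_top (hN : y ^ n = 1) (K : Type) [Field K] :
    Algebra.adjoin K {(1 : K) ⊗ₜ[ℤ] (x * y), (1 : K) ⊗ₜ[ℤ] y} = ⊤ := by
  have hy : (1 : K) ⊗ₜ[ℤ] y ∈ Algebra.adjoin K {(1 : K) ⊗ₜ[ℤ] (x * y), (1 : K) ⊗ₜ[ℤ] y} :=
    Algebra.subset_adjoin (Or.inr rfl)
  refine h.baseChange_eq_top K ?_ hy
  have h1 : (1 : K) ⊗ₜ[ℤ] x = (1 : K) ⊗ₜ[ℤ] (x * y) * ((1 : K) ⊗ₜ[ℤ] y) ^ (n - 1) := by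
    have h2 : y * y ^ (n - 1) = 1 := by rw [← pow_succ', Nat.sub_add_cancel (NeZero.pos n), hN]
    rw [Algebra.TensorProduct.tmul_pow, Algebra.TensorProduct.tmul_mul_tmul, mul_assoc, h2,
      one_pow, mul_one, mul_one]
  rw [h1]
  exact Subalgebra.mul_mem _ (Algebra.subset_adjoin (Or.inl rfl)) (Subalgebra.pow_mem _ hy _)

/-- The tensor product of two Orlik blocks decomposes into Orlik blocks. -/
theorem pairIso [Module.Free ℤ X] [Module.Finite ℤ X]
    (hrank : Module.finrank ℤ X = (orPoly M).natDegree * (orPoly N).natDegree)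
    (hM : ∀ d ∈ natSet M, d ∣ n) (hN : ∀ d ∈ natSet N, d ∣ n)
    (h₀ : FieldLayers ℂ n (natSet M) (natSet N))
    (hp : ∀ p hp, FieldLayers (PrimeClosure p hp) n (natSet M) (natSet N))
    (L : ℕ → Finset ℕ+) (hL : ∀ j, ∀ d ∈ natSet (L j), d ∣ n)
    (hmem : ∀ j (z : ZMod n), addOrderOf z ∈ natSet (L j) ↔
      j < orderCount n (natSet M) (natSet N) z)
    (l : ℕ) (hl : ∀ z : ZMod n, orderCount n (natSet M) (natSet N) z ≤ l) :
    PairIso (LinearMap.mulLeft ℤ (x * y)) (DirectSum.lmap fun j : Fin l => orEnd (L j)) := by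
  obtain ⟨hxn, hyn⟩ := h.pow_eq_one hM hN
  refine exists_equiv_of_mulSpanned (x * y) y l
    (fun j => orPoly (L j)) (fun j => orPoly_monic _) ?_ ?_ ?_
  -- No element has more than `l` representations, so the last layer is empty and its polynomial is
  -- `1`.
  · have : L l = ∅ := by
      rw [Finset.eq_empty_iff_forall_notMem]
      intro m hm
      rw [← mem_natSet] at hm
      obtain ⟨z, hz⟩ := exists_addOrderOf_eq (hL l _ hm)
      rw [← hz, hmem] at hm
      exact absurd (hl z) (not_le.2 hm)
    rw [this, orPoly, Finset.prod_empty]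
  · intro j _
    -- The common dimension in all characteristics is the sum of the counts exceeding `j`.
    refine mulSpanned_int _ _ _ j
      (∑ z : ZMod n, if j < orderCount n (natSet M) (natSet N) z then
        orderCount n (natSet M) (natSet N) z else 0) ℂ PrimeClosure ?_ ?_ ?_
    · rw [orPoly_map, h.finrank_quotient]
      exact h₀.pairDim_eq j _ (hL j) (hmem j)
    · intro p hp'
      rw [orPoly_map, h.finrank_quotient]
      exact (hp p hp').pairDim_eq j _ (hL j) (hmem j)
    · intro p hp'
      rw [orPoly_map]
      refine (hp p hp').mulSpanned j _ (hL j) (hmem j) _ _ _ (h.adjoin_eq_top hyn _)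
        (fun f => h.finrank_quotient _ f) ?_
      rw [Algebra.TensorProduct.tmul_pow, mul_pow, hxn, hyn, one_pow, mul_one]
      rfl
  · have h1 : ∀ j, (orPoly (L j)).natDegree =
        (Finset.univ.filter fun z : ZMod n => j < orderCount n (natSet M) (natSet N) z).card := by
      intro j
      rw [natDegree_orPoly (hL j)]
      congr 1
      ext z
      rw [mem_orderSet, hmem]
      simp
    simp only [h1]
    rw [sum_card_lt _ hl, hrank, natDegree_orPoly hM, natDegree_orPoly hN]
    exact sum_sumCount _ _

end IsRootPair

/-- The ring `A` is generated by a zero `a` of a polynomial, and it is universal. -/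
structure IsRootRing (M : Finset ℕ+) {A : Type} [CommRing A] (a : A) : Prop where
  eq_top : ∀ S : Subring A, a ∈ S → S = ⊤
  lift : ∀ (B : Type) [CommRing B] (b : B), aeval b (orPoly M) = 0 → ∃ F : A →+* B, F a = b
  aeval_eq : aeval a (orPoly M) = 0

lemma isRootRing_orBlock (M : Finset ℕ+) : IsRootRing M (AdjoinRoot.root (orPoly M)) where
  eq_top S hS := by
    rw [eq_top_iff]
    rintro z -
    obtain ⟨f, rfl⟩ := AdjoinRoot.mk_surjective z
    induction f using Polynomial.induction_on' with
    | add f g hf hg => rw [map_add]; exact S.add_mem hf hg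
    | monomial k c =>
      rw [← C_mul_X_pow_eq_monomial, map_mul, map_pow, AdjoinRoot.mk_X]
      refine S.mul_mem ?_ (S.pow_mem hS k)
      have : AdjoinRoot.mk (orPoly M) (C c) = (c : AdjoinRoot (orPoly M)) := by simp
      rw [this]
      exact intCast_mem S c
  lift B _ b hb := ⟨AdjoinRoot.lift (Int.castRingHom B) b hb, AdjoinRoot.lift_root _⟩
  aeval_eq := by
    have := AdjoinRoot.eval₂_root (orPoly M)
    rw [aeval_def]
    convert this
    exact RingHom.ext_int _ _

section Tensor

variable {A B : Type} [CommRing A] [CommRing B] {a : A} {b : B}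

lemma IsRootRing.isRootPair (ha : IsRootRing M a) (hb : IsRootRing N b) :
    IsRootPair M N (a ⊗ₜ[ℤ] (1 : B)) ((1 : A) ⊗ₜ[ℤ] b) where
  eq_top S hx hy := by
    have hl := ha.eq_top (S.comap (Algebra.TensorProduct.includeLeft : A →ₐ[ℤ] A ⊗[ℤ] B).toRingHom) hx
    have hr := hb.eq_top (S.comap (Algebra.TensorProduct.includeRight : B →ₐ[ℤ] A ⊗[ℤ] B).toRingHom) hy
    rw [eq_top_iff]
    rintro z -
    induction z using TensorProduct.induction_on with
    | zero => exact S.zero_mem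
    | tmul c d =>
      have h1 : c ∈ S.comap (Algebra.TensorProduct.includeLeft : A →ₐ[ℤ] A ⊗[ℤ] B).toRingHom :=
        hl ▸ Subring.mem_top c
      have h2 : d ∈ S.comap (Algebra.TensorProduct.includeRight : B →ₐ[ℤ] A ⊗[ℤ] B).toRingHom :=
        hr ▸ Subring.mem_top d
      have h3 : c ⊗ₜ[ℤ] (1 : B) ∈ S := h1
      have h4 : (1 : A) ⊗ₜ[ℤ] d ∈ S := h2
      have := S.mul_mem h3 h4
      rwa [Algebra.TensorProduct.tmul_mul_tmul, one_mul, mul_one] at this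
    | add c d hc hd => exact S.add_mem hc hd
  lift C _ x' y' hx hy := by
    obtain ⟨φ, hφ⟩ := ha.lift C x' hx
    obtain ⟨φ', hφ'⟩ := hb.lift C y' hy
    refine ⟨(Algebra.TensorProduct.lift φ.toIntAlgHom φ'.toIntAlgHom
      fun _ _ => Commute.all _ _).toRingHom, ?_, ?_⟩
    · simpa using hφ
    · simpa using hφ'
  aeval_left := by
    have h : aeval ((Algebra.TensorProduct.includeLeft : A →ₐ[ℤ] A ⊗[ℤ] B).toRingHom.toIntAlgHom a)
        (orPoly M) = 0 := by
      rw [aeval_algHom_apply, ha.aeval_eq, map_zero]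
    exact h
  aeval_right := by
    have h : aeval ((Algebra.TensorProduct.includeRight : B →ₐ[ℤ] A ⊗[ℤ] B).toRingHom.toIntAlgHom b)
        (orPoly N) = 0 := by
      rw [aeval_algHom_apply, hb.aeval_eq, map_zero]
    exact h

/-- The tensor product of two Orlik blocks decomposes into Orlik blocks. -/
theorem IsRootRing.pairIso_tensor [Module.Free ℤ A] [Module.Finite ℤ A] [Module.Free ℤ B]
    [Module.Finite ℤ B] (ha : IsRootRing M a) (hb : IsRootRing N b)
    (hA : Module.finrank ℤ A = (orPoly M).natDegree)
    (hB : Module.finrank ℤ B = (orPoly N).natDegree) {n : ℕ} [NeZero n]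
    (hM : ∀ d ∈ natSet M, d ∣ n) (hN : ∀ d ∈ natSet N, d ∣ n)
    (h₀ : FieldLayers ℂ n (natSet M) (natSet N))
    (hp : ∀ p hp, FieldLayers (PrimeClosure p hp) n (natSet M) (natSet N))
    (L : ℕ → Finset ℕ+) (hL : ∀ j, ∀ d ∈ natSet (L j), d ∣ n)
    (hmem : ∀ j (z : ZMod n), addOrderOf z ∈ natSet (L j) ↔
      j < orderCount n (natSet M) (natSet N) z)
    (l : ℕ) (hl : ∀ z : ZMod n, orderCount n (natSet M) (natSet N) z ≤ l) :
    PairIso (TensorProduct.map (LinearMap.mulLeft ℤ a) (LinearMap.mulLeft ℤ b))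
      (DirectSum.lmap fun j : Fin l => orEnd (L j)) := by
  have hfree : @Module.Free ℤ (A ⊗[ℤ] B) _ _ TensorProduct.leftModule := inferInstance
  have hfin : @Module.Finite ℤ (A ⊗[ℤ] B) _ _ TensorProduct.leftModule := inferInstance
  have hrank := Module.finrank_tensorProduct (R := ℤ) (S := ℤ) (M := A) (M' := B)
  -- The `ℤ`-module structure of a tensor product and that of its additive group agree; the results
  -- for universal rings use the latter.
  have hmod : (TensorProduct.leftModule : Module ℤ (A ⊗[ℤ] B)) =
    AddCommGroup.toIntModule _ := Subsingleton.elim _ _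
  rw [hmod, hA, hB] at hrank
  rw [hmod] at hfree hfin
  obtain ⟨e, he⟩ := (ha.isRootPair hb).pairIso hrank hM hN h₀ hp L hL hmem l hl
  refine PairIso.of_addEquiv e.toAddEquiv fun x => ?_
  have hx : TensorProduct.map (LinearMap.mulLeft ℤ a) (LinearMap.mulLeft ℤ b) x =
      (a ⊗ₜ[ℤ] (1 : B)) * ((1 : A) ⊗ₜ[ℤ] b) * x := by
    induction x using TensorProduct.induction_on with
    | zero => simp
    | tmul c d => simp
    | add c d hc hd => rw [map_add, hc, hd, mul_add]
  rw [hx]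
  exact he x

end Tensor

end RootPair

/-- The tensor product of two Orlik blocks decomposes into Orlik blocks. -/
theorem pairIso_orBlock_tensor {M N : Finset ℕ+} {n : ℕ} [NeZero n]
    (hM : ∀ d ∈ natSet M, d ∣ n) (hN : ∀ d ∈ natSet N, d ∣ n)
    (h₀ : FieldLayers ℂ n (natSet M) (natSet N))
    (hp : ∀ p hp, FieldLayers (PrimeClosure p hp) n (natSet M) (natSet N))
    (L : ℕ → Finset ℕ+) (hL : ∀ j, ∀ d ∈ natSet (L j), d ∣ n)
    (hmem : ∀ j (z : ZMod n), addOrderOf z ∈ natSet (L j) ↔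
      j < orderCount n (natSet M) (natSet N) z)
    (l : ℕ) (hl : ∀ z : ZMod n, orderCount n (natSet M) (natSet N) z ≤ l) :
    PairIso (TensorProduct.map (orEnd M) (orEnd N)) (DirectSum.lmap fun j : Fin l => orEnd (L j)) := by
  exact (isRootRing_orBlock M).pairIso_tensor (isRootRing_orBlock N)
    (finrank_adjoinRoot (orPoly_monic M)) (finrank_adjoinRoot (orPoly_monic N)) hM hN h₀ hp L hL hmem l hl


/-! ### Isomorphisms of modules with endomorphism -/

namespace PairIso

variable {R : Type*} [CommRing R] {G G' H H' I : Type*} [AddCommGroup G] [Module R G]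
  [AddCommGroup G'] [Module R G'] [AddCommGroup H] [Module R H] [AddCommGroup H'] [Module R H']
  [AddCommGroup I] [Module R I] {g : Module.End R G} {g' : Module.End R G'} {h : Module.End R H}
  {h' : Module.End R H'} {i : Module.End R I}

lemma refl (g : Module.End R G) : PairIso g g := ⟨LinearEquiv.refl R G, fun _ => rfl⟩

lemma symm : PairIso g h → PairIso h g := by
  rintro ⟨e, he⟩
  refine ⟨e.symm, fun x => ?_⟩
  rw [LinearEquiv.symm_apply_eq, he, e.apply_symm_apply]

lemma trans : PairIso g h → PairIso h i → PairIso g i := by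
  rintro ⟨e, he⟩ ⟨e', he'⟩
  exact ⟨e.trans e', fun x => by simp [he, he']⟩

lemma prodMap : PairIso g h → PairIso g' h' → PairIso (g.prodMap g') (h.prodMap h') := by
  rintro ⟨e, he⟩ ⟨e', he'⟩
  exact ⟨e.prodCongr e', fun x => by simp [he, he']⟩

lemma prodAssoc (g : Module.End R G) (h : Module.End R H) (i : Module.End R I) :
    PairIso ((g.prodMap h).prodMap i) (g.prodMap (h.prodMap i)) :=
  ⟨LinearEquiv.prodAssoc R G H I, fun _ => rfl⟩

lemma prod_of_subsingleton [Subsingleton G] (g : Module.End R G) (h : Module.End R H) :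
    PairIso (g.prodMap h) h :=
  ⟨{ LinearMap.snd R G H with
      invFun := fun x => (0, x)
      left_inv := fun _ => Prod.ext (Subsingleton.elim _ _) rfl
      right_inv := fun _ => rfl }, fun _ => rfl⟩

section DirectSum

variable {ι κ : Type*} {M N : ι → Type*} [∀ i, AddCommGroup (M i)] [∀ i, Module R (M i)]
  [∀ i, AddCommGroup (N i)] [∀ i, Module R (N i)]

lemma lmap_congr {f : ∀ i, Module.End R (M i)} {f' : ∀ i, Module.End R (N i)}
    (hf : ∀ i, PairIso (f i) (f' i)) : PairIso (DirectSum.lmap f) (DirectSum.lmap f') := by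
  choose e he using hf
  refine ⟨DirectSum.congrLinearEquiv e, fun x => ?_⟩
  ext i
  change e i (DirectSum.lmap f x i) = DirectSum.lmap f' (DirectSum.lmap (fun i => (e i).toLinearMap) x) i
  simp [he]

lemma lmap_reindex (f : ∀ i, Module.End R (M i)) (e : ι ≃ κ) :
    PairIso (DirectSum.lmap f) (DirectSum.lmap fun k => f (e.symm k)) := by
  refine ⟨DirectSum.lequivCongrLeft R e, fun x => ?_⟩
  ext k
  simp

lemma lmap_option {M : Option ι → Type*} [∀ i, AddCommGroup (M i)] [∀ i, Module R (M i)]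
    (f : ∀ i, Module.End R (M i)) :
    PairIso (DirectSum.lmap f) ((f none).prodMap (DirectSum.lmap fun k => f (some k))) := by
  refine ⟨DirectSum.lequivProdDirectSum R, fun x => ?_⟩
  refine Prod.ext ?_ ?_
  · exact DirectSum.lmap_apply f x none
  · ext k
    exact DirectSum.lmap_apply f x (some k)

lemma lmap_sigma [DecidableEq ι] {α : ι → Type*} {M : ∀ i, α i → Type*}
    [∀ i j, AddCommGroup (M i j)] [∀ i j, Module R (M i j)] (f : ∀ i j, Module.End R (M i j)) :
    PairIso (DirectSum.lmap fun i => DirectSum.lmap (f i))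
      (DirectSum.lmap fun k : Σ i, α i => f k.1 k.2) := by
  refine symm ⟨DirectSum.sigmaLcurryEquiv R, fun x => ?_⟩
  ext i j
  rw [DirectSum.lmap_apply, DirectSum.lmap_apply]
  exact (DirectSum.sigmaLcurry_apply R _ i j).trans ((DirectSum.lmap_apply _ x ⟨i, j⟩).trans
    (congrArg (f i j) (DirectSum.sigmaLcurry_apply R x i j).symm))

lemma tensor_lmap [DecidableEq ι] [DecidableEq κ] {N : κ → Type*} [∀ i, AddCommGroup (N i)]
    [∀ i, Module R (N i)] (f : ∀ i, Module.End R (M i)) (f' : ∀ i, Module.End R (N i)) :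
    PairIso (TensorProduct.map (DirectSum.lmap f) (DirectSum.lmap f'))
      (DirectSum.lmap fun k : ι × κ => TensorProduct.map (f k.1) (f' k.2)) := by
  refine ⟨TensorProduct.directSum R R M N, LinearMap.congr_fun (f := LinearMap.comp
    (TensorProduct.directSum R R M N).toLinearMap
      (TensorProduct.map (DirectSum.lmap f) (DirectSum.lmap f')))
    (g := LinearMap.comp (DirectSum.lmap fun k : ι × κ => TensorProduct.map (f k.1) (f' k.2))
      (TensorProduct.directSum R R M N).toLinearMap) ?_⟩
  refine TensorProduct.ext (DirectSum.linearMap_ext R fun i => LinearMap.ext fun x =>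
    DirectSum.linearMap_ext R fun j => LinearMap.ext fun y => ?_)
  simp [TensorProduct.directSum_lof_tmul_lof, DirectSum.lmap_lof]

end DirectSum

end PairIso

/-! ### Exchanging cyclic summands -/

section CyclicModules

variable {R : Type*} [CommRing R]

/-- The map `R[t] / (F) → R[t] / (G)` which is induced by multiplication by `c`. -/
lemma exists_mulMap {F G c : R[X]} (hF : F.Monic) (hc : G ∣ F * c) :
    ∃ μ : AdjoinRoot F →ₗ[R] AdjoinRoot G,
      (∀ Q, μ (AdjoinRoot.mk F Q) = AdjoinRoot.mk G (Q * c)) ∧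
      ∀ z, μ (AdjoinRoot.root F * z) = AdjoinRoot.root G * μ z := by
  have hw : aeval (AdjoinRoot.root G) F * AdjoinRoot.mk G c = 0 := by
    rw [AdjoinRoot.aeval_eq, ← map_mul, AdjoinRoot.mk_eq_zero]
    exact hc
  refine ⟨cyclicMap hF (AdjoinRoot.root G) (AdjoinRoot.mk G c), fun Q => ?_,
    fun z => cyclicMap_root_mul hF hw z⟩
  rw [cyclicMap_mk hF hw, AdjoinRoot.aeval_eq, map_mul]

lemma exists_linearMap_prod {A A' B B' : Type*} [AddCommGroup A] [Module R A] [AddCommGroup A']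
    [Module R A'] [AddCommGroup B] [Module R B] [AddCommGroup B'] [Module R B']
    (f₁₁ : A →ₗ[R] B) (f₁₂ : A' →ₗ[R] B) (f₂₁ : A →ₗ[R] B') (f₂₂ : A' →ₗ[R] B') :
    ∃ φ : A × A' →ₗ[R] B × B', ∀ x y, φ (x, y) = (f₁₁ x + f₁₂ y, f₂₁ x + f₂₂ y) :=
  ⟨LinearMap.prod (f₁₁.coprod f₁₂) (f₂₁.coprod f₂₂), fun _ _ => rfl⟩

/-- For coprime `u` and `v`, the cyclic modules for `d u` and `d v` can be replaced by the cyclic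
modules for `d u v` and `d`. -/
lemma pairIso_adjoinRoot_of_isCoprime {d u v : R[X]} (hd : d.Monic) (hu : u.Monic) (hv : v.Monic)
    (huv : IsCoprime u v) :
    PairIso ((LinearMap.mulLeft R (AdjoinRoot.root (d * u))).prodMap
      (LinearMap.mulLeft R (AdjoinRoot.root (d * v))))
      ((LinearMap.mulLeft R (AdjoinRoot.root (d * u * v))).prodMap
        (LinearMap.mulLeft R (AdjoinRoot.root d))) := by
  obtain ⟨α, β, h⟩ := huv
  have hdu := hd.mul hu
  have hdv := hd.mul hv
  have hduv := hdu.mul hv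
  -- With `α u + β v = 1`, the isomorphism is the matrix with rows `(β v, α u)` and `(-1, 1)` of
  -- determinant `1`; the inverse has rows `(1, -α u)` and `(1, β v)`. Each entry is a well defined
  -- map of the cyclic modules.
  obtain ⟨μ₁₁, hμ₁₁, hr₁₁⟩ := exists_mulMap (G := d * u * v) (c := β * v) hdu ⟨β, by ring⟩
  obtain ⟨μ₁₂, hμ₁₂, hr₁₂⟩ := exists_mulMap (G := d * u * v) (c := α * u) hdv ⟨α, by ring⟩
  obtain ⟨μ₂₁, hμ₂₁, hr₂₁⟩ := exists_mulMap (G := d) (c := -1) hdu ⟨-u, by ring⟩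
  obtain ⟨μ₂₂, hμ₂₂, hr₂₂⟩ := exists_mulMap (G := d) (c := 1) hdv ⟨v, by ring⟩
  obtain ⟨ν₁₁, hν₁₁, -⟩ := exists_mulMap (G := d * u) (c := 1) hduv ⟨v, by ring⟩
  obtain ⟨ν₁₂, hν₁₂, -⟩ := exists_mulMap (G := d * u) (c := -(α * u)) hd ⟨-α, by ring⟩
  obtain ⟨ν₂₁, hν₂₁, -⟩ := exists_mulMap (G := d * v) (c := 1) hduv ⟨u, by ring⟩
  obtain ⟨ν₂₂, hν₂₂, -⟩ := exists_mulMap (G := d * v) (c := β * v) hd ⟨β, by ring⟩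
  obtain ⟨φ, hφ⟩ := exists_linearMap_prod μ₁₁ μ₁₂ μ₂₁ μ₂₂
  obtain ⟨φ', hφ'⟩ := exists_linearMap_prod ν₁₁ ν₁₂ ν₂₁ ν₂₂
  have h1 : φ ∘ₗ φ' = LinearMap.id := by
    refine LinearMap.ext fun ⟨x, y⟩ => ?_
    obtain ⟨x, rfl⟩ := AdjoinRoot.mk_surjective x
    obtain ⟨y, rfl⟩ := AdjoinRoot.mk_surjective y
    rw [LinearMap.comp_apply, hφ', hν₁₁, hν₁₂, hν₂₁, hν₂₂,
      ← map_add, ← map_add, hφ, hμ₁₁, hμ₁₂, hμ₂₁, hμ₂₂,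
      ← map_add, ← map_add, LinearMap.id_apply]
    exact Prod.ext (congrArg (AdjoinRoot.mk (d * u * v)) (by linear_combination x * h))
      (congrArg (AdjoinRoot.mk d) (by linear_combination y * h))
  have h2 : φ' ∘ₗ φ = LinearMap.id := by
    refine LinearMap.ext fun ⟨x, y⟩ => ?_
    obtain ⟨x, rfl⟩ := AdjoinRoot.mk_surjective x
    obtain ⟨y, rfl⟩ := AdjoinRoot.mk_surjective y
    rw [LinearMap.comp_apply, hφ, hμ₁₁, hμ₁₂, hμ₂₁, hμ₂₂,
      ← map_add, ← map_add, hφ', hν₁₁, hν₁₂, hν₂₁, hν₂₂,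
      ← map_add, ← map_add, LinearMap.id_apply]
    exact Prod.ext (congrArg (AdjoinRoot.mk (d * u)) (by linear_combination x * h))
      (congrArg (AdjoinRoot.mk (d * v)) (by linear_combination y * h))
  refine ⟨LinearEquiv.ofLinearMap φ φ' h1 h2, fun x => ?_⟩
  obtain ⟨x, y⟩ := x
  simp only [LinearEquiv.coe_ofLinearMap, LinearMap.prodMap_apply, LinearMap.mulLeft_apply, hφ,
    hr₁₁, hr₁₂, hr₂₁, hr₂₂, mul_add]

end CyclicModules

/-! ### Comaximal cyclotomic polynomials -/

section Comaximal

/-- Cyclotomic polynomials are comaximal over the integers if the quotient of their indices is not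
a power of a prime number. -/
lemma isCoprime_cyclotomic_int {m n : ℕ} (hm : m ≠ 0) (hn : n ≠ 0)
    (h : ∀ p, p.Prime → ordCompl[p] m ≠ ordCompl[p] n) :
    IsCoprime (cyclotomic m ℤ) (cyclotomic n ℤ) := by
  rw [← Ideal.isCoprime_span_singleton_iff, Ideal.isCoprime_iff_sup_eq]
  -- Otherwise both polynomials lie in a maximal ideal `I`, and the class of `X` in the field `ℤ[X]
  -- / I` is a common root. In characteristic `p` it is a primitive root of unity for the `p`-free
  -- parts of both indices, which must therefore agree.
  by_contra htop
  obtain ⟨I, hI, hle⟩ := Ideal.exists_le_maximal _ htop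
  let := Ideal.Quotient.field I
  have hroot : ∀ k, cyclotomic k ℤ ∈ I →
      (cyclotomic k (ℤ[X] ⧸ I)).IsRoot (Ideal.Quotient.mk I X) := fun k hk => by
    rw [← map_cyclotomic_int, IsRoot.def, eval_map, ← Ideal.Quotient.eq_zero_iff_mem.2 hk]
    have := hom_eval₂ (cyclotomic k ℤ) C (Ideal.Quotient.mk I) X
    rw [eval₂_C_X] at this
    rw [this]
    congr 1
  have h1 := hroot m (hle (Ideal.mem_sup_left (Ideal.mem_span_singleton_self _)))
  have h2 := hroot n (hle (Ideal.mem_sup_right (Ideal.mem_span_singleton_self _)))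
  obtain ⟨p, hp⟩ := CharP.exists (ℤ[X] ⧸ I)
  rcases CharP.char_is_prime_or_zero (ℤ[X] ⧸ I) p with hprime | rfl
  · have := Fact.mk hprime
    have key : ∀ k, k ≠ 0 → (cyclotomic k (ℤ[X] ⧸ I)).IsRoot (Ideal.Quotient.mk I X) →
        IsPrimitiveRoot (Ideal.Quotient.mk I X) (ordCompl[p] k) := fun k hk hr => by
      have : NeZero ((ordCompl[p] k : ℕ) : ℤ[X] ⧸ I) := ⟨fun h0 =>
        Nat.not_dvd_ordCompl hprime hk ((CharP.cast_eq_zero_iff _ p _).1 h0)⟩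
      rw [← Nat.ordProj_mul_ordCompl_eq_self k p] at hr
      exact isRoot_cyclotomic_prime_pow_mul_iff_of_charP.1 hr
    exact h p hprime ((key m hm h1).unique (key n hn h2))
  · have := CharP.charP_to_charZero (ℤ[X] ⧸ I)
    have := NeZero.mk (Nat.cast_ne_zero.2 hm : ((m : ℕ) : ℤ[X] ⧸ I) ≠ 0)
    have := NeZero.mk (Nat.cast_ne_zero.2 hn : ((n : ℕ) : ℤ[X] ⧸ I) ≠ 0)
    rw [isRoot_cyclotomic_iff] at h1 h2
    exact h 2 Nat.prime_two (by rw [h1.unique h2])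

/-- Two sets of indices such that the differences consist of pairwise comaximal elements. -/
def Unlinked (A B : Finset ℕ+) : Prop :=
  ∀ a ∈ A \ B, ∀ b ∈ B \ A, ∀ p, p.Prime → ordCompl[p] (a : ℕ) ≠ ordCompl[p] (b : ℕ)

lemma pairIso_orBlock_union_inter {A B : Finset ℕ+} (h : Unlinked A B) :
    PairIso ((orEnd A).prodMap (orEnd B)) ((orEnd (A ∪ B)).prodMap (orEnd (A ∩ B))) := by
  have hA : orPoly A = orPoly (A ∩ B) * orPoly (A \ B) := by
    rw [orPoly, orPoly, orPoly, ← Finset.prod_union (Finset.disjoint_sdiff_inter A B).symm,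
      Finset.union_comm, Finset.sdiff_union_inter]
  have hB : orPoly B = orPoly (A ∩ B) * orPoly (B \ A) := by
    rw [orPoly, orPoly, orPoly, Finset.inter_comm,
      ← Finset.prod_union (Finset.disjoint_sdiff_inter B A).symm,
      Finset.union_comm, Finset.sdiff_union_inter]
  have hAB : orPoly (A ∪ B) = orPoly (A ∩ B) * orPoly (A \ B) * orPoly (B \ A) := by
    rw [← hA, orPoly, orPoly, orPoly, ← Finset.prod_union Finset.disjoint_sdiff,
      Finset.union_sdiff_self_eq_union]
  have hc : IsCoprime (orPoly (A \ B)) (orPoly (B \ A)) :=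
    IsCoprime.prod_left fun a ha => IsCoprime.prod_right fun b hb =>
      isCoprime_cyclotomic_int a.ne_zero b.ne_zero (h a ha b hb)
  have key := pairIso_adjoinRoot_of_isCoprime (orPoly_monic (A ∩ B)) (orPoly_monic (A \ B))
    (orPoly_monic (B \ A)) hc
  have transport : ∀ (M : Finset ℕ+) (F : ℤ[X]), orPoly M = F →
      PairIso (orEnd M) (LinearMap.mulLeft ℤ (AdjoinRoot.root F)) := by
    rintro M _ rfl
    exact PairIso.refl _
  exact ((transport _ _ hA).prodMap (transport _ _ hB)).trans
    (key.trans ((transport _ _ hAB).prodMap (transport _ _ rfl)).symm)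

end Comaximal


/-! ### Sorting blocks into a chain by unions and intersections -/

section Regroup

lemma PairIso.lmap_fin_succ {R : Type*} [CommRing R] {n : ℕ} {M : Fin (n + 1) → Type*}
    [∀ i, AddCommGroup (M i)] [∀ i, Module R (M i)] (f : ∀ i, Module.End R (M i)) :
    PairIso (DirectSum.lmap f) ((f 0).prodMap (DirectSum.lmap fun k : Fin n => f k.succ)) :=
  (PairIso.lmap_reindex f (finSuccEquiv n)).trans (PairIso.lmap_option _)

lemma PairIso.lmap_fin_last {R : Type*} [CommRing R] {n : ℕ} {M : Fin (n + 1) → Type*}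
    [∀ i, AddCommGroup (M i)] [∀ i, Module R (M i)] (f : ∀ i, Module.End R (M i)) :
    PairIso (DirectSum.lmap f)
      ((f (Fin.last n)).prodMap (DirectSum.lmap fun k : Fin n => f k.castSucc)) := by
  refine ((PairIso.lmap_reindex f finSuccEquivLast).trans (PairIso.lmap_option _)).trans ?_
  have h : ∀ i j : Fin (n + 1), i = j → PairIso (f i) (f j) := by
    rintro i _ rfl
    exact PairIso.refl _
  exact (h _ _ (by simp)).prodMap (PairIso.lmap_congr fun k => h _ _ (by simp))

lemma pairIso_orEnd_of_eq {A B : Finset ℕ+} (h : A = B) : PairIso (orEnd A) (orEnd B) := by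
  subst h
  exact PairIso.refl _

/-- A family of sets which is closed under unions and intersections and whose members are
unlinked. -/
structure IsUnlinkedLattice (𝒢 : Finset ℕ+ → Prop) : Prop where
  union : ∀ A B, 𝒢 A → 𝒢 B → 𝒢 (A ∪ B)
  inter : ∀ A B, 𝒢 A → 𝒢 B → 𝒢 (A ∩ B)
  unlinked : ∀ A B, 𝒢 A → 𝒢 B → Unlinked A B

variable {𝒢 : Finset ℕ+ → Prop} (h𝒢 : IsUnlinkedLattice 𝒢)

include h𝒢

/-- Insertion into a descending chain: `A ∪ B 0` becomes the new first set, and `A ∩ B 0` is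
inserted into the rest. The counts `b` of the chain go up by one exactly on `A`. -/
lemma pairIso_insert_chain (n : ℕ) (A : Finset ℕ+) (B : Fin n → Finset ℕ+)
    (D : Fin (n + 1) → Finset ℕ+) (b : ℕ+ → ℕ) (hb : ∀ m, b m ≤ n)
    (hB : ∀ k m, m ∈ B k ↔ (k : ℕ) < b m)
    (hD : ∀ k m, m ∈ D k ↔ (k : ℕ) < b m + if m ∈ A then 1 else 0)
    (hgA : 𝒢 A) (hgB : ∀ k, 𝒢 (B k)) :
    (∀ k, 𝒢 (D k)) ∧ PairIso ((orEnd A).prodMap (DirectSum.lmap fun k => orEnd (B k)))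
      (DirectSum.lmap fun k => orEnd (D k)) := by
  induction n generalizing A b with
  | zero =>
    have hD0 : A = D 0 := by
      ext m
      have := hb m
      rw [hD]
      split_ifs with h <;> simp [h]
      omega
    refine ⟨fun k => ?_, (PairIso.prodMap (pairIso_orEnd_of_eq hD0)
      (PairIso.lmap_congr fun k => k.elim0)).trans (PairIso.lmap_fin_succ fun k => orEnd (D k)).symm⟩
    rw [show k = 0 from Fin.ext (by omega), ← hD0]
    exact hgA
  | succ n ih =>
    have hD0 : A ∪ B 0 = D 0 := by
      ext m
      rw [Finset.mem_union, hB, hD]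
      split_ifs with h <;> simp [h]
    have h1 := PairIso.prodMap (PairIso.refl (orEnd A)) (PairIso.lmap_fin_succ fun k => orEnd (B k))
    have h2 := (PairIso.prodAssoc (orEnd A) (orEnd (B 0))
      (DirectSum.lmap fun k : Fin n => orEnd (B k.succ))).symm
    have h3 := PairIso.prodMap (pairIso_orBlock_union_inter (h𝒢.unlinked _ _ hgA (hgB 0)))
      (PairIso.refl (DirectSum.lmap fun k : Fin n => orEnd (B k.succ)))
    have h4 := PairIso.prodAssoc (orEnd (A ∪ B 0)) (orEnd (A ∩ B 0))
      (DirectSum.lmap fun k : Fin n => orEnd (B k.succ))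
    -- Dropping `B 0` lowers each count by one. Where `b m = 0` the subtraction truncates, but then
    -- `m` is not in `A ∩ B 0` either, so the counts still match.
    obtain ⟨hgD, h5⟩ := ih (A ∩ B 0) (fun k => B k.succ) (fun k => D k.succ) (fun m => b m - 1)
      (fun m => Nat.sub_le_of_le_add (hb m))
      (fun k m => by rw [hB, Fin.val_succ]; omega)
      (fun k m => by
        have h0 : m ∈ A ∩ B 0 ↔ m ∈ A ∧ 0 < b m := by rw [Finset.mem_inter, hB, Fin.val_zero]
        rw [hD, Fin.val_succ]
        simp only [h0]
        by_cases h : m ∈ A <;> by_cases h' : 0 < b m <;> simp only [h, h', and_self,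
          and_false, false_and, if_true, if_false] <;> omega)
      (h𝒢.inter _ _ hgA (hgB 0)) (fun k => hgB _)
    have hgD0 : 𝒢 (D 0) := hD0 ▸ h𝒢.union _ _ hgA (hgB 0)
    refine ⟨Fin.cases hgD0 hgD, ?_⟩
    exact h1.trans (h2.trans (h3.trans (h4.trans (((pairIso_orEnd_of_eq hD0).prodMap h5).trans
      (PairIso.lmap_fin_succ fun k => orEnd (D k)).symm))))

/-- Insertion sort: sort the sets after the first one, then insert the first. Membership in `𝒢`
survives, since only unions and intersections are formed. -/
lemma pairIso_chain_fin (n : ℕ) (A : Fin n → Finset ℕ+) (B : Fin n → Finset ℕ+)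
    (hB : ∀ k m, m ∈ B k ↔ (k : ℕ) < (Finset.univ.filter fun i => m ∈ A i).card)
    (hgA : ∀ k, 𝒢 (A k)) :
    (∀ k, 𝒢 (B k)) ∧ PairIso (DirectSum.lmap fun k => orEnd (A k))
      (DirectSum.lmap fun k => orEnd (B k)) := by
  induction n with
  | zero => exact ⟨fun k => k.elim0, PairIso.lmap_congr fun k => k.elim0⟩
  | succ n ih =>
    let b : ℕ+ → ℕ := fun m => (Finset.univ.filter fun i : Fin n => m ∈ A i.succ).card
    let B' : Fin n → Finset ℕ+ := fun k =>
      (Finset.univ.biUnion fun i : Fin n => A i.succ).filter fun m => (k : ℕ) < b m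
    have hB' : ∀ k m, m ∈ B' k ↔ (k : ℕ) < b m := by
      intro k m
      simp only [B', Finset.mem_filter, Finset.mem_biUnion, Finset.mem_univ, true_and,
        and_iff_right_iff_imp]
      intro h
      obtain ⟨i, hi⟩ := Finset.card_pos.1 (Nat.zero_lt_of_lt h)
      exact ⟨i, (Finset.mem_filter.1 hi).2⟩
    obtain ⟨h1, h2⟩ := ih (fun k => A k.succ) B' hB' fun k => hgA _
    have hcount : ∀ m, (Finset.univ.filter fun i => m ∈ A i).card =
        b m + if m ∈ A 0 then 1 else 0 := fun m => by
      rw [Finset.card_filter, Fin.sum_univ_succ, ← Finset.card_filter, add_comm]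
    obtain ⟨h3, h4⟩ := pairIso_insert_chain h𝒢 n (A 0) B' B b
      (fun m => (Finset.card_filter_le _ _).trans (by simp)) hB'
      (fun k m => by rw [hB, hcount]) (hgA 0) h1
    exact ⟨h3, (PairIso.lmap_fin_succ fun k => orEnd (A k)).trans
      (((PairIso.refl _).prodMap h2).trans h4)⟩

omit h𝒢 in
-- The block of the empty set is `ℤ[t] / (1) = 0`, so empty sets at the end of a chain do not
-- matter.
lemma pairIso_chain_drop (B : ℕ → Finset ℕ+) (l d : ℕ) (hB : ∀ k, l ≤ k → B k = ∅) :
    PairIso (DirectSum.lmap fun k : Fin (l + d) => orEnd (B k))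
      (DirectSum.lmap fun k : Fin l => orEnd (B k)) := by
  induction d with
  | zero => exact PairIso.refl _
  | succ d ih =>
    refine (PairIso.lmap_fin_last (n := l + d) fun k => orEnd (B k)).trans
      (PairIso.trans ?_ ih)
    have : Subsingleton (OrBlock (B (Fin.last (l + d)))) := by
      have h : Module.finrank ℤ (OrBlock (B (Fin.last (l + d)))) = 0 := by
        rw [finrank_adjoinRoot (orPoly_monic _), hB _ (by simp), orPoly, Finset.prod_empty,
          natDegree_one]
      exact (Module.finrank_eq_zero_iff_of_free ℤ _).1 h
    exact PairIso.prod_of_subsingleton _ _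

/-- A direct sum of blocks for unlinked sets is the direct sum for the chain of the sets of the
elements which are in at least `k` of the given sets. -/
theorem pairIso_chain {ι : Type*} [Fintype ι] (A : ι → Finset ℕ+) (hgA : ∀ i, 𝒢 (A i)) (l : ℕ)
    (B : ℕ → Finset ℕ+)
    (hB : ∀ k m, m ∈ B k ↔ k < (Finset.univ.filter fun i => m ∈ A i).card)
    (hl : ∀ k, l ≤ k → B k = ∅) :
    PairIso (DirectSum.lmap fun i => orEnd (A i)) (DirectSum.lmap fun k : Fin l => orEnd (B k)) := by
  let e := Fintype.equivFin ι
  have h1 := PairIso.lmap_reindex (fun i => orEnd (A i)) e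
  have h2 := (pairIso_chain_fin h𝒢 _ (fun k => A (e.symm k)) (fun k => B k) (fun k m => by
    rw [hB]
    have : (Finset.univ.filter fun i => m ∈ A i).card =
        (Finset.univ.filter fun i => m ∈ A (e.symm i)).card := by
      rw [Finset.card_filter, Finset.card_filter]
      exact Fintype.sum_equiv e _ _ fun i => by simp
    rw [this]) fun k => hgA _).2
  have h3 : ∀ k, Fintype.card ι ≤ k → B k = ∅ := fun k hk => by
    rw [Finset.eq_empty_iff_forall_notMem]
    intro m hm
    rw [hB] at hm
    exact absurd (hm.trans_le (Finset.card_filter_le _ _)) (not_lt.2 hk)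
  have h4 := pairIso_chain_drop B (Fintype.card ι) l h3
  have h5 := pairIso_chain_drop B l (Fintype.card ι) hl
  rw [add_comm] at h5
  exact h1.trans (h2.trans (h4.symm.trans h5))

end Regroup


/-! ### Excellent orders, the quadrant and its upper sets -/

section Orders

lemma ExcellentOrder.succ_iff (o : ExcellentOrder) (a b : ℕ) :
    o.succ a b ↔ a ≤ o.s ∧ b ≤ o.s ∧ LevelRel o.S a b := by
  have h1 := o.le_bound a b
  have h2 := o.irrefl
  have h3 := o.trans
  have h4 := o.trichotomous
  have h5 := o.eq_gt a b
  have h6 := o.eq_lt a b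
  have h7 := h3 a b 0
  have h8 := h3 b 0 a
  have h9 := h3 a 0 b
  have h10 := h4 b 0
  have h11 := h3 b a 0
  simp only [LevelRel, ExcellentOrder.S, Set.mem_ofPred_eq]
  grind

lemma ExcellentOrder.tensor_S (o₁ o₂ : ExcellentOrder) : (o₁.tensor o₂).S = symmDiff o₁.S o₂.S := by
  have h : (o₁.tensor o₂).S = (o₁.S ∪ o₂.S) \ (o₁.S ∩ o₂.S) := ExcellentOrder.S_ofSet _ _ _
  rw [h]
  ext k
  simp only [Set.mem_symmDiff, Set.mem_sdiff, Set.mem_union, Set.mem_inter_iff]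
  tauto

variable {P : Finset Nat.Primes}

lemma factorization_prod_primes (k : P → ℕ) (q : Nat.Primes) :
    (∏ p : P, (p.1 : ℕ) ^ k p).factorization q = if h : q ∈ P then k ⟨q, h⟩ else 0 := by
  rw [Nat.factorization_prod fun p _ => pow_ne_zero _ p.1.2.ne_zero, Finsupp.finsetSum_apply]
  have h : ∀ p : P, ((p.1 : ℕ) ^ k p).factorization q = if (p : Nat.Primes) = q then k p else 0 := by
    intro p
    rw [p.1.2.factorization_pow, Finsupp.single_apply]
    simp only [Nat.Primes.coe_nat_inj]
  simp only [h]
  split_ifs with hq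
  · rw [Finset.sum_eq_single ⟨q, hq⟩]
    · simp
    · intro p _ hp
      rw [if_neg]
      rintro rfl
      exact hp rfl
    · simp
  · refine Finset.sum_eq_zero fun p _ => ?_
    rw [if_neg]
    rintro rfl
    exact hq p.2

lemma mem_quadrant_iff (o : P → ExcellentOrder) (m : ℕ+) :
    m ∈ quadrant o ↔ ∀ q : Nat.Primes, val q m ≤ if h : q ∈ P then (o ⟨q, h⟩).s else 0 := by
  constructor
  · rintro ⟨k, hk, hm⟩ q
    rw [val, hm, factorization_prod_primes]
    split_ifs with h
    · exact hk _
    · exact le_rfl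
  · intro h
    refine ⟨fun p => val p.1 m, fun p => ?_, ?_⟩
    · have := h p.1
      rwa [dif_pos p.2] at this
    · refine Nat.eq_of_factorization_eq m.ne_zero
        (Finset.prod_ne_zero_iff.2 fun p _ => pow_ne_zero _ p.1.2.ne_zero) fun q => ?_
      by_cases hq : q.Prime
      · have h1 := factorization_prod_primes (fun p : P => val p.1 m) ⟨q, hq⟩
        change _ = (∏ p : P, (p.1 : ℕ) ^ val p.1 m).factorization ((⟨q, hq⟩ : Nat.Primes) : ℕ)
        rw [h1]
        split_ifs with hP
        · rfl
        · have := h ⟨q, hq⟩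
          rw [dif_neg hP] at this
          exact Nat.le_zero.1 this
      · rw [Nat.factorization_eq_zero_of_not_prime _ hq, Nat.factorization_eq_zero_of_not_prime _ hq]

lemma val_le_of_mem_quadrant {o : P → ExcellentOrder} {m : ℕ+} (h : m ∈ quadrant o) (p : P) :
    val p.1 m ≤ (o p).s := by
  have := (mem_quadrant_iff o m).1 h p.1
  rwa [dif_pos p.2] at this

lemma val_eq_zero_of_mem_quadrant {o : P → ExcellentOrder} {m : ℕ+} (h : m ∈ quadrant o)
    {q : Nat.Primes} (hq : q ∉ P) : val q m = 0 := by
  have := (mem_quadrant_iff o m).1 h q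
  rw [dif_neg hq] at this
  exact Nat.le_zero.1 this

/-- The largest element of the quadrant. -/
def quadrantTop (o : P → ExcellentOrder) : ℕ := ∏ p : P, (p.1 : ℕ) ^ (o p).s

lemma quadrantTop_ne_zero (o : P → ExcellentOrder) : quadrantTop o ≠ 0 :=
  Finset.prod_ne_zero_iff.2 fun p _ => pow_ne_zero _ p.1.2.ne_zero

lemma mem_quadrant_iff_dvd (o : P → ExcellentOrder) (m : ℕ+) :
    m ∈ quadrant o ↔ (m : ℕ) ∣ quadrantTop o := by
  rw [mem_quadrant_iff, ← Nat.factorization_le_iff_dvd m.ne_zero (quadrantTop_ne_zero o)]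
  constructor
  · intro h q
    by_cases hq : q.Prime
    · exact (h ⟨q, hq⟩).trans (factorization_prod_primes (fun p => (o p).s) ⟨q, hq⟩).symm.le
    · rw [Nat.factorization_eq_zero_of_not_prime _ hq]
      exact Nat.zero_le _
  · intro h q
    exact (h q).trans (factorization_prod_primes (fun p => (o p).s) q).le

lemma quadrant_subset_tensor (o₁ o₂ : P → ExcellentOrder) :
    quadrant o₁ ⊆ quadrant (fun p => (o₁ p).tensor (o₂ p)) ∧
      quadrant o₂ ⊆ quadrant (fun p => (o₁ p).tensor (o₂ p)) := by
  constructor <;> intro m hm <;> rw [mem_quadrant_iff] at hm ⊢ <;> intro q <;>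
    refine (hm q).trans ?_ <;> split_ifs
  · exact le_max_left _ _
  · exact le_rfl
  · exact le_max_right _ _
  · exact le_rfl

/-- The sets of elements of the quadrant which are upper sets for the edges. -/
structure IsEdgeUpper (o : P → ExcellentOrder) (A : Finset ℕ+) : Prop where
  subset : ∀ m ∈ A, m ∈ quadrant o
  mem : ∀ a b, IsEdge o a b → b ∈ A → a ∈ A

/-- Two quadrant elements with the same `p`-free part are equal or joined by a `p`-edge, because the
order for `p` is total; for `p ∉ P` both exponents vanish and the elements are equal. An edge
between `A \ B` and `B \ A` would contradict that both are upper sets. -/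
lemma isUnlinkedLattice_isEdgeUpper (o : P → ExcellentOrder) :
    IsUnlinkedLattice (IsEdgeUpper o) where
  union A B hA hB :=
    ⟨fun m hm => (Finset.mem_union.1 hm).elim (hA.subset m) (hB.subset m),
      fun a b h hb => Finset.mem_union.2 ((Finset.mem_union.1 hb).imp (hA.mem a b h) (hB.mem a b h))⟩
  inter A B hA hB :=
    ⟨fun m hm => hA.subset m (Finset.mem_inter.1 hm).1,
      fun a b h hb => Finset.mem_inter.2 ⟨hA.mem a b h (Finset.mem_inter.1 hb).1,
        hB.mem a b h (Finset.mem_inter.1 hb).2⟩⟩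
  unlinked A B hA hB a ha b hb p hp hab := by
    rw [Finset.mem_sdiff] at ha hb
    have hqa := hA.subset a ha.1
    have hqb := hB.subset b hb.1
    have hne : val ⟨p, hp⟩ a ≠ val ⟨p, hp⟩ b := fun h => ha.2 (by
      have : a = b := PNat.coe_injective (by
        have h' : (a : ℕ).factorization p = (b : ℕ).factorization p := h
        rw [← Nat.ordProj_mul_ordCompl_eq_self (a : ℕ) p, hab, h', Nat.ordProj_mul_ordCompl_eq_self])
      rw [this]; exact hb.1)
    by_cases hP : (⟨p, hp⟩ : Nat.Primes) ∈ P
    · rcases (o ⟨_, hP⟩).trichotomous _ _ (val_le_of_mem_quadrant hqa ⟨_, hP⟩)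
        (val_le_of_mem_quadrant hqb ⟨_, hP⟩) with h | h | h
      · exact hne h
      · exact ha.2 (hB.mem a b ⟨⟨_, hP⟩, hqa, hqb, hab, h⟩ hb.1)
      · exact hb.2 (hA.mem b a ⟨⟨_, hP⟩, hqb, hqa, hab.symm, h⟩ ha.1)
    · exact hne ((val_eq_zero_of_mem_quadrant hqa hP).trans (val_eq_zero_of_mem_quadrant hqb hP).symm)

lemma val_mul {p : ℕ} (hp : p.Prime) {k c : ℕ} (hc : ¬ p ∣ c) {m : ℕ+} (hm : (m : ℕ) = p ^ k * c) :
    val ⟨p, hp⟩ m = k ∧ proj ⟨p, hp⟩ m = c := by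
  have h0 : c ≠ 0 := by rintro rfl; exact hc (dvd_zero p)
  have h1 : (m : ℕ).factorization p = k := by
    rw [hm, Nat.factorization_mul (pow_ne_zero _ hp.ne_zero) h0, Finsupp.add_apply,
      hp.factorization_pow, Finsupp.single_eq_same, Nat.factorization_eq_zero_of_not_dvd hc, add_zero]
  refine ⟨h1, ?_⟩
  change (m : ℕ) / p ^ (m : ℕ).factorization p = c
  rw [h1, hm, Nat.mul_div_cancel_left _ (pow_pos hp.pos k)]

lemma mem_coverSet {χ : ℕ+ →₀ ℕ} {j : ℕ} {m : ℕ+} : m ∈ coverSet χ (j + 1) ↔ j < χ m := by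
  rw [coverSet, Finset.mem_filter, Finsupp.mem_support_iff]
  omega

lemma exists_of_mem_natSet {M : Finset ℕ+} {d : ℕ} (h : d ∈ natSet M) : ∃ m : ℕ+, m ∈ M ∧ (m : ℕ) = d := by
  obtain ⟨m, hm, h⟩ := Finset.mem_map.1 h
  exact ⟨m, hm, h⟩

/-- The sets of the standard covering are upper sets along each prime. -/
lemma IsCompatible.isUpperAlong {χ : ℕ+ →₀ ℕ} {o : P → ExcellentOrder} (h : IsCompatible χ o)
    (p : P) {s : ℕ} (j : ℕ) : IsUpperAlong p.1 s (o p).S (natSet (coverSet χ (j + 1))) := by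
  intro c hc
  refine ⟨fun k hk => hk.1, fun i i' hi hi' hii' => ⟨hi, ?_⟩⟩
  obtain ⟨-, hi'⟩ := hi'
  obtain ⟨m, hm, hmc⟩ := exists_of_mem_natSet hi'
  rw [mem_coverSet] at hm
  have hc0 : 0 < c := Nat.pos_of_ne_zero (by rintro rfl; exact hc (dvd_zero _))
  let m' : ℕ+ := ⟨p.1 ^ i * c, Nat.mul_pos (pow_pos p.1.2.pos i) hc0⟩
  obtain ⟨hv, hπ⟩ := val_mul p.1.2 hc hmc
  obtain ⟨hv', hπ'⟩ := val_mul p.1.2 hc (m := m') rfl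
  have hq : m ∈ quadrant o := h.support_subset (Finsupp.mem_support_iff.2 (by omega))
  have hi's : i' ≤ (o p).s := hv ▸ val_le_of_mem_quadrant hq p
  -- The exponent `i` is within the bound although `s` is arbitrary: a predecessor in the order is
  -- either in `S` or smaller than `i'`.
  have his : i ≤ (o p).s := by
    rcases hii' with h | h | h
    · exact h.1.1
    · exact h.1.1
    · omega
  have hq' : m' ∈ quadrant o := by
    rw [mem_quadrant_iff_dvd] at hq ⊢
    have hcop : (p.1 ^ i : ℕ).Coprime c := Nat.Coprime.pow_left _ ((p.1.2.coprime_iff_not_dvd).2 hc)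
    refine hcop.mul_dvd_of_dvd_of_dvd ?_ ((Dvd.intro_left _ rfl).trans (hmc ▸ hq))
    exact (pow_dvd_pow _ his).trans
      (Finset.dvd_prod_of_mem (fun p : P => (p.1 : ℕ) ^ (o p).s) (Finset.mem_univ p))
  have hedge : IsEdge o m' m := ⟨p, hq', hq, hπ'.trans hπ.symm, by
    have e1 : val p.1 m' = i := hv'
    have e2 : val p.1 m = i' := hv
    rw [e1, e2, ExcellentOrder.succ_iff]
    exact ⟨his, hi's, hii'⟩⟩
  exact mem_natSet (m := m').2 (mem_coverSet.2 (hm.trans_le (h.mono _ _ hedge)))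

end Orders


/-! ### Representation counts as functions of the order, and their monotonicity -/

section OrderCount

variable {n : ℕ} [NeZero n]

lemma exists_unit_mul_eq {z z' : ZMod n} (h : addOrderOf z = addOrderOf z') :
    ∃ u : (ZMod n)ˣ, u * z = z' := by
  have hn : n ≠ 0 := NeZero.ne n
  -- Every element of `ZMod n` is a unit times `n / ord z`, so elements of equal order differ by a
  -- unit.
  have key : ∀ z : ZMod n, ∃ u : (ZMod n)ˣ, z = u * ((n / addOrderOf z : ℕ) : ZMod n) := by
    intro z
    obtain ⟨d, hd, _, ⟨u, rfl⟩, rfl⟩ := z.eq_unit_mul_divisor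
    refine ⟨u, ?_⟩
    have h1 : addOrderOf ((u : ZMod n) * (d : ZMod n)) = addOrderOf (d : ZMod n) :=
      AddEquiv.addOrderOf_eq (AddAut.mulLeft u |>.toAdd) (d : ZMod n)
    rw [h1, ZMod.addOrderOf_coe _ hn, Nat.gcd_eq_right hd, Nat.div_div_self hd hn]
  obtain ⟨u, hu⟩ := key z
  obtain ⟨u', hu'⟩ := key z'
  rw [← h] at hu'
  generalize ((n / addOrderOf z : ℕ) : ZMod n) = w at hu hu'
  exact ⟨u' * u⁻¹, by rw [hu, hu', Units.val_mul, mul_assoc, Units.inv_mul_cancel_left]⟩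

lemma orderCount_eq_of_addOrderOf_eq (D D' : Finset ℕ) {z z' : ZMod n}
    (h : addOrderOf z = addOrderOf z') : orderCount n D D' z = orderCount n D D' z' := by
  obtain ⟨u, rfl⟩ := exists_unit_mul_eq h
  exact (sumCount_orderSet_equiv (AddAut.mulLeft u |>.toAdd) D D' z).symm

lemma orderCount_le (D D' : Finset ℕ) (z : ZMod n) : orderCount n D D' z ≤ n := by
  refine (sumCount_le _ _ z).trans ((Finset.card_le_univ _).trans_eq (ZMod.card n))

/-- The Chinese remainder theorem splits off the `p`-part. The count is then a sum over the second
coordinate of counts for level sets in `ZMod (p ^ s)`, compared term by term by `sumCountMono`. -/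
lemma orderCount_mono_mul {p s n : ℕ} [hp : Fact p.Prime] [NeZero (p ^ s * n)] (hpn : ¬ p ∣ n)
    {S S' : Set ℕ} {D D' : Finset ℕ} (hS : IsUpperAlong p s S D) (hS' : IsUpperAlong p s S' D')
    {z z' : ZMod (p ^ s * n)} (hc : ordCompl[p] (addOrderOf z) = ordCompl[p] (addOrderOf z'))
    (hk : LevelRel (symmDiff S S') ((addOrderOf z).factorization p)
      ((addOrderOf z').factorization p)) :
    orderCount (p ^ s * n) D D' z' ≤ orderCount (p ^ s * n) D D' z := by
  have : NeZero n := ⟨fun h => hpn (h ▸ dvd_zero p)⟩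
  have hcop : (p ^ s).Coprime n := Nat.Coprime.pow_left _ ((hp.out.coprime_iff_not_dvd).2 hpn)
  let e : ZMod (p ^ s * n) ≃+ ZMod (p ^ s) × ZMod n := (ZMod.chineseRemainder hcop).toAddEquiv
  have hz : ∀ w : ZMod n, ¬ p ∣ addOrderOf w := fun w h => hpn (h.trans (by
    simpa using addOrderOf_dvd_natCard w))
  have hord : ∀ x, ordCompl[p] (addOrderOf x) = addOrderOf (e x).2 ∧
      (addOrderOf x).factorization p = level p s (e x).1 := by
    intro x
    have h1 : addOrderOf x = p ^ level p s (e x).1 * addOrderOf (e x).2 := by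
      rw [← addOrderOf_mk_zmod hpn, Prod.mk.eta, AddEquiv.addOrderOf_eq]
    have h2 : (addOrderOf x).factorization p = level p s (e x).1 := by
      rw [h1, Nat.factorization_mul (pow_ne_zero _ hp.out.ne_zero) (addOrderOf_pos _).ne',
        Finsupp.add_apply, hp.out.factorization_pow, Finsupp.single_eq_same,
        Nat.factorization_eq_zero_of_not_dvd (hz _), add_zero]
    refine ⟨?_, h2⟩
    rw [h2, h1, Nat.mul_div_cancel_left _ (pow_pos hp.out.pos _)]
  obtain ⟨h1, h2⟩ := hord z
  obtain ⟨h1', h2'⟩ := hord z'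
  -- `z'` may be replaced by an element of the same order whose prime-to-`p` coordinate is that of
  -- `z`, so that the two sums run over the same slices.
  have heq : orderCount (p ^ s * n) D D' z' =
      orderCount (p ^ s * n) D D' (e.symm ((e z').1, (e z).2)) := by
    refine orderCount_eq_of_addOrderOf_eq D D' ?_
    rw [AddEquiv.addOrderOf_eq, addOrderOf_mk_zmod hpn, ← h1, hc, h1', ← addOrderOf_mk_zmod hpn,
      Prod.mk.eta, AddEquiv.addOrderOf_eq]
  rw [heq, orderCount, orderCount, ← sumCount_orderSet_equiv e, ← sumCount_orderSet_equiv e D D' z,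
    e.apply_symm_apply, ← Prod.mk.eta (p := e z), sumCount_prod, sumCount_prod]
  refine Finset.sum_le_sum fun w _ => ?_
  rw [orderSlice_zmod hpn, orderSlice_zmod hpn]
  refine sumCountMono S S' s _ _ (hS _ (hz _)) (hS' _ (hz _)) _ _ (level_le _) (level_le _) ?_
  rwa [← h2, ← h2']

lemma exists_eq_pow_mul (p : ℕ) (hp : p.Prime) (n : ℕ) (hn : n ≠ 0) :
    ∃ m, ¬ p ∣ m ∧ n = p ^ n.factorization p * m :=
  ⟨ordCompl[p] n, Nat.not_dvd_ordCompl hp hn, (Nat.ordProj_mul_ordCompl_eq_self n p).symm⟩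

lemma orderCount_mono {p : ℕ} (hp : p.Prime) {S S' : Set ℕ} {D D' : Finset ℕ}
    (hS : IsUpperAlong p (n.factorization p) S D) (hS' : IsUpperAlong p (n.factorization p) S' D')
    {z z' : ZMod n} (hc : ordCompl[p] (addOrderOf z) = ordCompl[p] (addOrderOf z'))
    (hk : LevelRel (symmDiff S S') ((addOrderOf z).factorization p)
      ((addOrderOf z').factorization p)) : orderCount n D D' z' ≤ orderCount n D D' z := by
  have := Fact.mk hp
  obtain ⟨m, hm, h⟩ := exists_eq_pow_mul p hp n (NeZero.ne n)
  generalize n.factorization p = s at *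
  subst h
  exact orderCount_mono_mul hm hS hS' hc hk

lemma fieldLayers_primeClosure {p : ℕ} (hp : p.Prime) {S S' : Set ℕ} {D D' : Finset ℕ}
    (hD : ∀ d ∈ D, d ∣ n) (hD' : ∀ d ∈ D', d ∣ n)
    (hS : IsUpperAlong p (n.factorization p) S D)
    (hS' : IsUpperAlong p (n.factorization p) S' D') :
    FieldLayers (PrimeClosure p hp) n D D' := by
  have := Fact.mk hp
  obtain ⟨m, hm, h⟩ := exists_eq_pow_mul p hp n (NeZero.ne n)
  generalize n.factorization p = s at *
  subst h
  exact fieldLayers_charP _ hm hD hD' hS hS'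

end OrderCount

/-! ### Layers and the convolution of two functions of the order -/

section Layers

variable {n : ℕ} [NeZero n]

/-- The order of an element of `ZMod n`, as a positive number. -/
noncomputable def pnatOrder (z : ZMod n) : ℕ+ := ⟨addOrderOf z, addOrderOf_pos z⟩

lemma exists_pnatOrder_eq {m : ℕ+} (h : (m : ℕ) ∣ n) : ∃ z : ZMod n, pnatOrder z = m := by
  obtain ⟨z, hz⟩ := exists_addOrderOf_eq h
  exact ⟨z, PNat.eq hz⟩

lemma pnatOrder_dvd (z : ZMod n) : (pnatOrder z : ℕ) ∣ n := by
  have := addOrderOf_dvd_natCard z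
  rwa [Nat.card_zmod] at this

/-- The set of orders of the elements with more than `k` representations. -/
noncomputable def layerSet (n : ℕ) [NeZero n] (D D' : Finset ℕ) (k : ℕ) : Finset ℕ+ :=
  (Finset.univ.filter fun z : ZMod n => k < orderCount n D D' z).image pnatOrder

lemma pnatOrder_mem_layerSet {D D' : Finset ℕ} {k : ℕ} {z : ZMod n} :
    pnatOrder z ∈ layerSet n D D' k ↔ k < orderCount n D D' z := by
  rw [layerSet, Finset.mem_image]
  constructor
  · rintro ⟨z', hz', h⟩
    rw [← orderCount_eq_of_addOrderOf_eq D D' (congrArg PNat.val h : addOrderOf z' = addOrderOf z)]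
    exact (Finset.mem_filter.1 hz').2
  · exact fun h => ⟨z, Finset.mem_filter.2 ⟨Finset.mem_univ _, h⟩, rfl⟩

lemma dvd_of_mem_layerSet {D D' : Finset ℕ} {k : ℕ} {m : ℕ+} (h : m ∈ layerSet n D D' k) :
    (m : ℕ) ∣ n := by
  obtain ⟨z, -, rfl⟩ := Finset.mem_image.1 h
  exact pnatOrder_dvd z

/-- The convolution of two functions of the order. -/
noncomputable def orderConv (n : ℕ) [NeZero n] (χ₁ χ₂ : ℕ+ →₀ ℕ) (z : ZMod n) : ℕ :=
  ∑ z₁ : ZMod n, χ₁ (pnatOrder z₁) * χ₂ (pnatOrder (z - z₁))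

lemma le_coverLength (χ : ℕ+ →₀ ℕ) (m : ℕ+) : χ m ≤ coverLength χ := by
  by_cases h : m ∈ χ.support
  · exact Finset.le_sup (f := χ) h
  · rw [Finsupp.notMem_support_iff.1 h]
    exact Nat.zero_le _

lemma card_filter_fin_lt {a l : ℕ} (h : a ≤ l) :
    (Finset.univ.filter fun i : Fin l => (i : ℕ) < a).card = a := by
  rw [Finset.card_filter, Fin.sum_univ_eq_sum_range (fun j => if j < a then 1 else 0) l,
    ← Finset.card_filter]
  have : (Finset.range l).filter (fun j => j < a) = Finset.range a := by
    ext j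
    simp only [Finset.mem_filter, Finset.mem_range]
    omega
  rw [this, Finset.card_range]

/-- Each `χ` is the sum of the indicators of its covering sets; expand the product in the
convolution. -/
lemma orderConv_eq_sum (χ₁ χ₂ : ℕ+ →₀ ℕ) (z : ZMod n) :
    orderConv n χ₁ χ₂ z = ∑ i : Fin (coverLength χ₁) × Fin (coverLength χ₂),
      orderCount n (natSet (coverSet χ₁ (i.1 + 1))) (natSet (coverSet χ₂ (i.2 + 1))) z := by
  have hmem : ∀ (χ : ℕ+ →₀ ℕ) (j : ℕ) (z : ZMod n),
      z ∈ orderSet (ZMod n) (natSet (coverSet χ (j + 1))) ↔ j < χ (pnatOrder z) := by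
    intro χ j z
    rw [mem_orderSet]
    exact (mem_natSet (m := pnatOrder z)).trans mem_coverSet
  have h : ∀ i : Fin (coverLength χ₁) × Fin (coverLength χ₂),
      orderCount n (natSet (coverSet χ₁ (i.1 + 1))) (natSet (coverSet χ₂ (i.2 + 1))) z =
      ∑ z₁, if (i.1 : ℕ) < χ₁ (pnatOrder z₁) ∧ (i.2 : ℕ) < χ₂ (pnatOrder (z - z₁)) then 1 else 0 := by
    intro i
    rw [orderCount, sumCount, ← Finset.card_filter]
    congr 1
    ext z₁
    simp only [Finset.mem_filter, hmem, Finset.mem_univ, true_and]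
  rw [Finset.sum_congr rfl fun i _ => h i, Finset.sum_comm]
  refine Finset.sum_congr rfl fun z₁ _ => ?_
  rw [← Finset.card_filter, ← Finset.univ_product_univ,
    Finset.filter_product (fun i : Fin (coverLength χ₁) => (i : ℕ) < χ₁ (pnatOrder z₁))
      (fun i : Fin (coverLength χ₂) => (i : ℕ) < χ₂ (pnatOrder (z - z₁))), Finset.card_product,
    card_filter_fin_lt (le_coverLength _ _), card_filter_fin_lt (le_coverLength _ _)]

lemma orderConv_eq_of_pnatOrder_eq (χ₁ χ₂ : ℕ+ →₀ ℕ) {z z' : ZMod n}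
    (h : pnatOrder z = pnatOrder z') : orderConv n χ₁ χ₂ z = orderConv n χ₁ χ₂ z' := by
  rw [orderConv_eq_sum, orderConv_eq_sum]
  exact Finset.sum_congr rfl fun i _ => orderCount_eq_of_addOrderOf_eq _ _ (congrArg PNat.val h)

/-- The function on the divisors of `n` which is given by the convolution of two functions. -/
noncomputable def convFinsupp (n : ℕ) [NeZero n] (χ₁ χ₂ : ℕ+ →₀ ℕ) : ℕ+ →₀ ℕ :=
  open Classical in
  Finsupp.onFinset (Finset.univ.image (pnatOrder : ZMod n → ℕ+))
    (fun m => if h : ∃ z : ZMod n, pnatOrder z = m then orderConv n χ₁ χ₂ h.choose else 0) (by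
      intro m hm
      split_ifs at hm with h
      · obtain ⟨z, hz⟩ := h
        exact Finset.mem_image.2 ⟨z, Finset.mem_univ _, hz⟩
      · exact absurd rfl hm)

lemma convFinsupp_pnatOrder (χ₁ χ₂ : ℕ+ →₀ ℕ) (z : ZMod n) :
    convFinsupp n χ₁ χ₂ (pnatOrder z) = orderConv n χ₁ χ₂ z := by
  have h : ∃ z' : ZMod n, pnatOrder z' = pnatOrder z := ⟨z, rfl⟩
  rw [convFinsupp, Finsupp.onFinset_apply, dif_pos h]
  exact orderConv_eq_of_pnatOrder_eq _ _ h.choose_spec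

lemma dvd_of_convFinsupp_ne_zero {χ₁ χ₂ : ℕ+ →₀ ℕ} {m : ℕ+} (h : convFinsupp n χ₁ χ₂ m ≠ 0) :
    (m : ℕ) ∣ n := by
  rw [convFinsupp, Finsupp.onFinset_apply] at h
  split_ifs at h with h'
  · obtain ⟨z, rfl⟩ := h'
    exact pnatOrder_dvd z
  · exact absurd rfl h

end Layers


/-! ### Products of cyclotomic polynomials and their tensor product -/

section Products

lemma cycloProd_eq_rootProd {n : ℕ} [NeZero n] {ω : ℂ} (hω : IsPrimitiveRoot ω n) {χ : ℕ+ →₀ ℕ}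
    (hχ : ∀ m, χ m ≠ 0 → (m : ℕ) ∣ n) :
    cycloProd χ = rootProd (powChar ω) fun z : ZMod n => χ (pnatOrder z) := by
  have h : ∀ m ∈ χ.support, cyclotomic (m : ℕ) ℂ ^ χ m =
      rootProd (powChar ω) fun z : ZMod n => (if pnatOrder z = m then 1 else 0) * χ m := by
    intro m hm
    rw [cyclotomic_eq_rootProd hω (hχ m (Finsupp.mem_support_iff.1 hm)), rootProd_pow]
    congr 1
    funext z
    have : pnatOrder z = m ↔ addOrderOf z = m := PNat.coe_inj.symm
    simp only [this]
  rw [cycloProd, Finsupp.prod, Finset.prod_congr rfl h, rootProd_prod]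
  congr 1
  funext z
  simp only [ite_mul, one_mul, zero_mul]
  rw [Finset.sum_ite_eq]
  split_ifs with hz
  · rfl
  · exact (Finsupp.notMem_support_iff.1 hz).symm

variable {K Z : Type*} [Fintype Z]

lemma prod_map_sum_nsmul_singleton {R : Type*} [CommMonoid R] (ψ : Z → K) (a : Z → ℕ) (f : K → R) :
    ((∑ z, a z • ({ψ z} : Multiset K)).map f).prod = ∏ z, f (ψ z) ^ a z := by
  rw [← Multiset.coe_mapAddMonoidHom, map_sum, Multiset.prod_sum]
  simp [Multiset.map_nsmul, Multiset.prod_nsmul]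

variable [Field K]

lemma roots_rootProd (ψ : Z → K) (a : Z → ℕ) :
    (rootProd ψ a).roots = ∑ z, a z • ({ψ z} : Multiset K) := by
  rw [rootProd, roots_prod _ _ (rootProd_monic ψ a).ne_zero]
  simp only [roots_pow, roots_X_sub_C]
  rfl

lemma rootProd_injective {ψ : Z → K} (hψ : Function.Injective ψ) :
    Function.Injective (rootProd ψ) := by
  classical
  intro a b h
  have key : ∀ (a : Z → ℕ) z, (rootProd ψ a).roots.count (ψ z) = a z := by
    intro a z
    rw [roots_rootProd, Multiset.count_sum']
    simp only [Multiset.count_nsmul, Multiset.count_singleton, hψ.eq_iff]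
    simp
  funext z
  rw [← key a, h, key]

lemma polyTensor_rootProd {n : ℕ} [NeZero n] {ω : ℂ} (hω : IsPrimitiveRoot ω n) (a b : ZMod n → ℕ) :
    polyTensor (rootProd (powChar ω) a) (rootProd (powChar ω) b) =
      rootProd (powChar ω) fun z => ∑ z₁, a z₁ * b (z - z₁) := by
  rw [polyTensor, roots_rootProd, roots_rootProd, Multiset.prod_map_product_eq_prod_prod]
  simp only [prod_map_sum_nsmul_singleton, ← powChar_add hω]
  rw [rootProd]
  simp only [← Finset.prod_pow_eq_pow_sum, ← Finset.prod_pow, ← pow_mul]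
  rw [Finset.prod_comm (s := Finset.univ) (t := Finset.univ)
    (f := fun z z₁ => (X - C (powChar ω z)) ^ (a z₁ * b (z - z₁)))]
  refine Finset.prod_congr rfl fun z _ => ?_
  refine Fintype.prod_equiv (Equiv.addLeft z) _ _ fun w => ?_
  simp [mul_comm]

/-- For a common multiple `n` of the two supports, root multiplicities recover the values of `χ` at
all divisors of `n`; elsewhere both functions vanish. -/
lemma cycloProd_injective : Function.Injective cycloProd := by
  intro χ χ' h
  have hn : ∏ m ∈ χ.support ∪ χ'.support, (m : ℕ) ≠ 0 :=
    Finset.prod_ne_zero_iff.2 fun m _ => m.ne_zero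
  have hdvd : ∀ m ∈ χ.support ∪ χ'.support, (m : ℕ) ∣ ∏ m ∈ χ.support ∪ χ'.support, (m : ℕ) :=
    fun m hm => Finset.dvd_prod_of_mem (fun m : ℕ+ => (m : ℕ)) hm
  generalize ∏ m ∈ χ.support ∪ χ'.support, (m : ℕ) = n at hn hdvd
  have : NeZero n := ⟨hn⟩
  have hχ : ∀ m, χ m ≠ 0 → (m : ℕ) ∣ n := fun m hm =>
    hdvd m (Finset.mem_union_left _ (Finsupp.mem_support_iff.2 hm))
  have hχ' : ∀ m, χ' m ≠ 0 → (m : ℕ) ∣ n := fun m hm =>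
    hdvd m (Finset.mem_union_right _ (Finsupp.mem_support_iff.2 hm))
  have hω := Complex.isPrimitiveRoot_exp n hn
  rw [cycloProd_eq_rootProd hω hχ, cycloProd_eq_rootProd hω hχ'] at h
  have h' := rootProd_injective (powChar_injective hω) h
  ext m
  by_cases hm : (m : ℕ) ∣ n
  · obtain ⟨z, rfl⟩ := exists_pnatOrder_eq hm
    exact congrFun h' z
  · rw [not_imp_comm.1 (hχ m) hm, not_imp_comm.1 (hχ' m) hm]

lemma polyTensor_cycloProd {n : ℕ} [NeZero n] {χ₁ χ₂ : ℕ+ →₀ ℕ}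
    (h₁ : ∀ m, χ₁ m ≠ 0 → (m : ℕ) ∣ n) (h₂ : ∀ m, χ₂ m ≠ 0 → (m : ℕ) ∣ n) :
    polyTensor (cycloProd χ₁) (cycloProd χ₂) = cycloProd (convFinsupp n χ₁ χ₂) := by
  have hω := Complex.isPrimitiveRoot_exp n (NeZero.ne n)
  rw [cycloProd_eq_rootProd hω h₁, cycloProd_eq_rootProd hω h₂, polyTensor_rootProd hω,
    cycloProd_eq_rootProd hω fun m => dvd_of_convFinsupp_ne_zero]
  congr 1
  funext z
  rw [convFinsupp_pnatOrder]
  rfl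

end Products

/-! ### Compatibility of the convolution, and assembly of the blocks -/

section Compatible

variable {P : Finset Nat.Primes} {o₁ o₂ : P → ExcellentOrder} {χ₁ χ₂ : ℕ+ →₀ ℕ}

open Classical in
/-- The set which belongs to the excellent order for the prime `q`. -/
noncomputable def primeLevels (o : P → ExcellentOrder) (q : Nat.Primes) : Set ℕ :=
  if h : q ∈ P then (o ⟨q, h⟩).S else ∅

lemma IsCompatible.isUpperAlong_primeLevels {χ : ℕ+ →₀ ℕ} {o o' : P → ExcellentOrder}
    (h : IsCompatible χ o) (q : Nat.Primes) (j : ℕ) :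
    IsUpperAlong q ((quadrantTop o').factorization q) (primeLevels o q)
      (natSet (coverSet χ (j + 1))) := by
  by_cases hq : q ∈ P
  · rw [primeLevels, dif_pos hq]
    exact h.isUpperAlong ⟨q, hq⟩ j
  -- For `q ∉ P` the exponent of `q` in the modulus is `0`, so the only level is `0` and the
  -- condition is trivial.
  · rw [quadrantTop, factorization_prod_primes, dif_neg hq]
    intro c _
    refine ⟨fun k hk => hk.1, fun i i' hi hi' _ => ?_⟩
    have := hi'.1
    rwa [(by omega : i = i')]

variable (h₁ : IsCompatible χ₁ o₁) (h₂ : IsCompatible χ₂ o₂)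
include h₁ h₂

lemma dvd_quadrantTop_tensor :
    (∀ m, χ₁ m ≠ 0 → (m : ℕ) ∣ quadrantTop fun p => (o₁ p).tensor (o₂ p)) ∧
      ∀ m, χ₂ m ≠ 0 → (m : ℕ) ∣ quadrantTop fun p => (o₁ p).tensor (o₂ p) :=
  ⟨fun m hm => (mem_quadrant_iff_dvd _ m).1 ((quadrant_subset_tensor o₁ o₂).1
      (h₁.support_subset (Finsupp.mem_support_iff.2 hm))),
    fun m hm => (mem_quadrant_iff_dvd _ m).1 ((quadrant_subset_tensor o₁ o₂).2
      (h₂.support_subset (Finsupp.mem_support_iff.2 hm)))⟩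

lemma orderCount_mono_of_isEdge [NeZero (quadrantTop fun p => (o₁ p).tensor (o₂ p))]
    (i j : ℕ) {z z' : ZMod (quadrantTop fun p => (o₁ p).tensor (o₂ p))}
    (h : IsEdge (fun p => (o₁ p).tensor (o₂ p)) (pnatOrder z) (pnatOrder z')) :
    orderCount _ (natSet (coverSet χ₁ (i + 1))) (natSet (coverSet χ₂ (j + 1))) z' ≤
      orderCount _ (natSet (coverSet χ₁ (i + 1))) (natSet (coverSet χ₂ (j + 1))) z := by
  obtain ⟨p, -, -, hproj, hsucc⟩ := h
  refine orderCount_mono p.1.2 (h₁.isUpperAlong_primeLevels p.1 i)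
    (h₂.isUpperAlong_primeLevels p.1 j) hproj ?_
  rw [primeLevels, primeLevels, dif_pos p.2, dif_pos p.2, ← ExcellentOrder.tensor_S]
  exact ((ExcellentOrder.succ_iff _ _ _).1 hsucc).2.2

lemma isCompatible_convFinsupp [NeZero (quadrantTop fun p => (o₁ p).tensor (o₂ p))] :
    IsCompatible (convFinsupp (quadrantTop fun p => (o₁ p).tensor (o₂ p)) χ₁ χ₂)
      fun p => (o₁ p).tensor (o₂ p) where
  support_subset m hm :=
    (mem_quadrant_iff_dvd _ m).2 (dvd_of_convFinsupp_ne_zero (Finsupp.mem_support_iff.1 hm))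
  primesOf_subset := by
    rintro q ⟨m, hm, hq⟩
    by_contra hP
    have := val_eq_zero_of_mem_quadrant ((mem_quadrant_iff_dvd (fun p => (o₁ p).tensor (o₂ p)) m).2
      (dvd_of_convFinsupp_ne_zero (Finsupp.mem_support_iff.1 hm))) hP
    omega
  mono a b hab := by
    obtain ⟨p, ha, hb, h⟩ := hab
    obtain ⟨z, rfl⟩ := exists_pnatOrder_eq ((mem_quadrant_iff_dvd _ a).1 ha)
    obtain ⟨z', rfl⟩ := exists_pnatOrder_eq ((mem_quadrant_iff_dvd _ b).1 hb)
    rw [convFinsupp_pnatOrder, convFinsupp_pnatOrder, orderConv_eq_sum, orderConv_eq_sum]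
    exact Finset.sum_le_sum fun i _ => orderCount_mono_of_isEdge h₁ h₂ i.1 i.2 ⟨p, ha, hb, h⟩

lemma isEdgeUpper_layerSet [NeZero (quadrantTop fun p => (o₁ p).tensor (o₂ p))] (i j k : ℕ) :
    IsEdgeUpper (fun p => (o₁ p).tensor (o₂ p))
      (layerSet (quadrantTop fun p => (o₁ p).tensor (o₂ p)) (natSet (coverSet χ₁ (i + 1)))
        (natSet (coverSet χ₂ (j + 1))) k) where
  subset m hm := (mem_quadrant_iff_dvd _ m).2 (dvd_of_mem_layerSet hm)
  mem a b hab hb := by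
    obtain ⟨p, ha', hb', h⟩ := hab
    obtain ⟨z, rfl⟩ := exists_pnatOrder_eq ((mem_quadrant_iff_dvd _ a).1 ha')
    obtain ⟨z', rfl⟩ := exists_pnatOrder_eq ((mem_quadrant_iff_dvd _ b).1 hb')
    rw [pnatOrder_mem_layerSet] at hb ⊢
    exact hb.trans_le (orderCount_mono_of_isEdge h₁ h₂ i j ⟨p, ha', hb', h⟩)

lemma pairIso_orBlock_tensor_layerSet [NeZero (quadrantTop fun p => (o₁ p).tensor (o₂ p))]
    (i j : ℕ) :
    PairIso (TensorProduct.map (orEnd (coverSet χ₁ (i + 1))) (orEnd (coverSet χ₂ (j + 1))))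
      (DirectSum.lmap fun k : Fin (quadrantTop fun p => (o₁ p).tensor (o₂ p)) =>
        orEnd (layerSet (quadrantTop fun p => (o₁ p).tensor (o₂ p))
          (natSet (coverSet χ₁ (i + 1))) (natSet (coverSet χ₂ (j + 1))) k)) := by
  obtain ⟨hd₁, hd₂⟩ := dvd_quadrantTop_tensor h₁ h₂
  have hM : ∀ d ∈ natSet (coverSet χ₁ (i + 1)), d ∣ quadrantTop fun p => (o₁ p).tensor (o₂ p) := by
    intro d hd
    obtain ⟨m, hm, rfl⟩ := exists_of_mem_natSet hd
    exact hd₁ m (Nat.ne_zero_of_lt (mem_coverSet.1 hm))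
  have hN : ∀ d ∈ natSet (coverSet χ₂ (j + 1)), d ∣ quadrantTop fun p => (o₁ p).tensor (o₂ p) := by
    intro d hd
    obtain ⟨m, hm, rfl⟩ := exists_of_mem_natSet hd
    exact hd₂ m (Nat.ne_zero_of_lt (mem_coverSet.1 hm))
  -- The modulus itself serves as a uniform bound for all counts; the empty layers that this adds
  -- disappear in the regrouping.
  refine pairIso_orBlock_tensor hM hN (fieldLayers_charZero ℂ hM hN)
    (fun p hp => fieldLayers_primeClosure hp hM hN (h₁.isUpperAlong_primeLevels ⟨p, hp⟩ i)
      (h₂.isUpperAlong_primeLevels ⟨p, hp⟩ j)) _ ?_ ?_ _ (orderCount_le _ _)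
  · intro k d hd
    obtain ⟨m, hm, rfl⟩ := exists_of_mem_natSet hd
    exact dvd_of_mem_layerSet hm
  · intro k z
    exact (mem_natSet (m := pnatOrder z)).trans pnatOrder_mem_layerSet

/-- Distribute the tensor product over the sums, decompose each product of two blocks into layers,
and sort all layers. Each `m` lies in exactly `χ₃(m)` layers, so the sorted chain is the standard
covering. -/
theorem pairIso_orSumEnd_tensor [NeZero (quadrantTop fun p => (o₁ p).tensor (o₂ p))] :
    PairIso (TensorProduct.map (orSumEnd χ₁) (orSumEnd χ₂))
      (orSumEnd (convFinsupp (quadrantTop fun p => (o₁ p).tensor (o₂ p)) χ₁ χ₂)) := by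
  set n := quadrantTop fun p => (o₁ p).tensor (o₂ p) with hn
  let L : (i : Fin (coverLength χ₁) × Fin (coverLength χ₂)) → Fin n → Finset ℕ+ := fun i k =>
    layerSet n (natSet (coverSet χ₁ (i.1 + 1))) (natSet (coverSet χ₂ (i.2 + 1))) k
  have h1 := PairIso.tensor_lmap (fun i : Fin (coverLength χ₁) => orEnd (coverSet χ₁ (i + 1)))
    (fun j : Fin (coverLength χ₂) => orEnd (coverSet χ₂ (j + 1)))
  have h2 := PairIso.lmap_congr fun i : Fin (coverLength χ₁) × Fin (coverLength χ₂) =>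
    pairIso_orBlock_tensor_layerSet h₁ h₂ i.1 i.2
  have h3 := PairIso.lmap_sigma fun i k => orEnd (L i k)
  have h4 := pairIso_chain (isUnlinkedLattice_isEdgeUpper fun p => (o₁ p).tensor (o₂ p))
    (fun i : Σ _ : Fin (coverLength χ₁) × Fin (coverLength χ₂), Fin n => L i.1 i.2)
    (fun i => isEdgeUpper_layerSet h₁ h₂ _ _ _) (coverLength (convFinsupp n χ₁ χ₂))
    (fun k => coverSet (convFinsupp n χ₁ χ₂) (k + 1)) ?_ ?_
  · exact h1.trans (h2.trans (h3.trans h4))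
  · intro k m
    rw [mem_coverSet]
    suffices h : convFinsupp n χ₁ χ₂ m = (Finset.univ.filter fun
        i : Σ _ : Fin (coverLength χ₁) × Fin (coverLength χ₂), Fin n => m ∈ L i.1 i.2).card by
      rw [h]
    rw [Finset.card_filter, ← Finset.univ_sigma_univ, Finset.sum_sigma]
    by_cases hm : (m : ℕ) ∣ n
    · obtain ⟨z, rfl⟩ := exists_pnatOrder_eq hm
      rw [convFinsupp_pnatOrder, orderConv_eq_sum]
      refine Finset.sum_congr rfl fun i _ => ?_
      simp only [L, pnatOrder_mem_layerSet]
      rw [← Finset.card_filter, card_filter_fin_lt (orderCount_le _ _ _)]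
    · rw [not_imp_comm.1 dvd_of_convFinsupp_ne_zero hm]
      symm
      refine Finset.sum_eq_zero fun i _ => Finset.sum_eq_zero fun k _ => ?_
      rw [if_neg fun h => hm (dvd_of_mem_layerSet h)]
  · intro k hk
    rw [Finset.eq_empty_iff_forall_notMem]
    intro m hm
    rw [mem_coverSet] at hm
    have := le_coverLength (convFinsupp n χ₁ χ₂) m
    omega

end Compatible


/-! ### Standard decompositions into Orlik blocks -/

section OrlikBlocks

variable {R G H : Type*} [CommRing R] [AddCommGroup G] [Module R G] [AddCommGroup H] [Module R H]
  {g : Module.End R G} {h : Module.End R H}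

lemma PairIso.isOrlikBlock (hgh : PairIso g h) : IsOrlikBlock g → IsOrlikBlock h := by
  obtain ⟨e, he⟩ := hgh
  have hpow : ∀ (n : ℕ) x, e ((g ^ n) x) = (h ^ n) (e x) := by
    intro n
    induction n with
    | zero => exact fun x => rfl
    | succ n ih => exact fun x => by rw [pow_succ, pow_succ, Module.End.mul_apply, ih, he]; rfl
  rintro ⟨⟨hpos, a, b, hb⟩, hfin⟩
  refine ⟨⟨e.finrank_eq ▸ hpos, e a, (b.map e).reindex (finCongr e.finrank_eq), fun j => ?_⟩, ?_⟩
  · rw [Module.Basis.reindex_apply, Module.Basis.map_apply, hb, hpow]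
    rfl
  · obtain ⟨n, hn, hgn⟩ := isOfFinOrder_iff_pow_eq_one.1 hfin
    refine isOfFinOrder_iff_pow_eq_one.2 ⟨n, hn, LinearMap.ext fun y => ?_⟩
    rw [← e.apply_symm_apply y, ← hpow, hgn]
    rfl

lemma PairIso.charpoly_eq [Module.Free R G] [Module.Finite R G] [Module.Free R H]
    [Module.Finite R H] (hgh : PairIso g h) : g.charpoly = h.charpoly := by
  obtain ⟨e, he⟩ := hgh
  rw [← e.charpoly_conj g]
  congr 1
  ext y
  rw [LinearEquiv.conj_apply_apply, he, e.apply_symm_apply]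

lemma isOrlikBlock_orEnd {M : Finset ℕ+} (hM : M.Nonempty) : IsOrlikBlock (orEnd M) := by
  have hmonic := orPoly_monic M
  have hrank : (AdjoinRoot.powerBasis' hmonic).dim = Module.finrank ℤ (OrBlock M) :=
    (finrank_adjoinRoot hmonic).symm
  have hpow : ∀ n : ℕ, orEnd M ^ n = LinearMap.mulLeft ℤ (AdjoinRoot.root (orPoly M) ^ n) :=
    fun n => LinearMap.pow_mulLeft ℤ _ _ n
  refine ⟨⟨?_, 1, (AdjoinRoot.powerBasis' hmonic).basis.reindex (finCongr hrank), fun j => ?_⟩, ?_⟩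
  · obtain ⟨m, hm⟩ := hM
    rw [finrank_adjoinRoot hmonic, orPoly, natDegree_prod_of_monic M (fun m => cyclotomic (m : ℕ) ℤ)
      fun m _ => cyclotomic.monic (m : ℕ) ℤ]
    refine Finset.sum_pos' (fun _ _ => Nat.zero_le _) ⟨m, hm, ?_⟩
    rw [natDegree_cyclotomic]
    exact Nat.totient_pos.2 m.pos
  · rw [Module.Basis.reindex_apply, PowerBasis.basis_eq_pow, hpow, LinearMap.mulLeft_apply, mul_one]
    rfl
  · have hn : ∏ m ∈ M, (m : ℕ) ≠ 0 := Finset.prod_ne_zero_iff.2 fun m _ => m.ne_zero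
    have : NeZero (∏ m ∈ M, (m : ℕ)) := ⟨hn⟩
    refine isOfFinOrder_iff_pow_eq_one.2 ⟨∏ m ∈ M, (m : ℕ), Nat.pos_of_ne_zero hn, ?_⟩
    rw [hpow, root_pow_eq_one, LinearMap.mulLeft_one]
    · rfl
    · intro d hd
      obtain ⟨m, hm, rfl⟩ := exists_of_mem_natSet hd
      exact Finset.dvd_prod_of_mem (fun m : ℕ+ => (m : ℕ)) hm

lemma charpoly_orEnd (M : Finset ℕ+) : (orEnd M).charpoly = orPoly M := by
  refine eq_of_monic_of_dvd_of_natDegree_le (orPoly_monic M) (orEnd M).charpoly_monic ?_ ?_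
  -- Evaluating Cayley–Hamilton at `1` shows that the defining polynomial divides the characteristic
  -- polynomial; both are monic of the same degree.
  · have h : aeval (orEnd M) (orEnd M).charpoly = 0 := LinearMap.aeval_self_charpoly _
    have hl : orEnd M = Algebra.lmul ℤ (OrBlock M) (AdjoinRoot.root (orPoly M)) := rfl
    generalize (orEnd M).charpoly = f at h
    rw [hl, aeval_algHom_apply, AdjoinRoot.aeval_eq] at h
    have h1 := LinearMap.congr_fun h 1
    rw [← AdjoinRoot.mk_eq_zero]
    simpa using h1
  · rw [LinearMap.charpoly_natDegree, finrank_adjoinRoot (orPoly_monic M)]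

lemma orPoly_dvd_orPoly {M N : Finset ℕ+} (h : M ⊆ N) : orPoly M ∣ orPoly N :=
  Finset.prod_dvd_prod_of_subset _ _ _ h

/-- The summand of the direct sum of modules with endomorphism, as an invariant submodule. -/
lemma PairIso.exists_submodule {ι : Type*} [DecidableEq ι] {M : ι → Type*}
    [∀ i, AddCommGroup (M i)] [∀ i, Module R (M i)] {f : ∀ i, Module.End R (M i)}
    (hg : PairIso g (DirectSum.lmap f)) :
    ∃ (B : ι → Submodule R G) (hB : ∀ i, ∀ x ∈ B i, g x ∈ B i), DirectSum.IsInternal B ∧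
      ∀ i, PairIso (f i) (g.restrict (hB i)) := by
  obtain ⟨e, he⟩ := hg
  let φ : ∀ i, M i →ₗ[R] G := fun i => e.symm.toLinearMap ∘ₗ DirectSum.lof R ι M i
  have hφ : ∀ i x, φ i x = e.symm (DirectSum.lof R ι M i x) := fun i x => rfl
  have hinj : ∀ i, Function.Injective (φ i) := fun i =>
    e.symm.injective.comp (DirectSum.of_injective i)
  have hφg : ∀ i x, g (φ i x) = φ i (f i x) := by
    intro i x
    rw [hφ, hφ, LinearEquiv.eq_symm_apply, he, e.apply_symm_apply, DirectSum.lmap_lof]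
  have hB : ∀ i, ∀ x ∈ LinearMap.range (φ i), g x ∈ LinearMap.range (φ i) := by
    rintro i _ ⟨x, rfl⟩
    exact ⟨f i x, (hφg i x).symm⟩
  let E : ∀ i, M i ≃ₗ[R] LinearMap.range (φ i) := fun i => LinearEquiv.ofInjective (φ i) (hinj i)
  refine ⟨fun i => LinearMap.range (φ i), hB, ?_, fun i => ⟨E i, fun x => Subtype.ext ?_⟩⟩
  · have hcomp : (DirectSum.coeLinearMap fun i => LinearMap.range (φ i)) ∘ₗ
        (DirectSum.congrLinearEquiv E).toLinearMap = e.symm.toLinearMap := by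
      refine DirectSum.linearMap_ext R fun i => LinearMap.ext fun x => ?_
      change DirectSum.coeLinearMap _ (DirectSum.lmap (fun i => (E i).toLinearMap)
        (DirectSum.lof R ι M i x)) = _
      rw [DirectSum.lmap_lof, DirectSum.coeLinearMap_lof]
      rfl
    have hb : Function.Bijective ((DirectSum.coeLinearMap fun i => LinearMap.range (φ i)) ∘
        DirectSum.congrLinearEquiv E) := by
      have : ((DirectSum.coeLinearMap fun i => LinearMap.range (φ i)) ∘
        DirectSum.congrLinearEquiv E) = e.symm := congrArg DFunLike.coe hcomp
      rw [this]
      exact e.symm.bijective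
    -- The canonical map from the sum of the submodules becomes `e.symm` after composition with an
    -- isomorphism, so it is bijective.
    exact (Function.Bijective.of_comp_iff _ (DirectSum.congrLinearEquiv E).bijective).1 hb
  · exact (hφg i x).symm

lemma PairIso.hasStandardOrlikDecomposition [IsDomain R] [IsPrincipalIdealRing R]
    [Module.Free R G] [Module.Finite R G] {k : ℕ} {M : Fin k → Type*} [∀ i, AddCommGroup (M i)]
    [∀ i, Module R (M i)] [∀ i, Module.Free R (M i)] [∀ i, Module.Finite R (M i)]
    {f : ∀ i, Module.End R (M i)} (hg : PairIso g (DirectSum.lmap f))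
    (hf : ∀ i, IsOrlikBlock (f i)) (hdvd : ∀ i j, i ≤ j → (f j).charpoly ∣ (f i).charpoly) :
    HasStandardOrlikDecomposition g := by
  obtain ⟨B, hB, hint, hiso⟩ := hg.exists_submodule
  refine ⟨k, B, hB, hint, fun i => (hiso i).isOrlikBlock (hf i), fun i j hij => ?_⟩
  rw [← (hiso i).charpoly_eq, ← (hiso j).charpoly_eq]
  exact hdvd i j hij

end OrlikBlocks

theorem PairIso.hasStandardOrlikDecomposition_of_orSumEnd {G : Type*} [AddCommGroup G] [Module ℤ G]
    [Module.Free ℤ G] [Module.Finite ℤ G] {g : Module.End ℤ G} {χ : ℕ+ →₀ ℕ}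
    (hg : PairIso g (orSumEnd χ)) : HasStandardOrlikDecomposition g := by
  refine PairIso.hasStandardOrlikDecomposition hg (fun i => isOrlikBlock_orEnd ?_)
    fun i j hij => ?_
  · obtain ⟨m, -, hm⟩ := (Finset.lt_sup_iff (f := χ)).1 i.2
    exact ⟨m, mem_coverSet.2 hm⟩
  · rw [charpoly_orEnd, charpoly_orEnd]
    refine orPoly_dvd_orPoly fun m hm => ?_
    rw [mem_coverSet] at hm ⊢
    exact lt_of_le_of_lt hij hm

end OrlikTensor

open OrlikTensor in
theorem theorem9p10 (χ₁ χ₂ : ℕ+ →₀ ℕ) (P : Finset Nat.Primes) (o₁ o₂ : P → ExcellentOrder)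
    (h₁ : IsCompatible χ₁ o₁) (h₂ : IsCompatible χ₂ o₂) :
    (∃! χ₃ : ℕ+ →₀ ℕ, polyTensor (cycloProd χ₁) (cycloProd χ₂) = cycloProd χ₃) ∧
    ∀ χ₃ : ℕ+ →₀ ℕ, polyTensor (cycloProd χ₁) (cycloProd χ₂) = cycloProd χ₃ →
      IsCompatible χ₃ (fun p => (o₁ p).tensor (o₂ p)) ∧
      PairIso (TensorProduct.map (orSumEnd χ₁) (orSumEnd χ₂)) (orSumEnd χ₃) ∧
      HasStandardOrlikDecomposition (TensorProduct.map (orSumEnd χ₁) (orSumEnd χ₂)) := by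
  -- The largest element of the tensor quadrant is the modulus `n`: both supports divide it, and its
  -- divisors are exactly the quadrant.
  have : NeZero (quadrantTop fun p => (o₁ p).tensor (o₂ p)) := ⟨quadrantTop_ne_zero _⟩
  obtain ⟨hd₁, hd₂⟩ := dvd_quadrantTop_tensor h₁ h₂
  have heq := polyTensor_cycloProd hd₁ hd₂
  refine ⟨⟨_, heq, fun χ hχ => cycloProd_injective (hχ.symm.trans heq)⟩, fun χ₃ h₃ => ?_⟩
  obtain rfl := cycloProd_injective (h₃.symm.trans heq)
  have hiso := pairIso_orSumEnd_tensor h₁ h₂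
  exact ⟨isCompatible_convFinsupp h₁ h₂, hiso, hiso.hasStandardOrlikDecomposition_of_orSumEnd⟩
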